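/- **Setting.** Let $G$ be a simple complex algebraic group of adjoint type with maximal torus $T$, simple roots $\alpha_i$ and simple coroots $\alpha_i^\vee$ ($i\in I$), opposite Borel subgroups $B\supset T$, $B^-\supset T$ with unipotent radicals $U$, $U^-$, and Chevalley generators $e_i,f_i$ with $[e_i,f_i]=\alpha_i^\vee$; let $x_i(a)=\exp(ae_i)$, $y_i(a)=\exp(af_i)$ be the corresponding one-parameter subgroups and $\chi_i^-:U^-\to\mathbb{G}_a$ the homomorphism with $\chi_i^-(y_j(a))=\delta_{ij}a$. Let $W$ be the Weyl group with simple reflections $s_i$, put $\overline{s_i}=x_i(-1)y_i(1)x_i(-1)$, and $\overline{w}=\overline{s_{i_1}}\cdots\overline{s_{i_m}}$ for a reduced decomposition $w=s_{i_1}\cdots s_{i_m}$. Let $I_P\subsetneq I$, let $Z(L_P)=\{t\in T:\alpha_i(t)=1\ \forall i\in I_P\}$, let $w_0$ and $w_0^P$ be the longest elements of $W$ and of $W_P=\langle s_i: i\in I_P\rangle$, and $w_P=w_0^Pw_0$. The parabolic geometric crystal is $X=B^-\cap U\,Z(L_P)\,\overline{w_P}\,U$. For $x=u_0t_0\in X$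 with $u_0\in U^-$, $t_0\in T$ put $\gamma(x)=t_0$, $\varphi_i(x)=\chi_i^-(u_0)$, $\varepsilon_i(x)=\varphi_i(x)\,\alpha_i(t_0)$, and define the rational maps $$e_i^c(x)=x_i\Big(\tfrac{c-1}{\varphi_i(x)}\Big)\,x\,x_i\Big(\tfrac{c^{-1}-1}{\varepsilon_i(x)}\Big)\quad(c\in\mathbb{C}^\times),\qquad s_i(x)=e_i^{1/\alpha_i(\gamma(x))}(x)$$ from $X$ to $X$. In the rational $W$-action of Berenstein and Kazhdan on $X$, an element $w=s_{j_1}\cdots s_{j_m}\in W$ (any expression, reduced or not) acts by the rational map $s_{j_1}\circ\cdots\circ s_{j_m}$. Let $T_{>0}$ be the monoid generated by all $\alpha_i^\vee(a)$, and $G_{\ge0}$ the monoid generated by all $\alpha_i^\vee(a),x_i(a),y_i(a)$, with $i\in I$ and $a\in\mathbb{R}_{>0}$. The totally positive part of $X$ is $$X_{>0}=\{\,t x:\ t\in Z(L_P)\cap T_{>0},\ x\in B^-\cap U\overline{w_P}U\cap G_{\ge0}\,\}.$$ **Lemma.** $X_{>0}$ lies in the domain of definition of the $W$-action and is preserved by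 it. More precisely: 1. For every $i\in I$ and every real $c>0$, the rational map $e_i^c$ is defined and regular at every point of $X_{>0}$ (in particular $\varphi_i$ and $\varepsilon_i$ do not vanish on $X_{>0}$), and $e_i^c(X_{>0})=X_{>0}$. 2. For every $w\in W$ and every expression $w=s_{j_1}\cdots s_{j_m}$, the successive composite $s_{j_1}\circ\cdots\circ s_{j_m}$ is defined and regular (on a Zariski neighbourhood in $X$) at every point of $X_{>0}$, and maps $X_{>0}$ onto $X_{>0}$. -/

import Mathlib

open LieAlgebra LieSubalgebra

noncomputable section

namespace GeometricCrystal

/-! ### The adjoint group and its standard subgroups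

`L` is a simple complex Lie algebra, `b : LieAlgebra.Basis ι H` fixes the Cartan subalgebra `H`, the
simple roots `α_i` (with index set `ι`), and Chevalley generators `e_i`, `f_i`, `h_i = [e_i, f_i]`.
The simple group of adjoint type with Lie algebra `L` is the group of inner automorphisms of `L`,
realised inside the general linear group of `L` (through the adjoint representation). -/

section ExpAd

variable {L : Type*} [LieRing L] [LieAlgebra ℂ L]

/-- The automorphism `exp (ad z)` of `L` for an ad-nilpotent element `z` (and `1` otherwise). -/
def expAd (z : L) : L ≃ₗ[ℂ] L :=
  letI : Module ℚ (Module.End ℂ L) := Module.compHom _ (algebraMap ℚ ℂ)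
  open Classical in
  if h : IsNilpotent (ad ℂ L z) then
    LinearEquiv.ofLinearMap (IsNilpotent.exp (ad ℂ L z)) (IsNilpotent.exp (-(ad ℂ L z)))
      (IsNilpotent.exp_mul_exp_neg_self h) (IsNilpotent.exp_neg_mul_exp_self h)
  else 1

/-- `exp (ad z)` is given by the exponential series. -/
theorem expAd_apply {z : L} {n : ℕ} (h : ad ℂ L z ^ n = 0) (v : L) :
    expAd z v = ∑ k ∈ Finset.range n, ((k.factorial : ℂ)⁻¹) • ((ad ℂ L z ^ k) v) := by
  let _ : Module ℚ (Module.End ℂ L) := Module.compHom _ (algebraMap ℚ ℂ)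
  have hn : IsNilpotent (ad ℂ L z) := ⟨n, h⟩
  have h1 : expAd z v = (IsNilpotent.exp (ad ℂ L z)) v := by
    simp only [expAd, dif_pos hn]
    rfl
  rw [h1, IsNilpotent.exp_eq_sum h, LinearMap.sum_apply]
  refine Finset.sum_congr rfl fun k _ => ?_
  have h2 : ((k.factorial : ℚ)⁻¹ • (ad ℂ L z ^ k) : Module.End ℂ L)
      = ((algebraMap ℚ ℂ) (k.factorial : ℚ)⁻¹) • (ad ℂ L z ^ k) := rfl
  rw [h2, LinearMap.smul_apply]
  simp

variable (L) in
/-- The adjoint group `G` of `L`. -/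
def adjointGroup : Subgroup (L ≃ₗ[ℂ] L) :=
  Subgroup.closure {g | ∃ z : L, IsNilpotent (ad ℂ L z) ∧ g = expAd z}

/-- The maximal torus `T` of `G` with Lie algebra `H`: the elements of `G` fixing `H` pointwise. -/
def torus (H : LieSubalgebra ℂ L) : Subgroup (L ≃ₗ[ℂ] L) where
  carrier := {g | g ∈ adjointGroup L ∧ ∀ h ∈ H, g h = h}
  mul_mem' {g k} hg hk :=
    ⟨mul_mem hg.1 hk.1, fun h hh => by rw [LinearEquiv.mul_apply, hk.2 h hh, hg.2 h hh]⟩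
  one_mem' := ⟨one_mem _, fun _ _ => rfl⟩
  inv_mem' {g} hg :=
    ⟨inv_mem hg.1, fun h hh => by
      conv_lhs => rw [← hg.2 h hh]
      exact g.symm_apply_apply h⟩

end ExpAd

section Group

variable {L : Type*} [LieRing L] [LieAlgebra ℂ L]
  {H : LieSubalgebra ℂ L} {ι : Type*} [Fintype ι] (b : LieAlgebra.Basis ι H)

/-- The unipotent radical `U` of the Borel subgroup `B`, generated by the exponentials of elements
of the sum of the positive root spaces (the subalgebra generated by the `e_i`). -/
def unipUpper : Subgroup (L ≃ₗ[ℂ] L) :=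
  Subgroup.closure {g | ∃ z ∈ lieSpan ℂ L (Set.range b.e), g = expAd z}

/-- The unipotent radical `U⁻` of the opposite Borel subgroup `B⁻`. -/
def unipLower : Subgroup (L ≃ₗ[ℂ] L) :=
  Subgroup.closure {g | ∃ z ∈ lieSpan ℂ L (Set.range b.f), g = expAd z}

/-- The opposite Borel subgroup `B⁻ = U⁻ T`. -/
def borelMinus : Set (L ≃ₗ[ℂ] L) :=
  {g | ∃ u ∈ unipLower b, ∃ t ∈ torus H, g = u * t}

/-- The one-parameter subgroup `x_i`. -/
def xRoot (i : ι) (a : ℂ) : L ≃ₗ[ℂ] L := expAd (a • b.e i)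

/-- The one-parameter subgroup `y_i`. -/
def yRoot (i : ι) (a : ℂ) : L ≃ₗ[ℂ] L := expAd (a • b.f i)

/-- The value at `a ≠ 0` of the simple coroot `α_i^∨ : 𝔾_m → T`, i.e. the image of
`diag (a, a⁻¹)` under the homomorphism `SL₂ → G` given by `x_i` and `y_i`. In `SL₂` the matrix
`diag (a, a⁻¹)` is the product of `!![0, a; -a⁻¹, 0]` and the inverse of `!![0, 1; -1, 0]`. -/
def simpleCoroot (i : ι) (a : ℂ) : L ≃ₗ[ℂ] L :=
  (xRoot b i a * yRoot b i (-a⁻¹) * xRoot b i a) *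
    (xRoot b i 1 * yRoot b i (-1) * xRoot b i 1)⁻¹

/-- The value `α_i(t)` of the simple root `α_i` at `t ∈ T`: the scalar by which `t` acts on the
root space of `α_i`, which is spanned by `e_i`. -/
def simpleRoot (i : ι) (t : L ≃ₗ[ℂ] L) : ℂ :=
  Classical.epsilon fun c : ℂ => t (b.e i) = c • b.e i

/-- The center `Z(L_P)` of the Levi subgroup of the parabolic subgroup given by `IP`: the elements
`t` of `T` with `α_i(t) = 1` for all `i ∈ IP`. -/
def leviCenter (IP : Set ι) : Set (L ≃ₗ[ℂ] L) :=
  {t | t ∈ torus H ∧ ∀ i ∈ IP, t (b.e i) = b.e i}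

/-- The representative `x_i(-1) y_i(1) x_i(-1)` of the simple reflection `s_i`. -/
def sBar (i : ι) : L ≃ₗ[ℂ] L := xRoot b i (-1) * yRoot b i 1 * xRoot b i (-1)

/-- The product of the representatives of the letters of a word. If the word is a reduced
decomposition of `w`, this is the standard representative of `w` in the normalizer of `T`. -/
def wBar (ii : List ι) : L ≃ₗ[ℂ] L := (ii.map (sBar b)).prod

end Group

/-! ### The Weyl group -/

section Weyl

variable {L : Type*} [LieRing L] [LieAlgebra ℂ L] [FiniteDimensional ℂ L] [IsSimple ℂ L]
  {H : LieSubalgebra ℂ L} [H.IsCartanSubalgebra] {ι : Type*} [Fintype ι] (b : LieAlgebra.Basis ι H)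

/-- The simple reflection `s_i` in the Weyl group. -/
def simpleReflection (i : ι) : (IsKilling.rootSystem H).weylGroup :=
  RootPairing.weylGroup.ofIdx (IsKilling.rootSystem H) (b.baseSupp' i)

/-- The product `s_{i_1} ⋯ s_{i_m}` in the Weyl group. -/
def wordProd (ii : List ι) : (IsKilling.rootSystem H).weylGroup :=
  (ii.map (simpleReflection b)).prod

/-- The length of an element of the Weyl group with respect to the simple reflections. -/
def weylLength (w : (IsKilling.rootSystem H).weylGroup) : ℕ :=
  sInf {n | ∃ ii : List ι, ii.length = n ∧ wordProd b ii = w}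

/-- `ii` is a reduced decomposition of `w`. -/
def IsReducedWord (ii : List ι) (w : (IsKilling.rootSystem H).weylGroup) : Prop :=
  wordProd b ii = w ∧ ii.length = weylLength b w

/-- The parabolic subgroup `W_J` generated by the `s_j` with `j ∈ J`. -/
def parabolicSubgroup (J : Set ι) : Subgroup (IsKilling.rootSystem H).weylGroup :=
  Subgroup.closure (simpleReflection b '' J)

/-- `w` is the longest element of `W_J`. -/
def IsLongest (J : Set ι) (w : (IsKilling.rootSystem H).weylGroup) : Prop :=
  w ∈ parabolicSubgroup b J ∧ ∀ v ∈ parabolicSubgroup b J, weylLength b v ≤ weylLength b w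

/-- `ii` is a reduced decomposition of `w_P = w_0^P w_0`, where `w_0` is the longest element of `W`
and `w_0^P` the longest element of `W_P`. -/
def IsReducedWordWP (IP : Set ι) (ii : List ι) : Prop :=
  ∃ w₀ w₀P : (IsKilling.rootSystem H).weylGroup,
    IsLongest b Set.univ w₀ ∧ IsLongest b IP w₀P ∧ IsReducedWord b ii (w₀P * w₀)

end Weyl

/-! ### The parabolic geometric crystal and its totally positive part -/

section Crystal

variable {L : Type*} [LieRing L] [LieAlgebra ℂ L]
  {H : LieSubalgebra ℂ L} {ι : Type*} [Fintype ι] (b : LieAlgebra.Basis ι H)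

/-- The parabolic geometric crystal `X = B⁻ ∩ U Z(L_P) w̄_P U`; here and below `ii` is a reduced
decomposition of `w_P`. -/
def crystal (IP : Set ι) (ii : List ι) : Set (L ≃ₗ[ℂ] L) :=
  {x | x ∈ borelMinus b ∧ ∃ u₁ ∈ unipUpper b, ∃ t ∈ leviCenter b IP, ∃ u₂ ∈ unipUpper b,
    x = u₁ * t * wBar b ii * u₂}

/-- The unipotent-type cell `B⁻_{w_P} = B⁻ ∩ U w̄_P U`. -/
def bruhatCell (ii : List ι) : Set (L ≃ₗ[ℂ] L) :=
  {x | x ∈ borelMinus b ∧ ∃ u₁ ∈ unipUpper b, ∃ u₂ ∈ unipUpper b, x = u₁ * wBar b ii * u₂}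

/-- `T_{>0}`: the submonoid generated by the `α_i^∨(a)` with `a > 0`. -/
def torusPos : Submonoid (L ≃ₗ[ℂ] L) :=
  Submonoid.closure {g | ∃ i : ι, ∃ a : ℝ, 0 < a ∧ g = simpleCoroot b i a}

/-- `G_{≥0}`: the submonoid generated by the `α_i^∨(a)`, `x_i(a)` and `y_i(a)` with `a > 0`. -/
def groupNonneg : Submonoid (L ≃ₗ[ℂ] L) :=
  Submonoid.closure {g | ∃ i : ι, ∃ a : ℝ, 0 < a ∧
    (g = simpleCoroot b i a ∨ g = xRoot b i a ∨ g = yRoot b i a)}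

/-- The totally positive part of the crystal: the products `t x` with `t ∈ Z(L_P) ∩ T_{>0}` and
`x ∈ B⁻_{w_P} ∩ G_{≥0}`. -/
def crystalPos (IP : Set ι) (ii : List ι) : Set (L ≃ₗ[ℂ] L) :=
  {g | ∃ t ∈ leviCenter b IP, t ∈ torusPos b ∧
    ∃ x ∈ bruhatCell b ii, x ∈ groupNonneg b ∧ g = t * x}

/-- The weight map `γ`: for `x = u₀ t₀` with `u₀ ∈ U⁻` and `t₀ ∈ T` it gives `t₀`. -/
def weight (x : L ≃ₗ[ℂ] L) : L ≃ₗ[ℂ] L :=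
  Classical.epsilon fun t => t ∈ torus H ∧ x * t⁻¹ ∈ unipLower b

/-- The additive character `χ_i⁻` of `U⁻` with `χ_i⁻(y_j(a)) = δ_{ij} a`, as a matrix coefficient of
the adjoint representation: for `u ∈ U⁻` the component of `u h_i` in the root space of `-α_i` is
`2 χ_i⁻(u) f_i`. See `lowerChar_mul` and `lowerChar_yRoot`. -/
def lowerChar (i : ι) (u : L ≃ₗ[ℂ] L) : ℂ :=
  killingForm ℂ L (b.e i) (u (b.h i)) / (2 * killingForm ℂ L (b.e i) (b.f i))

/-- `φ_i(x) = χ_i⁻(u₀)` for `x = u₀ t₀` with `u₀ ∈ U⁻`, `t₀ ∈ T`. -/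
def phi (i : ι) (x : L ≃ₗ[ℂ] L) : ℂ := lowerChar b i (x * (weight b x)⁻¹)

/-- `ε_i(x) = χ_i⁻(u₀) α_i(t₀)` for `x = u₀ t₀` with `u₀ ∈ U⁻`, `t₀ ∈ T`. -/
def eps (i : ι) (x : L ≃ₗ[ℂ] L) : ℂ := phi b i x * simpleRoot b i (weight b x)

/-- The rational map `e_i^c` on the crystal, as a partial map which is defined at those `x` in the
crystal at which the denominators `φ_i(x)`, `ε_i(x)` of the defining formula do not vanish. -/
def eAct (IP : Set ι) (ii : List ι) (i : ι) (c : ℂ) : (L ≃ₗ[ℂ] L) →. (L ≃ₗ[ℂ] L) := fun x =>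
  ⟨x ∈ crystal b IP ii ∧ c ≠ 0 ∧ phi b i x ≠ 0 ∧ eps b i x ≠ 0,
    fun _ => xRoot b i ((c - 1) / phi b i x) * x * xRoot b i ((c⁻¹ - 1) / eps b i x)⟩

/-- The rational map `s_i(x) = e_i^{1 / α_i(γ(x))}(x)` on the crystal. -/
def sAct (IP : Set ι) (ii : List ι) (i : ι) : (L ≃ₗ[ℂ] L) →. (L ≃ₗ[ℂ] L) := fun x =>
  eAct b IP ii i (1 / simpleRoot b i (weight b x)) x

/-- The composite rational map `s_{j_1} ∘ ⋯ ∘ s_{j_m}` on the crystal, as a composite of partial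
maps. If `s_{j_1} ⋯ s_{j_m} = w` in the Weyl group, it represents the action of `w`. -/
def wordAct (IP : Set ι) (ii : List ι) : List ι → ((L ≃ₗ[ℂ] L) →. (L ≃ₗ[ℂ] L))
  | [] => fun x => ⟨x ∈ crystal b IP ii, fun _ => x⟩
  | j :: js => (sAct b IP ii j).comp (wordAct IP ii js)

variable (L) in
/-- The coordinate ring of `G`: the functions generated by the matrix coefficients of the adjoint
representation. (As `G` preserves the Killing form, it contains those of the inverse too.) -/
def coordRing : Subalgebra ℂ ((L ≃ₗ[ℂ] L) → ℂ) :=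
  Algebra.adjoin ℂ {p | ∃ (ξ : Module.Dual ℂ L) (v : L), p = fun g => ξ (g v)}

/-- The partial self-map `f` of the subvariety `X` of `G` is defined and regular on a neighbourhood
of `x` in the Zariski topology of `X`: on some basic open neighbourhood `{q ≠ 0}` of `x` in `X` it
is defined, takes values in `X`, and pulls regular functions back to functions `r / q ^ n`. -/
def IsRegularAt (X : Set (L ≃ₗ[ℂ] L)) (f : (L ≃ₗ[ℂ] L) →. (L ≃ₗ[ℂ] L)) (x : L ≃ₗ[ℂ] L) : Prop :=
  x ∈ X ∧ ∃ q ∈ coordRing L, q x ≠ 0 ∧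
    (∀ y ∈ X, q y ≠ 0 → ∃ z ∈ f y, z ∈ X) ∧
    ∀ p ∈ coordRing L, ∃ r ∈ coordRing L, ∃ n : ℕ,
      ∀ y ∈ X, q y ≠ 0 → ∀ z ∈ f y, p z = r y / q y ^ n

end Crystal

/-! ### The additive characters of `U⁻` -/

section LowerChar

variable {L : Type*} [LieRing L] [LieAlgebra ℂ L]
  {H : LieSubalgebra ℂ L} {ι : Type*} [Fintype ι] (b : LieAlgebra.Basis ι H)

/-- An element of the Cartan subalgebra on which all simple roots take the value `1`. -/
theorem exists_grading : ∃ ρ : L, (∀ i, ⁅ρ, b.e i⁆ = b.e i) ∧ (∀ i, ⁅ρ, b.f i⁆ = -b.f i) ∧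
    ∀ i, ⁅ρ, b.h i⁆ = 0 := by
  classical
  let A : Matrix ι ι ℂ := (Int.castRingHom ℂ).mapMatrix b.A
  have hA : IsUnit A.det := by
    have h0 : A.det = ((b.A.det : ℤ) : ℂ) := by
      rw [show A = (Int.castRingHom ℂ).mapMatrix b.A from rfl, ← RingHom.map_det]; rfl
    rw [h0, isUnit_iff_ne_zero]
    exact_mod_cast b.nondegen.det_ne_zero
  let c : ι → ℂ := A⁻¹.mulVec 1
  have hc : ∀ i, ∑ j, c j * (b.A i j : ℂ) = 1 := by
    intro i
    have h1 : A.mulVec c = 1 := by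
      simp only [c, Matrix.mulVec_mulVec, Matrix.mul_nonsing_inv A hA, Matrix.one_mulVec]
    have h2 := congrFun h1 i
    simp only [Matrix.mulVec, dotProduct, Pi.one_apply] at h2
    rw [← h2]
    exact Finset.sum_congr rfl fun j _ => mul_comm _ _
  refine ⟨∑ j, c j • b.h j, fun i => ?_, fun i => ?_, fun i => ?_⟩
  · simp only [sum_lie, smul_lie, b.lie_h_e, ← Int.cast_smul_eq_zsmul ℂ, smul_smul]
    rw [← Finset.sum_smul, hc, one_smul]
  · simp only [sum_lie, smul_lie, b.lie_h_f, ← Int.cast_smul_eq_zsmul ℂ, smul_smul, Int.cast_neg]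
    rw [← Finset.sum_smul]
    simp only [mul_neg, Finset.sum_neg_distrib, hc, neg_smul, one_smul]
  · simp [sum_lie, smul_lie, b.lie_h_h]

/-- The elements of degree at most `-m` for the grading given by `ρ`. -/
def gradedBelow (ρ : L) (m : ℕ) : Submodule ℂ L :=
  Submodule.span ℂ {w | ∃ k : ℕ, m ≤ k ∧ ⁅ρ, w⁆ = -(k : ℂ) • w}

theorem lie_mem_gradedBelow {ρ : L} {m n : ℕ} {z w : L} (hz : z ∈ gradedBelow ρ m)
    (hw : w ∈ gradedBelow ρ n) : ⁅z, w⁆ ∈ gradedBelow ρ (m + n) := by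
  induction hz using Submodule.span_induction with
  | zero => simp
  | add x y _ _ hx hy => rw [add_lie]; exact add_mem hx hy
  | smul a x _ hx => rw [smul_lie]; exact Submodule.smul_mem _ _ hx
  | mem x hx =>
    obtain ⟨k, hk, hk'⟩ := hx
    induction hw using Submodule.span_induction with
    | zero => simp
    | add x y _ _ hx hy => rw [lie_add]; exact add_mem hx hy
    | smul a x _ hx => rw [lie_smul]; exact Submodule.smul_mem _ _ hx
    | mem y hy =>
      obtain ⟨l, hl, hl'⟩ := hy
      refine Submodule.subset_span ⟨k + l, by omega, ?_⟩
      rw [leibniz_lie, hk', hl', smul_lie, lie_smul, ← add_smul]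
      congr 1
      push_cast
      ring

theorem gradedBelow_anti (ρ : L) {m n : ℕ} (h : m ≤ n) : gradedBelow ρ n ≤ gradedBelow ρ m :=
  Submodule.span_mono fun _ ⟨k, hk, hk'⟩ => ⟨k, h.trans hk, hk'⟩

theorem lower_le_gradedBelow {ρ : L} (hρ : ∀ i, ⁅ρ, b.f i⁆ = -b.f i) {z : L}
    (hz : z ∈ lieSpan ℂ L (Set.range b.f)) : z ∈ gradedBelow ρ 1 := by
  induction hz using lieSpan_induction with
  | mem x hx =>
    obtain ⟨i, rfl⟩ := hx
    exact Submodule.subset_span ⟨1, le_rfl, by simp [hρ]⟩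
  | zero => exact zero_mem _
  | add x y _ _ hx hy => exact add_mem hx hy
  | smul a x _ hx => exact Submodule.smul_mem _ _ hx
  | lie x y _ _ hx hy => exact gradedBelow_anti ρ (by omega) (lie_mem_gradedBelow hx hy)

theorem expAd_inv (z : L) : (expAd z)⁻¹ = expAd (-z) := by
  by_cases h : IsNilpotent (ad ℂ L z)
  · have h' : IsNilpotent (ad ℂ L (-z)) := by rw [map_neg]; exact h.neg
    let _ : Module ℚ (Module.End ℂ L) := Module.compHom _ (algebraMap ℚ ℂ)
    apply LinearEquiv.toLinearMap_injective
    have h1 : ((expAd z)⁻¹ : L ≃ₗ[ℂ] L).toLinearMap = IsNilpotent.exp (-(ad ℂ L z)) := by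
      simp only [expAd, dif_pos h]; rfl
    have h2 : (expAd (-z)).toLinearMap = IsNilpotent.exp (ad ℂ L (-z)) := by
      simp only [expAd, dif_pos h']; rfl
    rw [h1, h2, map_neg]
  · have h' : ¬ IsNilpotent (ad ℂ L (-z)) := by rw [map_neg, isNilpotent_neg_iff]; exact h
    simp only [expAd, dif_neg h, dif_neg h', inv_one]

/-- If `(ad z) v` lies in a subspace stable under `ad z`, then so does `exp (ad z) v - v`. -/
theorem expAd_sub_mem {z v : L} (N : Submodule ℂ L) (h1 : ⁅z, v⁆ ∈ N)
    (h2 : ∀ w ∈ N, ⁅z, w⁆ ∈ N) : expAd z v - v ∈ N := by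
  by_cases h : IsNilpotent (ad ℂ L z)
  · obtain ⟨n, hn⟩ := h
    have hn' : ad ℂ L z ^ (n + 1) = 0 := by rw [pow_succ, hn, zero_mul]
    rw [expAd_apply hn', Finset.sum_range_succ']
    simp only [Nat.factorial_zero, Nat.cast_one, inv_one, pow_zero, one_smul, Module.End.one_apply,
      add_sub_cancel_right]
    refine Submodule.sum_mem _ fun k hk => Submodule.smul_mem _ _ ?_
    clear hk
    induction k with
    | zero => simpa using h1
    | succ k ih => rw [pow_succ', Module.End.mul_apply]; exact h2 _ ih
  · simp only [expAd, dif_neg h]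
    simp

theorem unipLower_apply_sub {ρ : L} (hρ : ∀ i, ⁅ρ, b.f i⁆ = -b.f i)
    {u : L ≃ₗ[ℂ] L} (hu : u ∈ unipLower b) (m : ℕ) (v : L) (hv : ⁅ρ, v⁆ = -(m : ℂ) • v) :
    u v - v ∈ gradedBelow ρ (m + 1) := by
  have key : ∀ z ∈ lieSpan ℂ L (Set.range b.f), ∀ m, ∀ w ∈ gradedBelow ρ m,
      expAd z w - w ∈ gradedBelow ρ (m + 1) := fun z hz m w hw =>
    expAd_sub_mem _ (by rw [add_comm]; exact lie_mem_gradedBelow (lower_le_gradedBelow b hρ hz) hw)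
      fun w hw => gradedBelow_anti ρ (by omega)
        (lie_mem_gradedBelow (lower_le_gradedBelow b hρ hz) hw)
  have main : ∀ m, ∀ w ∈ gradedBelow ρ m, u w - w ∈ gradedBelow ρ (m + 1) := by
    induction hu using Subgroup.closure_induction'' with
    | mem g hg => obtain ⟨z, hz, rfl⟩ := hg; exact key z hz
    | inv_mem g hg =>
      obtain ⟨z, hz, rfl⟩ := hg
      rw [expAd_inv]
      exact key _ (neg_mem hz)
    | one => intro m w _; simp
    | mul g k _ _ hg hk =>
      intro m w hw
      have h1 := hk m w hw
      have h2 := hg _ _ h1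
      have h3 := hg m w hw
      have : (g * k) w - w = (g (k w - w) - (k w - w)) + (k w - w) + (g w - w) := by
        rw [LinearEquiv.mul_apply, map_sub]; abel
      rw [this]
      exact add_mem (add_mem (gradedBelow_anti ρ (by omega) h2) h1) h3
  exact main m v (Submodule.subset_span ⟨m, le_rfl, hv⟩)

theorem killingForm_e_gradedBelow {ρ : L} (hρ : ∀ i, ⁅ρ, b.e i⁆ = b.e i) (i : ι) {w : L}
    (hw : w ∈ gradedBelow ρ 2) : killingForm ℂ L (b.e i) w = 0 := by
  induction hw using Submodule.span_induction with
  | zero => simp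
  | add x y _ _ hx hy => rw [map_add, hx, hy, add_zero]
  | smul a x _ hx => rw [map_smul, hx, smul_zero]
  | mem x hx =>
    obtain ⟨k, hk, hk'⟩ := hx
    have h1 := LieModule.traceForm_apply_lie_apply' ℂ L L ρ (b.e i) x
    rw [hρ, hk', map_smul, smul_eq_mul] at h1
    have h2 : ((k : ℂ) - 1) * killingForm ℂ L (b.e i) x = 0 := by
      linear_combination -h1
    rcases mul_eq_zero.mp h2 with h3 | h3
    · exfalso
      have h4 : (k : ℂ) = ((1 : ℕ) : ℂ) := by rw [Nat.cast_one]; exact sub_eq_zero.mp h3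
      have := Nat.cast_injective h4
      omega
    · exact h3

theorem killingForm_e_h (i j : ι) : killingForm ℂ L (b.e i) (b.h j) = 0 := by
  obtain ⟨ρ, hρ, -, hρh⟩ := exists_grading b
  have h1 := LieModule.traceForm_apply_lie_apply' ℂ L L ρ (b.e i) (b.h j)
  rw [hρ, hρh, map_zero, neg_zero] at h1
  exact h1

/-- `χ_i⁻` is a group homomorphism on `U⁻`. -/
theorem lowerChar_mul (i : ι) {u v : L ≃ₗ[ℂ] L} (hu : u ∈ unipLower b) (hv : v ∈ unipLower b) :
    lowerChar b i (u * v) = lowerChar b i u + lowerChar b i v := by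
  obtain ⟨ρ, hρe, hρf, hρh⟩ := exists_grading b
  have h1 : v (b.h i) - b.h i ∈ gradedBelow ρ 1 :=
    unipLower_apply_sub b hρf hv 0 _ (by simp [hρh])
  have h2 : ∀ w ∈ gradedBelow ρ 1, killingForm ℂ L (b.e i) (u w - w) = 0 := by
    intro w hw
    induction hw using Submodule.span_induction with
    | zero => simp
    | add x y _ _ hx hy =>
      rw [map_add, show u x + u y - (x + y) = (u x - x) + (u y - y) by abel, map_add, hx, hy,
        add_zero]
    | smul a x _ hx => rw [map_smul, ← smul_sub, map_smul, hx, smul_zero]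
    | mem x hx =>
      obtain ⟨k, hk, hk'⟩ := hx
      exact killingForm_e_gradedBelow b hρe i
        (gradedBelow_anti ρ (by omega) (unipLower_apply_sub b hρf hu k x hk'))
  have h3 := h2 _ h1
  have h4 : killingForm ℂ L (b.e i) ((u * v) (b.h i)) =
      killingForm ℂ L (b.e i) (u (b.h i)) + killingForm ℂ L (b.e i) (v (b.h i)) := by
    have h5 := killingForm_e_h b i i
    rw [map_sub, map_sub, map_sub, map_sub, h5] at h3
    rw [LinearEquiv.mul_apply]
    linear_combination h3
  rw [lowerChar, lowerChar, lowerChar, h4, add_div]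

/-- `χ_i⁻(y_j(a)) = δ_{ij} a`. -/
theorem lowerChar_yRoot [FiniteDimensional ℂ L] [IsSimple ℂ L] [DecidableEq ι] (i j : ι) (a : ℂ) :
    lowerChar b i (yRoot b j a) = if i = j then a else 0 := by
  have : H.IsCartanSubalgebra := b.isCartanSubalgebra
  have hf : ∀ j, b.f j ∈ rootSpace H (-b.baseSupp j) := fun j =>
    (LieModule.mem_genWeightSpace _ _ _).mpr fun ⟨z, hz⟩ ↦
      ⟨1, by simp [← eq_neg_iff_add_eq_zero]⟩
  have he : b.e i ∈ rootSpace H (b.baseSupp i) :=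
    (LieModule.mem_genWeightSpace _ _ _).mpr fun ⟨z, hz⟩ ↦ ⟨1, by simp⟩
  have hne : (-b.baseSupp j : H → ℂ) ≠ 0 := by
    intro h0
    have h1 := congrFun h0 (b.h' j)
    have h2 : (b.baseSupp j (b.h' j) : ℂ) = 0 := neg_eq_zero.mp h1
    rw [b.baseSupp_apply_h' j j] at h2
    have : IsAddTorsionFree L := .of_isTorsionFree ℂ L
    rw [b.A_diag_eq_two] at h2
    norm_num at h2
  have hnil : IsNilpotent (ad ℂ L (b.f j)) := isNilpotent_ad_of_mem_rootSpace H hne (hf j)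
  have hnil' : IsNilpotent (ad ℂ L (a • b.f j)) := by
    rw [map_smul]; exact hnil.smul a
  obtain ⟨n, hn⟩ := hnil'
  have hn' : ad ℂ L (a • b.f j) ^ (n + 2) = 0 := by rw [pow_add, hn, zero_mul]
  have hfh : ⁅b.f j, b.h i⁆ = b.A j i • b.f j := by
    rw [← lie_skew, b.lie_h_f, neg_smul, neg_neg]
  have hy : yRoot b j a (b.h i) = b.h i + (a * b.A j i) • b.f j := by
    rw [yRoot, expAd_apply hn', Finset.sum_range_succ', Finset.sum_range_succ']
    have h0 : ∑ k ∈ Finset.range n, (((k + 1 + 1).factorial : ℂ)⁻¹) •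
        ((ad ℂ L (a • b.f j) ^ (k + 1 + 1)) (b.h i)) = 0 := by
      refine Finset.sum_eq_zero fun k _ => ?_
      rw [pow_add, pow_add, pow_one, mul_assoc, Module.End.mul_apply, Module.End.mul_apply]
      simp [hfh]
    rw [h0]
    simp [hfh, ← Int.cast_smul_eq_zsmul ℂ, smul_smul, add_comm]
  have hef : killingForm ℂ L (b.e i) (b.f i) ≠ 0 := by
    intro h0
    have hfi : b.f i ∈ rootSpace H (-(b.baseSupp' i).val : H → ℂ) := hf i
    have hei : b.e i ∈ rootSpace H ((b.baseSupp' i).val : H → ℂ) := he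
    have h1 := IsKilling.lie_eq_killingForm_smul_of_mem_rootSpace_of_mem_rootSpace_neg hei hfi
    rw [(b.sl2 i).lie_e_f, h0, zero_smul] at h1
    exact (b.sl2 i).h_ne_zero h1
  have hij : i ≠ j → killingForm ℂ L (b.e i) (b.f j) = 0 := by
    intro hne'
    have h1 := LieModule.traceForm_apply_lie_apply ℂ L L (b.h i) (b.e i) (b.f j)
    rw [b.lie_e_f_ne i j hne', (b.sl2 i).lie_h_e_nsmul, map_zero, map_nsmul,
      LinearMap.smul_apply] at h1
    simpa using h1
  rw [lowerChar, hy, map_add, killingForm_e_h, map_smul, smul_eq_mul, zero_add]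
  split_ifs with h
  · subst h
    have : IsAddTorsionFree L := .of_isTorsionFree ℂ L
    rw [b.A_diag_eq_two]
    push_cast
    field_simp
  · rw [hij h]; simp

end LowerChar

end GeometricCrystal

end

/-!
The totally positive part of the crystal is stable under the maps `e_i^c` because of the relation
`x_i(s) y_i(a) = y_i(a / (1 + s a)) α_i^∨(1 + s a) x_i(s / (1 + s a))` in `SL₂`
(`xRoot_mul_yRoot`), which has an algebraic and a positive use.

On `B⁻`, an element `u` of `U⁻` is written as `y_i(χ_i⁻(u)) n`, with `n` in the unipotent radical of
a minimal parabolic subgroup, which `x_i` and `T` normalize (`exists_yRoot_mul`). This rests on the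
fact that an automorphism of `L` of negative degree agrees to leading order with a derivation, which
is inner (`IsLower.exists_lie`). The relation then computes the Gauss decomposition of `e_i^c(x)`
(`exists_eq_mul_simpleCoroot`, `eMap_spec`): `e_i^c` stays in the crystal, divides `φ_i` by `c`,
multiplies `γ` by `α_i^∨(c)`, and has the inverse `e_i^{1/c}`. In particular `s_i` is an involution.
As `φ_i` and `α_i ∘ γ` are matrix coefficients of the adjoint representation, all maps are regular
where `φ_i` does not vanish (`isRegularAt_eAct`), and so are their composites (`IsRegularAt.comp`).

For positivity, a totally nonnegative element of `B⁻` is a product of factors `y_j(a)`, `a > 0`, and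
of an element of `T_{>0}`. The factor `x_i(s)` can be moved past such a product with all parameters
remaining positive as long as `1 + s φ_i > 0` (`exists_xRoot_mul_lowerNonneg`); for
`s = (c - 1) / φ_i` this number is `c`, so `e_i^c` preserves total nonnegativity for `c > 0`.

It remains to see that `φ_i` does not vanish on the totally nonnegative part of `B⁻ ∩ U w̄_P U`
(`phi_ne_zero`). If `φ_i(x) = 0`, then no factor `y_i(a)` occurs in `x`, and `x` fixes the
fundamental coweight `ω_i`. Comparing components in `H` in `x = u₁ w̄_P u₂`, one gets
`κ(ω_k, ω_i) = κ(w_P⁻¹ ω_k, ω_i)` for the Killing form `κ` and any `k ∉ I_P`. Here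
`κ(h, h') = ∑ β(h) β(h')`, the sum over all roots `β`, and `W_P` fixes `ω_k`, so the left hand side
is a sum of terms `β(ω_k) β(ω_i) ≥ 0` and the right hand side a sum of terms
`(w₀ β)(ω_k) β(ω_i) ≤ 0`, because `w₀` maps positive roots to negative roots
(`IsLongest.neg_smul_mem_closure`). Hence all terms vanish and `ad ω_i ∘ ad ω_k = 0`, which is
impossible in a simple Lie algebra (`exists_lie_lie_ne_zero`).
-/

noncomputable section

namespace GeometricCrystal

/-! ### Inner automorphisms -/

section Automorphisms

variable {L : Type*} [LieRing L] [LieAlgebra ℂ L]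

variable (L) in
/-- The group of automorphisms of the Lie algebra `L`, inside the general linear group of `L`. -/
def lieAut : Subgroup (L ≃ₗ[ℂ] L) where
  carrier := {g | ∀ x y, g ⁅x, y⁆ = ⁅g x, g y⁆}
  mul_mem' {g k} hg hk x y := by
    rw [LinearEquiv.mul_apply, LinearEquiv.mul_apply, LinearEquiv.mul_apply, hk, hg]
  one_mem' _ _ := rfl
  inv_mem' {g} hg x y := by
    apply g.injective
    rw [hg]
    simp only [← LinearEquiv.mul_apply, mul_inv_cancel]
    rfl

theorem inv_apply_self' (g : L ≃ₗ[ℂ] L) (v : L) : g⁻¹ (g v) = v := g.symm_apply_apply v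

theorem apply_inv_self' (g : L ≃ₗ[ℂ] L) (v : L) : g (g⁻¹ v) = v := g.apply_symm_apply v

theorem lieAut_apply_lie {g : L ≃ₗ[ℂ] L} (hg : g ∈ lieAut L) (x y : L) :
    g ⁅x, y⁆ = ⁅g x, g y⁆ := hg x y

theorem expAd_of_not_isNilpotent {z : L} (h : ¬ IsNilpotent (ad ℂ L z)) : expAd z = 1 := by
  simp only [expAd, dif_neg h]

@[simp] theorem expAd_zero : expAd (0 : L) = 1 := by
  ext v
  rw [expAd_apply (n := 1) (by simp)]
  simp

/-- The exponential of an ad-nilpotent element preserves the bracket. -/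
theorem expAd_mem_lieAut (z : L) : expAd z ∈ lieAut L := by
  by_cases h : IsNilpotent (ad ℂ L z)
  · let _ : Module ℚ L := Module.compHom _ (algebraMap ℚ ℂ)
    let _ : LieAlgebra ℚ L :=
      { lie_smul := fun t x y => lie_smul ((algebraMap ℚ ℂ) t) x y }
    have hcoe : (LieDerivation.ad ℂ L z).toLinearMap = ad ℂ L z :=
      LieDerivation.coe_ad_apply_eq_ad_apply z
    have hD : IsNilpotent (LieDerivation.ad ℂ L z).toLinearMap := hcoe ▸ h
    obtain ⟨n, hn⟩ := id h
    have hn' : (LieDerivation.ad ℂ L z).toLinearMap ^ n = 0 := by rw [hcoe, hn]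
    have key : ∀ v, expAd z v = (LieDerivation.ad ℂ L z).exp hD v := by
      intro v
      rw [LieDerivation.exp_map_apply, expAd_apply hn, IsNilpotent.exp_eq_sum hn',
        LinearMap.sum_apply, hcoe]
      refine Finset.sum_congr rfl fun k _ => ?_
      rw [LinearMap.smul_apply]
      change _ = ((algebraMap ℚ ℂ) (k.factorial : ℚ)⁻¹) • ((ad ℂ L z ^ k) v)
      simp
    intro x y
    simp only [key, LieEquiv.map_lie]
  · rw [expAd_of_not_isNilpotent h]; exact one_mem _

theorem ad_apply_pow_conj {g : L ≃ₗ[ℂ] L} (hg : g ∈ lieAut L) (z v : L) (n : ℕ) :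
    (ad ℂ L (g z) ^ n) (g v) = g ((ad ℂ L z ^ n) v) := by
  induction n with
  | zero => simp
  | succ n ih =>
    rw [pow_succ', pow_succ', Module.End.mul_apply, Module.End.mul_apply, ih, ad_apply, ad_apply,
      hg]

theorem isNilpotent_ad_apply {g : L ≃ₗ[ℂ] L} (hg : g ∈ lieAut L) {z : L}
    (h : IsNilpotent (ad ℂ L z)) : IsNilpotent (ad ℂ L (g z)) := by
  obtain ⟨n, hn⟩ := h
  refine ⟨n, LinearMap.ext fun v => ?_⟩
  obtain ⟨w, rfl⟩ := g.surjective v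
  rw [ad_apply_pow_conj hg, hn]
  simp

/-- Conjugation by an automorphism `g` takes `exp (ad z)` to `exp (ad (g z))`. -/
theorem conj_expAd {g : L ≃ₗ[ℂ] L} (hg : g ∈ lieAut L) (z : L) :
    g * expAd z * g⁻¹ = expAd (g z) := by
  rw [mul_inv_eq_iff_eq_mul]
  by_cases h : IsNilpotent (ad ℂ L z)
  · obtain ⟨n, hn⟩ := id h
    have hn' : ad ℂ L (g z) ^ n = 0 := by
      refine LinearMap.ext fun v => ?_
      obtain ⟨w, rfl⟩ := g.surjective v
      rw [ad_apply_pow_conj hg, hn]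
      simp
    ext v
    rw [LinearEquiv.mul_apply, LinearEquiv.mul_apply, expAd_apply hn, expAd_apply hn', map_sum]
    refine Finset.sum_congr rfl fun k _ => ?_
    rw [map_smul, ad_apply_pow_conj hg]
  · have h' : ¬ IsNilpotent (ad ℂ L (g z)) := fun h' => h (by
      have := isNilpotent_ad_apply (inv_mem hg) h'
      rwa [inv_apply_self'] at this)
    rw [expAd_of_not_isNilpotent h, expAd_of_not_isNilpotent h', mul_one, one_mul]

theorem expAd_add_smul {z : L} (h : IsNilpotent (ad ℂ L z)) (s t : ℂ) :
    expAd ((s + t) • z) = expAd (s • z) * expAd (t • z) := by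
  let _ : Module ℚ (Module.End ℂ L) := Module.compHom _ (algebraMap ℚ ℂ)
  have hs : ∀ a : ℂ, IsNilpotent (ad ℂ L (a • z)) := fun a => by rw [map_smul]; exact h.smul a
  have hc : ∀ a : ℂ, ∀ v, expAd (a • z) v = IsNilpotent.exp (ad ℂ L (a • z)) v := fun a v => by
    simp only [expAd, dif_pos (hs a)]
    rfl
  ext v
  rw [LinearEquiv.mul_apply, hc, hc, hc, add_smul, map_add,
    IsNilpotent.exp_add_of_commute _ (hs s) (hs t), Module.End.mul_apply]
  rw [map_smul, map_smul]
  exact ((Commute.refl _).smul_left s).smul_right t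

/-- The first terms of the exponential series, when the others vanish on `v`. -/
theorem expAd_apply_of_lie_lie_lie {z v : L} (hz : IsNilpotent (ad ℂ L z))
    (h : ⁅z, ⁅z, ⁅z, v⁆⁆⁆ = 0) : expAd z v = v + ⁅z, v⁆ + (2⁻¹ : ℂ) • ⁅z, ⁅z, v⁆⁆ := by
  obtain ⟨n, hn⟩ := hz
  have hn' : ad ℂ L z ^ (n + 3) = 0 := by rw [pow_add, hn, zero_mul]
  rw [expAd_apply hn', Finset.sum_range_succ', Finset.sum_range_succ', Finset.sum_range_succ']
  have h0 : ∑ k ∈ Finset.range n, (((k + 1 + 1 + 1).factorial : ℂ)⁻¹) •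
      ((ad ℂ L z ^ (k + 1 + 1 + 1)) v) = 0 := by
    refine Finset.sum_eq_zero fun k _ => ?_
    rw [add_assoc, add_assoc, pow_add, Module.End.mul_apply]
    have : (ad ℂ L z ^ (1 + (1 + 1))) v = 0 := by
      rw [pow_add, pow_add, pow_one]
      simpa using h
    rw [this, map_zero, smul_zero]
  rw [h0]
  simp [pow_succ]
  abel

theorem expAd_apply_of_lie_lie {z v : L} (hz : IsNilpotent (ad ℂ L z))
    (h : ⁅z, ⁅z, v⁆⁆ = 0) : expAd z v = v + ⁅z, v⁆ := by
  rw [expAd_apply_of_lie_lie_lie hz (by rw [h, lie_zero]), h, smul_zero, add_zero]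

theorem expAd_apply_of_lie {z v : L} (h : ⁅z, v⁆ = 0) : expAd z v = v := by
  have := expAd_sub_mem (z := z) (v := v) ⊥ (by simp [h]) (by simp)
  simpa [sub_eq_zero] using this

theorem adjointGroup_le_lieAut : adjointGroup L ≤ lieAut L := by
  rw [adjointGroup, Subgroup.closure_le]
  rintro g ⟨z, -, rfl⟩
  exact expAd_mem_lieAut z

theorem expAd_mem_adjointGroup (z : L) : expAd z ∈ adjointGroup L := by
  by_cases h : IsNilpotent (ad ℂ L z)
  · exact Subgroup.subset_closure ⟨z, h, rfl⟩
  · rw [expAd_of_not_isNilpotent h]; exact one_mem _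

theorem torus_le_lieAut (H : LieSubalgebra ℂ L) : torus H ≤ lieAut L :=
  fun _ hg => adjointGroup_le_lieAut hg.1

theorem killingForm_apply_apply {g : L ≃ₗ[ℂ] L} (hg : g ∈ lieAut L) (x y : L) :
    killingForm ℂ L (g x) (g y) = killingForm ℂ L x y := by
  let e : L ≃ₗ⁅ℂ⁆ L := { g with map_lie' := fun {x y} => hg x y }
  exact killingForm_of_equiv_apply e x y

theorem killingForm_apply_left {g : L ≃ₗ[ℂ] L} (hg : g ∈ lieAut L) (x y : L) :
    killingForm ℂ L (g x) y = killingForm ℂ L x (g⁻¹ y) := by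
  rw [← killingForm_apply_apply hg x, apply_inv_self']

end Automorphisms

/-! ### Gradings and unipotent automorphisms -/

section Grading

variable {L : Type*} [LieRing L] [LieAlgebra ℂ L]

/-- The piece of degree `m` of the grading of `L` by the integral eigenvalues of `ad ρ`. -/
def gradedPiece (ρ : L) (m : ℤ) : Submodule ℂ L := Module.End.eigenspace (ad ℂ L ρ) (m : ℂ)

/-- `ad ρ` is diagonalizable with integral eigenvalues. -/
def IsGrading (ρ : L) : Prop := ⨆ m : ℤ, gradedPiece ρ m = ⊤

/-- The elements of degree at most `m`. -/
def filtLE (ρ : L) (m : ℤ) : Submodule ℂ L := ⨆ k : {k : ℤ // k ≤ m}, gradedPiece ρ k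

/-- `g` is congruent to the identity modulo operators of degree at most `-k`. -/
def IsLower (ρ : L) (k : ℤ) (g : L ≃ₗ[ℂ] L) : Prop :=
  ∀ m, ∀ v ∈ filtLE ρ m, g v - v ∈ filtLE ρ (m - k)

theorem mem_gradedPiece {ρ v : L} {m : ℤ} : v ∈ gradedPiece ρ m ↔ ⁅ρ, v⁆ = (m : ℂ) • v := by
  rw [gradedPiece, Module.End.mem_eigenspace_iff, ad_apply]

theorem lie_mem_gradedPiece {ρ v w : L} {m n : ℤ} (hv : v ∈ gradedPiece ρ m)
    (hw : w ∈ gradedPiece ρ n) : ⁅v, w⁆ ∈ gradedPiece ρ (m + n) := by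
  rw [mem_gradedPiece] at *
  rw [leibniz_lie, hv, hw, smul_lie, lie_smul, ← add_smul]
  push_cast
  rfl

theorem gradedPiece_neg (ρ : L) (m : ℤ) : gradedPiece (-ρ) m = gradedPiece ρ (-m) := by
  ext v
  rw [mem_gradedPiece, mem_gradedPiece, neg_lie, neg_eq_iff_eq_neg, Int.cast_neg, neg_smul]

theorem IsGrading.neg {ρ : L} (hρ : IsGrading ρ) : IsGrading (-ρ) := by
  rw [IsGrading, ← hρ]
  simp only [gradedPiece_neg]
  exact (Equiv.neg ℤ).iSup_comp (g := gradedPiece ρ)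

theorem gradedPiece_le_filtLE (ρ : L) {m n : ℤ} (h : m ≤ n) : gradedPiece ρ m ≤ filtLE ρ n :=
  le_iSup (fun k : {k : ℤ // k ≤ n} => gradedPiece ρ k) ⟨m, h⟩

theorem filtLE_mono (ρ : L) {m n : ℤ} (h : m ≤ n) : filtLE ρ m ≤ filtLE ρ n :=
  iSup_le fun k => gradedPiece_le_filtLE ρ (k.2.trans h)

@[elab_as_elim]
theorem filtLE_induction {ρ : L} {m : ℤ} {p : L → Prop} {v : L} (hv : v ∈ filtLE ρ m)
    (mem : ∀ k ≤ m, ∀ x ∈ gradedPiece ρ k, p x) (add : ∀ x y, p x → p y → p (x + y)) : p v :=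
  Submodule.iSup_induction _ (motive := p) hv (fun k x hx => mem k k.2 x hx)
    (mem m le_rfl 0 (zero_mem _)) add

theorem lie_mem_filtLE {ρ v w : L} {m n : ℤ} (hv : v ∈ filtLE ρ m) (hw : w ∈ filtLE ρ n) :
    ⁅v, w⁆ ∈ filtLE ρ (m + n) := by
  refine filtLE_induction hv (fun k hk x hx => ?_) fun x y hx hy => by
    rw [add_lie]; exact add_mem hx hy
  refine filtLE_induction hw (fun l hl y hy => ?_) fun y z hy hz => by
    rw [lie_add]; exact add_mem hy hz
  exact gradedPiece_le_filtLE ρ (by lia) (lie_mem_gradedPiece hx hy)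

theorem lie_mem_filtLE_of_le {ρ v w : L} {m n l : ℤ} (hv : v ∈ filtLE ρ m) (hw : w ∈ filtLE ρ n)
    (h : m + n ≤ l) : ⁅v, w⁆ ∈ filtLE ρ l :=
  filtLE_mono ρ h (lie_mem_filtLE hv hw)

theorem IsGrading.induction {ρ : L} (hρ : IsGrading ρ) {p : L → Prop}
    (mem : ∀ m, ∀ x ∈ gradedPiece ρ m, p x) (add : ∀ x y, p x → p y → p (x + y)) (v : L) : p v :=
  Submodule.iSup_induction _ (motive := p)
    (show v ∈ ⨆ m : ℤ, gradedPiece ρ m by rw [hρ]; trivial) mem (mem 0 0 (zero_mem _)) add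

/-- Linear maps on the graded pieces can be chosen independently of each other. -/
theorem IsGrading.exists_end {ρ : L} (hρ : IsGrading ρ) (f : ℤ → Module.End ℂ L) :
    ∃ S : Module.End ℂ L, ∀ m, ∀ v ∈ gradedPiece ρ m, S v = f m v := by
  classical
  have hind : iSupIndep (gradedPiece ρ) :=
    (Module.End.eigenspaces_iSupIndep (ad ℂ L ρ)).comp Int.cast_injective
  have hint := DirectSum.isInternal_submodule_of_iSupIndep_of_iSup_eq_top hind hρ
  let e := LinearEquiv.ofBijective (DirectSum.coeLinearMap (gradedPiece ρ)) hint
  refine ⟨(DirectSum.toModule ℂ ℤ L fun m => f m ∘ₗ (gradedPiece ρ m).subtype) ∘ₗ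
    e.symm.toLinearMap, fun m v hv => ?_⟩
  have h1 : e.symm v = DirectSum.lof ℂ ℤ (fun m => gradedPiece ρ m) m ⟨v, hv⟩ := by
    rw [LinearEquiv.symm_apply_eq]
    exact (DirectSum.coeLinearMap_lof (gradedPiece ρ) m ⟨v, hv⟩).symm
  rw [LinearMap.comp_apply, LinearEquiv.coe_coe, h1, DirectSum.toModule_lof]
  rfl

/-- The projection of `L` to the piece of degree `j`. -/
theorem IsGrading.exists_proj {ρ : L} (hρ : IsGrading ρ) (j : ℤ) :
    ∃ S : Module.End ℂ L, (∀ v ∈ gradedPiece ρ j, S v = v) ∧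
      (∀ m, m < j → ∀ v ∈ filtLE ρ m, S v = 0) ∧ (∀ v, S v ∈ gradedPiece ρ j) ∧
      ∀ v ∈ filtLE ρ j, v - S v ∈ filtLE ρ (j - 1) := by
  classical
  obtain ⟨S, hS⟩ := hρ.exists_end fun m => if m = j then 1 else 0
  have h1 : ∀ v ∈ gradedPiece ρ j, S v = v := fun v hv => by rw [hS j v hv]; simp
  have h2 : ∀ m, m ≠ j → ∀ v ∈ gradedPiece ρ m, S v = 0 := fun m hm v hv => by
    rw [hS m v hv]; simp [hm]
  refine ⟨S, h1, fun m hm v hv => ?_, hρ.induction (fun m v hv => ?_) fun x y hx hy => ?_,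
    fun v hv => ?_⟩
  · refine filtLE_induction hv (fun k hk x hx => h2 k (by lia) x hx) fun x y hx hy => ?_
    rw [map_add, hx, hy, add_zero]
  · by_cases hm : m = j
    · subst hm; rwa [h1 v hv]
    · rw [h2 m hm v hv]; exact zero_mem _
  · rw [map_add]; exact add_mem hx hy
  · refine filtLE_induction hv (fun k hk x hx => ?_) fun x y hx hy => ?_
    · by_cases hk' : k = j
      · subst hk'; rw [h1 x hx, sub_self]; exact zero_mem _
      · rw [h2 k hk' x hx, sub_zero]
        exact gradedPiece_le_filtLE ρ (by lia) hx
    · rw [map_add, add_sub_add_comm]; exact add_mem hx hy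

theorem IsGrading.eq_zero {ρ : L} (hρ : IsGrading ρ) {j m : ℤ} (hm : m < j) {v : L}
    (h1 : v ∈ gradedPiece ρ j) (h2 : v ∈ filtLE ρ m) : v = 0 := by
  obtain ⟨S, hS1, hS2, -, -⟩ := hρ.exists_proj j
  rw [← hS1 v h1, hS2 m hm v h2]

/-- An element of degree at most `m` for `ρ` and at most `n < -m` for `-ρ` vanishes. -/
theorem IsGrading.eq_zero_of_mem_filtLE_neg {ρ : L} (hρ : IsGrading ρ) {m n : ℤ} (hmn : m + n < 0)
    {v : L} (h1 : v ∈ filtLE ρ m) (h2 : v ∈ filtLE (-ρ) n) : v = 0 := by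
  obtain ⟨S, hS⟩ := hρ.exists_end fun k => if k ≤ m then 1 else 0
  have e1 : S v = v := by
    refine filtLE_induction h1 (fun k hk y hy => ?_) fun y z hy hz => by rw [map_add, hy, hz]
    rw [hS k y hy, if_pos hk]; rfl
  have e2 : S v = 0 := by
    refine filtLE_induction h2 (fun k hk y hy => ?_) fun y z hy hz => by
      rw [map_add, hy, hz, add_zero]
    rw [gradedPiece_neg] at hy
    rw [hS _ y hy, if_neg (by lia)]; rfl
  rw [← e1, e2]

/-- In finite dimension the degrees are bounded. -/
theorem IsGrading.exists_bound [FiniteDimensional ℂ L] {ρ : L} (hρ : IsGrading ρ) :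
    ∃ N : ℕ, filtLE ρ N = ⊤ ∧ ∀ m : ℤ, m < -N → filtLE ρ m = ⊥ := by
  have hind : iSupIndep (gradedPiece ρ) :=
    (Module.End.eigenspaces_iSupIndep (ad ℂ L ρ)).comp Int.cast_injective
  have hfin := WellFoundedGT.finite_ne_bot_of_iSupIndep hind
  obtain ⟨N, hN⟩ : ∃ N : ℕ, ∀ m, gradedPiece ρ m ≠ ⊥ → |m| ≤ N := by
    obtain ⟨B, hB⟩ := (hfin.image fun m => m.natAbs).bddAbove
    refine ⟨B, fun m hm => ?_⟩
    have := hB ⟨m, hm, rfl⟩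
    simp only at this
    rw [Int.abs_eq_natAbs]
    exact_mod_cast this
  refine ⟨N, ?_, fun m hm => ?_⟩
  · rw [eq_top_iff, ← hρ]
    refine iSup_le fun m => ?_
    by_cases h : gradedPiece ρ m = ⊥
    · rw [h]; exact bot_le
    · exact gradedPiece_le_filtLE ρ ((le_abs_self m).trans (hN m h))
  · rw [_root_.eq_bot_iff]
    refine iSup_le fun k => ?_
    by_contra h
    have := hN k fun h' => h (by rw [h'])
    have := k.2
    have := neg_abs_le (k : ℤ)
    lia

theorem IsGrading.isNilpotent_ad [FiniteDimensional ℂ L] {ρ : L} (hρ : IsGrading ρ) {z : L}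
    (hz : z ∈ filtLE ρ (-1)) : IsNilpotent (ad ℂ L z) := by
  obtain ⟨N, hN, hN'⟩ := hρ.exists_bound
  refine ⟨2 * N + 1, LinearMap.ext fun v => ?_⟩
  have h : ∀ n : ℕ, (ad ℂ L z ^ n) v ∈ filtLE ρ (N - n) := by
    intro n
    induction n with
    | zero => simp [hN]
    | succ n ih =>
      rw [pow_succ', Module.End.mul_apply, ad_apply]
      exact lie_mem_filtLE_of_le hz ih (by push_cast; lia)
  have := h (2 * N + 1)
  rw [hN' _ (by push_cast; lia)] at this
  simpa using this

theorem IsLower.mul {ρ : L} {k : ℤ} (hk : 0 ≤ k) {g g' : L ≃ₗ[ℂ] L} (hg : IsLower ρ k g)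
    (hg' : IsLower ρ k g') : IsLower ρ k (g * g') := fun m v hv => by
  have h1 := hg' m v hv
  have h2 := hg _ _ h1
  have h3 := hg m v hv
  rw [LinearEquiv.mul_apply, show g (g' v) - v = (g (g' v - v) - (g' v - v)) + (g' v - v) +
    (g v - v) by rw [map_sub]; abel]
  exact add_mem (add_mem (filtLE_mono ρ (by lia) h2) h1) h3

theorem isLower_expAd {ρ z : L} {k : ℤ} (hk : 0 ≤ k) (hz : z ∈ filtLE ρ (-k)) :
    IsLower ρ k (expAd z) := fun m _ hv =>
  expAd_sub_mem _ (lie_mem_filtLE_of_le hz hv (by lia)) fun _ hw =>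
    lie_mem_filtLE_of_le hz hw (by lia)

theorem isLower_of_mem_closure {ρ : L} {k : ℤ} (hk : 0 ≤ k) {S : Set L}
    (hS : ∀ z ∈ S, z ∈ filtLE ρ (-k)) (hneg : ∀ z ∈ S, -z ∈ S) {g : L ≃ₗ[ℂ] L}
    (hg : g ∈ Subgroup.closure {g | ∃ z ∈ S, g = expAd z}) : IsLower ρ k g := by
  induction hg using Subgroup.closure_induction'' with
  | mem g hg => obtain ⟨z, hz, rfl⟩ := hg; exact isLower_expAd hk (hS z hz)
  | inv_mem g hg =>
    obtain ⟨z, hz, rfl⟩ := hg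
    rw [expAd_inv]
    exact isLower_expAd hk (hS _ (hneg z hz))
  | one => intro m v _; simp
  | mul g g' _ _ hg hg' => exact hg.mul hk hg'

/-- The leading part of a unipotent automorphism is a derivation, and derivations are inner. -/
theorem IsLower.exists_lie [FiniteDimensional ℂ L] [IsKilling ℂ L] {ρ : L} (hρ : IsGrading ρ)
    {k : ℤ} (hk : 1 ≤ k) {g : L ≃ₗ[ℂ] L} (hg : g ∈ lieAut L) (hgk : IsLower ρ k g) :
    ∃ z ∈ gradedPiece ρ (-k), ∀ m, ∀ v ∈ gradedPiece ρ m,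
      g v - v - ⁅z, v⁆ ∈ filtLE ρ (m - k - 1) := by
  choose S hS1 hS2 hS3 hS4 using hρ.exists_proj
  obtain ⟨D, hD⟩ := hρ.exists_end fun m => S (m - k) ∘ₗ (g.toLinearMap - LinearMap.id)
  have hD1 : ∀ m, ∀ v ∈ gradedPiece ρ m, D v ∈ gradedPiece ρ (m - k) := fun m v hv => by
    rw [hD m v hv]; exact hS3 _ _
  have hD2 : ∀ m, ∀ v ∈ gradedPiece ρ m, g v - v - D v ∈ filtLE ρ (m - k - 1) := fun m v hv => by
    rw [hD m v hv]
    exact hS4 _ _ (hgk m v (gradedPiece_le_filtLE ρ le_rfl hv))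
  have hD3 : ∀ x y, D ⁅x, y⁆ = ⁅x, D y⁆ - ⁅y, D x⁆ := by
    refine hρ.induction (fun m x hx => ?_) fun x x' hx hx' y => by
      rw [add_lie, map_add, hx, hx', add_lie, map_add, lie_add]; abel
    refine hρ.induction (fun n y hy => ?_) fun y y' hy hy' => by
      rw [lie_add, map_add, hy, hy', add_lie, map_add, lie_add]; abel
    rw [← sub_eq_zero]
    refine hρ.eq_zero (j := m + n - k) (m := m + n - k - 1) (by lia) ?_ ?_
    · refine sub_mem (hD1 _ _ (lie_mem_gradedPiece hx hy)) (sub_mem ?_ ?_)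
      · convert lie_mem_gradedPiece hx (hD1 _ _ hy) using 2; ring
      · convert lie_mem_gradedPiece hy (hD1 _ _ hx) using 2; ring
    · have hx' := hD2 _ _ hx
      have hy' := hD2 _ _ hy
      have hxy := hD2 _ _ (lie_mem_gradedPiece hx hy)
      have hxf := gradedPiece_le_filtLE ρ le_rfl hx
      have hyf := gradedPiece_le_filtLE ρ le_rfl hy
      have hgx := hgk _ _ hxf
      have hgy := hgk _ _ hyf
      have key : D ⁅x, y⁆ - (⁅x, D y⁆ - ⁅y, D x⁆) = ⁅g x - x, g y - y⁆ + ⁅g x - x - D x, y⁆ +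
          ⁅x, g y - y - D y⁆ - (g ⁅x, y⁆ - ⁅x, y⁆ - D ⁅x, y⁆) := by
        rw [hg x y, ← lie_skew y (D x)]
        simp only [sub_lie, lie_sub]
        abel
      rw [key]
      refine sub_mem (add_mem (add_mem ?_ ?_) ?_) hxy
      · exact lie_mem_filtLE_of_le hgx hgy (by lia)
      · exact lie_mem_filtLE_of_le hx' hyf (by lia)
      · exact lie_mem_filtLE_of_le hxf hy' (by lia)
  obtain ⟨z, hz⟩ := LieDerivation.IsKilling.exists_eq_ad
    ({ toLinearMap := D, leibniz' := hD3 } : LieDerivation ℂ L L)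
  have hz' : ∀ v, ⁅z, v⁆ = D v := fun v => by
    have := congrArg (fun d : LieDerivation ℂ L L => d v) hz
    simpa using this
  refine ⟨z, ?_, fun m v hv => by rw [hz']; exact hD2 m v hv⟩
  rw [mem_gradedPiece, ← sub_eq_zero, ← LieDerivation.IsKilling.ad_apply_eq_zero_iff ℂ L]
  ext v
  simp only [LieDerivation.ad_apply_apply, LieDerivation.coe_zero, Pi.zero_apply]
  refine hρ.induction (p := fun v => ⁅⁅ρ, z⁆ - ((-k : ℤ) : ℂ) • z, v⁆ = 0)
    (fun m v hv => ?_) (fun x y hx hy => ?_) v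
  swap
  · rw [lie_add, hx, hy, add_zero]
  have h1 := hD1 m v hv
  rw [mem_gradedPiece] at h1 hv
  rw [sub_lie, lie_lie, hz', h1, hv, lie_smul, smul_lie, hz', ← sub_smul, ← sub_smul]
  push_cast
  simp

/-- A unipotent automorphism is a product of exponentials of elements of negative degree; the
first factor may be taken homogeneous of the leading degree. -/
theorem IsLower.exists_expAd_mul [FiniteDimensional ℂ L] [IsKilling ℂ L] {ρ : L}
    (hρ : IsGrading ρ) {k : ℕ} (hk : 1 ≤ k) {g : L ≃ₗ[ℂ] L} (hg : g ∈ lieAut L)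
    (hgk : IsLower ρ k g) :
    ∃ z ∈ gradedPiece ρ (-(k : ℤ)),
      ∃ g' ∈ Subgroup.closure {g | ∃ z ∈ filtLE ρ (-(k + 1 : ℤ)), g = expAd z},
        g = expAd z * g' := by
  obtain ⟨N, hN, hN'⟩ := hρ.exists_bound
  -- Beyond the range of the degrees a unipotent automorphism is trivial.
  obtain ⟨d, hd⟩ : ∃ d : ℕ, 2 * N < k + d := ⟨2 * N + 1, by lia⟩
  induction d generalizing k g with
  | zero =>
    have : g = 1 := by
      ext v
      have := hgk N v (by rw [hN]; trivial)
      rw [hN' _ (by lia), Submodule.mem_bot, sub_eq_zero] at this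
      exact this
    exact ⟨0, zero_mem _, 1, one_mem _, by simp [this]⟩
  | succ d ih =>
    obtain ⟨z, hz, hz'⟩ := hgk.exists_lie hρ (by lia) hg
    have hzf : z ∈ filtLE ρ (-(k : ℤ)) := gradedPiece_le_filtLE ρ le_rfl hz
    have hlow : IsLower ρ ((k + 1 : ℕ) : ℤ) (expAd (-z) * g) := by
      intro m v hv
      refine filtLE_induction hv (fun l hl x hx => ?_) fun x y hx hy => by
        rw [map_add, add_sub_add_comm]; exact add_mem hx hy
      have hxf := gradedPiece_le_filtLE ρ le_rfl hx
      have h1 := hz' l x hx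
      have h2 : ∀ w ∈ filtLE ρ l, expAd (-z) w - w - ⁅-z, w⁆ ∈ filtLE ρ (l - k - k) := by
        intro w hw
        have hnil : IsNilpotent (ad ℂ L (-z)) :=
          hρ.isNilpotent_ad (neg_mem (filtLE_mono ρ (by lia) hzf))
        obtain ⟨n, hn⟩ := hnil
        have hn' : ad ℂ L (-z) ^ (n + 2) = 0 := by rw [pow_add, hn, zero_mul]
        rw [expAd_apply hn', Finset.sum_range_succ', Finset.sum_range_succ']
        simp only [zero_add, Nat.factorial_one, Nat.cast_one, inv_one, pow_one, one_smul,
          Nat.factorial_zero, pow_zero, Module.End.one_apply, ad_apply]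
        rw [add_sub_cancel_right, add_sub_cancel_right]
        refine Submodule.sum_mem _ fun j hj => Submodule.smul_mem _ _ ?_
        clear hj
        induction j with
        | zero =>
          rw [show (0 + 1 + 1) = 2 by rfl, pow_two, Module.End.mul_apply, ad_apply, ad_apply]
          exact lie_mem_filtLE_of_le (neg_mem hzf)
            (lie_mem_filtLE_of_le (neg_mem hzf) hw le_rfl) (by lia)
        | succ j ih =>
          rw [pow_succ', Module.End.mul_apply, ad_apply]
          exact lie_mem_filtLE_of_le (neg_mem hzf) ih (by lia)
      have h3 := h2 x hxf
      have h4 : g x - x ∈ filtLE ρ (l - k) := hgk l x hxf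
      have h5 := h2 _ (filtLE_mono ρ (by lia) h4)
      have h6 : ⁅-z, g x - x⁆ ∈ filtLE ρ (l - k - k) :=
        lie_mem_filtLE_of_le (neg_mem hzf) h4 (by lia)
      rw [LinearEquiv.mul_apply, show expAd (-z) (g x) - x =
        (expAd (-z) x - x - ⁅-z, x⁆) + (expAd (-z) (g x - x) - (g x - x) - ⁅-z, g x - x⁆) +
          ⁅-z, g x - x⁆ + (g x - x - ⁅z, x⁆) by rw [map_sub, neg_lie z x]; abel]
      refine add_mem (add_mem (add_mem ?_ ?_) ?_) ?_
      · exact filtLE_mono ρ (by push_cast; lia) h3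
      · exact filtLE_mono ρ (by push_cast; lia) h5
      · exact filtLE_mono ρ (by push_cast; lia) h6
      · exact filtLE_mono ρ (by push_cast; lia) h1
    obtain ⟨z', hz1, g', hg', heq⟩ :=
      ih (by lia) (mul_mem (expAd_mem_lieAut _) hg) hlow (by lia)
    refine ⟨z, hz, expAd z' * g', mul_mem (Subgroup.subset_closure ⟨z', ?_, rfl⟩) ?_, ?_⟩
    · exact gradedPiece_le_filtLE ρ (by push_cast; lia) hz1
    · refine Subgroup.closure_mono ?_ hg'
      rintro _ ⟨w, hw, rfl⟩
      exact ⟨w, filtLE_mono ρ (by push_cast; lia) hw, rfl⟩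
    · rw [← heq, ← expAd_inv, mul_inv_cancel_left]

end Grading

/-! ### The principal grading -/

section Principal

variable {L : Type*} [LieRing L] [LieAlgebra ℂ L]
  {H : LieSubalgebra ℂ L} {ι : Type*} [Fintype ι] (b : LieAlgebra.Basis ι H)

theorem lie_cartan_e (h : H) (i : ι) : ⁅(h : L), b.e i⁆ = b.baseSupp i h • b.e i :=
  (b.baseSupp_apply_smul_e i h).symm

theorem lie_cartan_f (h : H) (i : ι) : ⁅(h : L), b.f i⁆ = -(b.baseSupp i h) • b.f i := by
  rw [neg_smul, b.baseSupp_apply_smul_f i h, neg_neg, coe_bracket_of_module]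

include b in
theorem lie_cartan_cartan (h h' : H) : ⁅(h : L), (h' : L)⁆ = 0 := by
  have := b.isLieAbelian_cartan
  rw [← coe_bracket, trivial_lie_zero]
  rfl

theorem lie_e_cartan (h : H) (i : ι) : ⁅b.e i, (h : L)⁆ = -(b.baseSupp i h) • b.e i := by
  rw [← lie_skew, lie_cartan_e, neg_smul]

theorem baseSupp_h'_self (i : ι) : b.baseSupp i (b.h' i) = 2 := by
  have : IsAddTorsionFree L := .of_isTorsionFree ℂ L
  rw [b.baseSupp_apply_h', b.A_diag_eq_two]
  norm_num

theorem coe_h' (i : ι) : (b.h' i : L) = b.h i := rfl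

/-- The simple roots take arbitrary values on the Cartan subalgebra. -/
theorem exists_baseSupp_eq (c : ι → ℂ) : ∃ h : H, ∀ i, b.baseSupp i h = c i := by
  classical
  let A : Matrix ι ι ℂ := (Int.castRingHom ℂ).mapMatrix b.A
  have hA : IsUnit A.det := by
    have h0 : A.det = ((b.A.det : ℤ) : ℂ) := by
      rw [show A = (Int.castRingHom ℂ).mapMatrix b.A from rfl, ← RingHom.map_det]; rfl
    rw [h0, isUnit_iff_ne_zero]
    exact_mod_cast b.nondegen.det_ne_zero
  refine ⟨∑ j, (A⁻¹.mulVec c) j • b.h' j, fun i => ?_⟩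
  have h1 : A.mulVec (A⁻¹.mulVec c) = c := by
    rw [Matrix.mulVec_mulVec, Matrix.mul_nonsing_inv A hA, Matrix.one_mulVec]
  rw [map_sum, ← congrFun h1 i]
  simp only [Matrix.mulVec, dotProduct, map_smul, b.baseSupp_apply_h', smul_eq_mul]
  exact Finset.sum_congr rfl fun j _ => mul_comm _ _

/-- An element of the Cartan subalgebra on which the simple roots are integral grades `L`. -/
theorem isGrading_of_int {h : H} (hh : ∀ i, ∃ n : ℤ, b.baseSupp i h = n) :
    IsGrading (h : L) := by
  rw [IsGrading, eq_top_iff]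
  intro v _
  have hv : v ∈ lieSpan ℂ L (Set.range b.e ∪ Set.range b.f) := by rw [b.span_ef]; trivial
  have hmem : ∀ m, ∀ x ∈ gradedPiece (h : L) m, x ∈ ⨆ m : ℤ, gradedPiece (h : L) m :=
    fun m x hx => le_iSup (gradedPiece (h : L)) m hx
  induction hv using lieSpan_induction with
  | mem x hx =>
    rcases hx with ⟨i, rfl⟩ | ⟨i, rfl⟩
    · obtain ⟨n, hn⟩ := hh i
      exact hmem n _ (by rw [mem_gradedPiece, lie_cartan_e, hn])
    · obtain ⟨n, hn⟩ := hh i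
      exact hmem (-n) _ (by rw [mem_gradedPiece, lie_cartan_f, hn, Int.cast_neg])
  | zero => exact zero_mem _
  | add x y _ _ hx hy => exact add_mem (hx trivial) (hy trivial)
  | smul a x _ hx => exact Submodule.smul_mem _ _ (hx trivial)
  | lie x y _ _ hx hy =>
    refine Submodule.iSup_induction _ (motive := fun x => ⁅x, y⁆ ∈ _) (hx trivial)
      (fun m x hx => ?_) (by simp) fun x x' hx hx' => by rw [add_lie]; exact add_mem hx hx'
    refine Submodule.iSup_induction _ (motive := fun y => ⁅x, y⁆ ∈ _) (hy trivial)
      (fun n y hy => ?_) (by simp) fun y y' hy hy' => by rw [lie_add]; exact add_mem hy hy'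
    exact hmem _ _ (lie_mem_gradedPiece hx hy)

/-- The element of the Cartan subalgebra on which all simple roots take the value `1`. -/
def principal : H := (exists_baseSupp_eq b 1).choose

theorem baseSupp_principal (i : ι) : b.baseSupp i (principal b) = 1 :=
  (exists_baseSupp_eq b 1).choose_spec i

theorem isGrading_principal : IsGrading (principal b : L) :=
  isGrading_of_int b fun i => ⟨1, by rw [baseSupp_principal, Int.cast_one]⟩

theorem isGrading_h (i : ι) : IsGrading (b.h i) :=
  isGrading_of_int b (h := b.h' i) fun j => ⟨b.A j i, b.baseSupp_apply_h' j i⟩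

theorem principal_symm : principal b.symm = -principal b := by
  have h1 : ∀ h : H, (∀ i, b.baseSupp i h = 0) → h = 0 := by
    intro h hh
    have hz : ∀ v : L, ⁅(h : L), v⁆ = 0 := by
      intro v
      have hv : v ∈ lieSpan ℂ L (Set.range b.e ∪ Set.range b.f) := by rw [b.span_ef]; trivial
      induction hv using lieSpan_induction with
      | mem x hx =>
        rcases hx with ⟨i, rfl⟩ | ⟨i, rfl⟩
        · rw [lie_cartan_e, hh, zero_smul]
        · rw [lie_cartan_f, hh, neg_zero, zero_smul]
      | zero => simp
      | add x y _ _ hx hy => rw [lie_add, hx, hy, add_zero]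
      | smul a x _ hx => rw [lie_smul, hx, smul_zero]
      | lie x y _ _ hx hy => rw [leibniz_lie, hx, hy, zero_lie, lie_zero, add_zero]
    obtain ⟨h, hmem⟩ := h
    have hspan : h ∈ Submodule.span ℂ (Set.range b.h) := by
      rw [← b.coe_cartan_eq_span]; exact hmem
    obtain ⟨c, rfl⟩ := (Submodule.mem_span_range_iff_exists_fun ℂ).mp hspan
    have hc : (fun i => c i) = 0 := by
      classical
      let A : Matrix ι ι ℂ := (Int.castRingHom ℂ).mapMatrix b.A
      have hA : A.det ≠ 0 := by
        have h0 : A.det = ((b.A.det : ℤ) : ℂ) := by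
          rw [show A = (Int.castRingHom ℂ).mapMatrix b.A from rfl, ← RingHom.map_det]; rfl
        rw [h0]
        exact_mod_cast b.nondegen.det_ne_zero
      refine Matrix.eq_zero_of_mulVec_eq_zero hA (funext fun i => ?_)
      have h2 : (⟨∑ j, c j • b.h j, hmem⟩ : H) = ∑ j, c j • b.h' j := by
        ext; simp [coe_h']
      have h3 := hh i
      rw [h2, map_sum] at h3
      rw [Pi.zero_apply, ← h3]
      simp only [Matrix.mulVec, dotProduct, map_smul, b.baseSupp_apply_h', smul_eq_mul]
      exact Finset.sum_congr rfl fun j _ => mul_comm _ _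
    ext
    simp [show c = 0 from hc]
  rw [← sub_eq_zero]
  refine h1 _ fun i => ?_
  have h2 := baseSupp_principal b.symm i
  rw [b.symm_baseSupp] at h2
  have h3 : b.baseSupp i (principal b.symm) = -1 := by
    rw [← h2]; simp
  rw [map_sub, map_neg, baseSupp_principal, h3, sub_self]

theorem e_mem_gradedPiece (i : ι) : b.e i ∈ gradedPiece (principal b : L) 1 := by
  rw [mem_gradedPiece, lie_cartan_e, baseSupp_principal, Int.cast_one]

theorem f_mem_gradedPiece (i : ι) : b.f i ∈ gradedPiece (principal b : L) (-1) := by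
  rw [mem_gradedPiece, lie_cartan_f, baseSupp_principal, Int.cast_neg, Int.cast_one]

include b in
theorem cartan_mem_gradedPiece (h h' : H) : (h' : L) ∈ gradedPiece (h : L) 0 := by
  rw [mem_gradedPiece, lie_cartan_cartan b, Int.cast_zero, zero_smul]

theorem lieSpan_f_le {z : L} (hz : z ∈ lieSpan ℂ L (Set.range b.f)) :
    z ∈ filtLE (principal b : L) (-1) := by
  induction hz using lieSpan_induction with
  | mem x hx =>
    obtain ⟨i, rfl⟩ := hx
    exact gradedPiece_le_filtLE _ le_rfl (f_mem_gradedPiece b i)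
  | zero => exact zero_mem _
  | add x y _ _ hx hy => exact add_mem hx hy
  | smul a x _ hx => exact Submodule.smul_mem _ _ hx
  | lie x y _ _ hx hy => exact lie_mem_filtLE_of_le hx hy (by lia)

theorem lieSpan_e_le {z : L} (hz : z ∈ lieSpan ℂ L (Set.range b.e)) :
    z ∈ filtLE (-(principal b : L)) (-1) := by
  have := lieSpan_f_le b.symm hz
  rwa [principal_symm] at this

/-- The subalgebra generated by the `f_i` is the sum of the pieces of negative degree. -/
theorem mem_lieSpan_f_iff {z : L} :
    z ∈ lieSpan ℂ L (Set.range b.f) ↔ z ∈ filtLE (principal b : L) (-1) := by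
  refine ⟨lieSpan_f_le b, fun hz => ?_⟩
  have h1 : z ∈ H.toLieSubmodule ⊔ b.borelLower ⊔ b.borelUpper := by
    have h2 : H.toLieSubmodule ⊔ b.borelLower ⊔ b.borelUpper = ⊤ := by
      simpa using b.iSup_cartan_borelLower_borelUpper_eq_top
    rw [h2]; trivial
  obtain ⟨h, hh, l, hl, u, hu, heq⟩ :
      ∃ᵉ (h ∈ H) (l ∈ lieSpan ℂ L (Set.range b.f)) (u ∈ lieSpan ℂ L (Set.range b.e)),
        h + l + u = z := by simpa [LieSubmodule.mem_sup] using! h1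
  have h3 : z - l = 0 := by
    refine (isGrading_principal b).eq_zero_of_mem_filtLE_neg (m := -1) (n := 0) (by lia)
      (sub_mem hz (lieSpan_f_le b hl)) ?_
    rw [← heq, show h + l + u - l = h + u by abel]
    refine add_mem (gradedPiece_le_filtLE _ le_rfl ?_) (filtLE_mono _ (by lia) (lieSpan_e_le b hu))
    rw [gradedPiece_neg, neg_zero]
    exact cartan_mem_gradedPiece b _ ⟨h, hh⟩
  rw [sub_eq_zero.mp h3]
  exact hl

/-- The piece of degree `-1` is spanned by the `f_i`. -/
theorem gradedPiece_neg_one_le {z : L} (hz : z ∈ gradedPiece (principal b : L) (-1)) :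
    z ∈ Submodule.span ℂ (Set.range b.f) := by
  have key : ∀ w ∈ lieSpan ℂ L (Set.range b.f), ∃ s ∈ Submodule.span ℂ (Set.range b.f),
      w - s ∈ filtLE (principal b : L) (-2) := by
    intro w hw
    induction hw using lieSpan_induction with
    | mem x hx => exact ⟨x, Submodule.subset_span hx, by simp⟩
    | zero => exact ⟨0, zero_mem _, by simp⟩
    | add x y _ _ hx hy =>
      obtain ⟨s, hs, hs'⟩ := hx
      obtain ⟨t, ht, ht'⟩ := hy
      exact ⟨s + t, add_mem hs ht, by rw [add_sub_add_comm]; exact add_mem hs' ht'⟩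
    | smul a x _ hx =>
      obtain ⟨s, hs, hs'⟩ := hx
      exact ⟨a • s, Submodule.smul_mem _ _ hs, by
        rw [← smul_sub]; exact Submodule.smul_mem _ _ hs'⟩
    | lie x y hx hy _ _ =>
      refine ⟨0, zero_mem _, ?_⟩
      rw [sub_zero]
      exact lie_mem_filtLE_of_le (lieSpan_f_le b hx) (lieSpan_f_le b hy) (by lia)
  obtain ⟨s, hs, hs'⟩ := key z ((mem_lieSpan_f_iff b).mpr (gradedPiece_le_filtLE _ le_rfl hz))
  have hsp : Submodule.span ℂ (Set.range b.f) ≤ gradedPiece (principal b : L) (-1) := by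
    rw [Submodule.span_le]
    rintro _ ⟨i, rfl⟩
    exact f_mem_gradedPiece b i
  have := (isGrading_principal b).eq_zero (j := -1) (m := -2) (by lia) (sub_mem hz (hsp hs)) hs'
  rwa [sub_eq_zero.mp this]

theorem killingForm_gradedPiece {ρ v w : L} {m n : ℤ} (hmn : m + n ≠ 0)
    (hv : v ∈ gradedPiece ρ m) (hw : w ∈ gradedPiece ρ n) : killingForm ℂ L v w = 0 := by
  rw [mem_gradedPiece] at hv hw
  have h1 := LieModule.traceForm_apply_lie_apply' ℂ L L ρ v w
  rw [hv, hw, map_smul, LinearMap.smul_apply, map_smul, smul_eq_mul, smul_eq_mul] at h1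
  have h2 : ((m + n : ℤ) : ℂ) * killingForm ℂ L v w = 0 := by
    push_cast
    linear_combination h1
  exact (mul_eq_zero.mp h2).resolve_left (by exact_mod_cast hmn)

theorem killingForm_gradedPiece_filtLE {ρ v w : L} {m n : ℤ} (hmn : m + n < 0)
    (hv : v ∈ gradedPiece ρ m) (hw : w ∈ filtLE ρ n) : killingForm ℂ L v w = 0 := by
  refine filtLE_induction hw (fun k hk x hx => killingForm_gradedPiece (by lia) hv hx)
    fun x y hx hy => by rw [map_add, hx, hy, add_zero]

end Principal

/-! ### Relations in the subgroups of type `SL₂` -/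

section SL2

variable {L : Type*} [LieRing L] [LieAlgebra ℂ L] [FiniteDimensional ℂ L]
  {H : LieSubalgebra ℂ L} {ι : Type*} [Fintype ι] (b : LieAlgebra.Basis ι H)

theorem isNilpotent_ad_f (i : ι) : IsNilpotent (ad ℂ L (b.f i)) :=
  (isGrading_principal b).isNilpotent_ad (gradedPiece_le_filtLE _ le_rfl (f_mem_gradedPiece b i))

theorem isNilpotent_ad_e (i : ι) : IsNilpotent (ad ℂ L (b.e i)) := isNilpotent_ad_f b.symm i

omit [FiniteDimensional ℂ L] in
theorem isNilpotent_ad_smul {z : L} (hz : IsNilpotent (ad ℂ L z)) (a : ℂ) :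
    IsNilpotent (ad ℂ L (a • z)) := by
  rw [map_smul]; exact hz.smul a

omit [FiniteDimensional ℂ L] in
theorem yRoot_eq_symm (i : ι) (a : ℂ) : yRoot b i a = xRoot b.symm i a := rfl

theorem xRoot_add (i : ι) (a a' : ℂ) : xRoot b i (a + a') = xRoot b i a * xRoot b i a' :=
  expAd_add_smul (isNilpotent_ad_e b i) a a'

theorem yRoot_add (i : ι) (a a' : ℂ) : yRoot b i (a + a') = yRoot b i a * yRoot b i a' :=
  xRoot_add b.symm i a a'

omit [FiniteDimensional ℂ L] in
@[simp] theorem xRoot_zero (i : ι) : xRoot b i 0 = 1 := by rw [xRoot, zero_smul, expAd_zero]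

omit [FiniteDimensional ℂ L] in
@[simp] theorem yRoot_zero (i : ι) : yRoot b i 0 = 1 := xRoot_zero b.symm i

omit [FiniteDimensional ℂ L] in
theorem xRoot_inv (i : ι) (a : ℂ) : (xRoot b i a)⁻¹ = xRoot b i (-a) := by
  rw [xRoot, xRoot, expAd_inv, neg_smul]

omit [FiniteDimensional ℂ L] in
theorem yRoot_inv (i : ι) (a : ℂ) : (yRoot b i a)⁻¹ = yRoot b i (-a) := xRoot_inv b.symm i a

omit [FiniteDimensional ℂ L] in
theorem xRoot_mem_lieAut (i : ι) (a : ℂ) : xRoot b i a ∈ lieAut L := expAd_mem_lieAut _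

omit [FiniteDimensional ℂ L] in
theorem yRoot_mem_lieAut (i : ι) (a : ℂ) : yRoot b i a ∈ lieAut L := expAd_mem_lieAut _

omit [FiniteDimensional ℂ L] in
theorem xRoot_apply_e (i : ι) (a : ℂ) : xRoot b i a (b.e i) = b.e i :=
  expAd_apply_of_lie (by simp)

theorem xRoot_apply_cartan (i : ι) (a : ℂ) (h : H) :
    xRoot b i a (h : L) = h - (a * b.baseSupp i h) • b.e i := by
  have h1 : ⁅a • b.e i, (h : L)⁆ = -(a * b.baseSupp i h) • b.e i := by
    rw [smul_lie, lie_e_cartan, smul_smul, mul_neg]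
  rw [xRoot, expAd_apply_of_lie_lie (isNilpotent_ad_smul (isNilpotent_ad_e b i) a)
    (by rw [h1]; simp), h1, neg_smul, sub_eq_add_neg]

theorem yRoot_apply_cartan (i : ι) (a : ℂ) (h : H) :
    yRoot b i a (h : L) = h + (a * b.baseSupp i h) • b.f i := by
  have := xRoot_apply_cartan b.symm i a h
  rw [b.symm_baseSupp] at this
  rw [yRoot_eq_symm, this, Pi.neg_apply, LinearMap.neg_apply, mul_neg, neg_smul, sub_neg_eq_add]
  rfl

theorem xRoot_apply_h (i : ι) (a : ℂ) : xRoot b i a (b.h i) = b.h i - (2 * a) • b.e i := by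
  have := xRoot_apply_cartan b i a (b.h' i)
  rwa [baseSupp_h'_self, coe_h', mul_comm] at this

theorem xRoot_apply_f (i : ι) (a : ℂ) :
    xRoot b i a (b.f i) = b.f i + a • b.h i - (a ^ 2) • b.e i := by
  have h1 : ⁅a • b.e i, b.f i⁆ = a • b.h i := by rw [smul_lie, (b.sl2 i).lie_e_f]
  have h2 : ⁅a • b.e i, a • b.h i⁆ = (-(2 * a ^ 2)) • b.e i := by
    have := lie_e_cartan b (b.h' i) i
    rw [coe_h', baseSupp_h'_self] at this
    rw [smul_lie, lie_smul, this, smul_smul, smul_smul]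
    congr 1; ring
  rw [xRoot, expAd_apply_of_lie_lie_lie (isNilpotent_ad_smul (isNilpotent_ad_e b i) a)
    (by rw [h1, h2]; simp), h1, h2, smul_smul, sub_eq_add_neg, ← neg_smul]
  congr 2; ring

theorem yRoot_apply_e (i : ι) (a : ℂ) :
    yRoot b i a (b.e i) = b.e i - a • b.h i - (a ^ 2) • b.f i := by
  have := xRoot_apply_f b.symm i a
  rw [b.symm_e, b.symm_f, b.symm_h, Pi.neg_apply] at this
  rw [yRoot_eq_symm, this, smul_neg, ← sub_eq_add_neg]

/-- The representative `x_i(c) y_i(-c⁻¹) x_i(c)` of the simple reflection `s_i`, the image of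
`!![0, c; -c⁻¹, 0]` under `SL₂ → G`. -/
def nRoot (i : ι) (c : ℂ) : L ≃ₗ[ℂ] L := xRoot b i c * yRoot b i (-c⁻¹) * xRoot b i c

omit [FiniteDimensional ℂ L] in
theorem nRoot_mem_lieAut (i : ι) (c : ℂ) : nRoot b i c ∈ lieAut L :=
  mul_mem (mul_mem (xRoot_mem_lieAut b i _) (yRoot_mem_lieAut b i _)) (xRoot_mem_lieAut b i _)

omit [FiniteDimensional ℂ L] in
theorem sBar_eq_nRoot (i : ι) : sBar b i = nRoot b i (-1) := by
  rw [sBar, nRoot, inv_neg, inv_one, neg_neg]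

omit [FiniteDimensional ℂ L] in
theorem simpleCoroot_eq_nRoot (i : ι) (a : ℂ) :
    simpleCoroot b i a = nRoot b i a * (nRoot b i 1)⁻¹ := by
  rw [simpleCoroot, nRoot, nRoot, inv_one]

theorem nRoot_apply_e (i : ι) {c : ℂ} (hc : c ≠ 0) :
    nRoot b i c (b.e i) = (-(c ^ 2)⁻¹) • b.f i := by
  rw [nRoot, LinearEquiv.mul_apply, LinearEquiv.mul_apply, xRoot_apply_e, yRoot_apply_e]
  simp only [map_sub, map_smul, xRoot_apply_e, xRoot_apply_h, xRoot_apply_f]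
  match_scalars <;> field_simp <;> ring

/-- `nRoot b i c` acts on the Cartan subalgebra as the simple reflection. -/
theorem nRoot_apply_cartan (i : ι) {c : ℂ} (hc : c ≠ 0) (h : H) :
    nRoot b i c (h : L) = h - b.baseSupp i h • b.h i := by
  rw [nRoot, LinearEquiv.mul_apply, LinearEquiv.mul_apply, xRoot_apply_cartan]
  simp only [map_sub, map_add, map_smul, xRoot_apply_e, xRoot_apply_h, xRoot_apply_f,
    yRoot_apply_e, yRoot_apply_cartan, xRoot_apply_cartan]
  match_scalars <;> field_simp <;> ring

theorem nRoot_conj_xRoot (i : ι) {c : ℂ} (hc : c ≠ 0) (s : ℂ) :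
    nRoot b i c * xRoot b i s * (nRoot b i c)⁻¹ = yRoot b i (-s * (c ^ 2)⁻¹) := by
  rw [xRoot, conj_expAd (nRoot_mem_lieAut b i c), map_smul, nRoot_apply_e b i hc, smul_smul, yRoot]
  congr 2; ring

omit [FiniteDimensional ℂ L] in
/-- Rescaling the graded pieces by the powers of `r` is an automorphism. -/
theorem IsGrading.exists_scale {ρ : L} (hρ : IsGrading ρ) {r : ℂ} (hr : r ≠ 0) :
    ∃ S ∈ lieAut L, ∀ m : ℤ, ∀ v ∈ gradedPiece ρ m, S v = r ^ m • v := by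
  obtain ⟨S, hS⟩ := hρ.exists_end fun m => r ^ m • LinearMap.id
  obtain ⟨T, hT⟩ := hρ.exists_end fun m => r ^ (-m) • LinearMap.id
  have hS' : ∀ m : ℤ, ∀ v ∈ gradedPiece ρ m, S v = r ^ m • v := fun m v hv => by
    rw [hS m v hv]; rfl
  have hT' : ∀ m : ℤ, ∀ v ∈ gradedPiece ρ m, T v = r ^ (-m) • v := fun m v hv => by
    rw [hT m v hv]; rfl
  have h1 : ∀ v, S (T v) = v := hρ.induction (fun m v hv => by
    rw [hT' m v hv, map_smul, hS' m v hv, smul_smul, ← zpow_add₀ hr, neg_add_cancel, zpow_zero,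
      one_smul]) fun x y hx hy => by rw [map_add, map_add, hx, hy]
  have h2 : ∀ v, T (S v) = v := hρ.induction (fun m v hv => by
    rw [hS' m v hv, map_smul, hT' m v hv, smul_smul, ← zpow_add₀ hr, add_neg_cancel, zpow_zero,
      one_smul]) fun x y hx hy => by rw [map_add, map_add, hx, hy]
  refine ⟨LinearEquiv.ofLinearMap S T (LinearMap.ext h1) (LinearMap.ext h2), ?_, hS'⟩
  change ∀ x y, S ⁅x, y⁆ = ⁅S x, S y⁆
  refine hρ.induction (fun m x hx => ?_) fun x x' hx hx' y => by
    rw [add_lie, map_add, hx, hx', map_add, add_lie]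
  refine hρ.induction (fun n y hy => ?_) fun y y' hy hy' => by
    rw [lie_add, map_add, hy, hy', map_add, lie_add]
  rw [hS' _ _ (lie_mem_gradedPiece hx hy), hS' m x hx, hS' n y hy, smul_lie, lie_smul, smul_smul,
    zpow_add₀ hr]

omit [FiniteDimensional ℂ L] in
theorem e_mem_gradedPiece_h (i j : ι) : b.e j ∈ gradedPiece (b.h i) (b.A j i) := by
  rw [mem_gradedPiece, b.lie_h_e, Int.cast_smul_eq_zsmul]

omit [FiniteDimensional ℂ L] in
theorem f_mem_gradedPiece_h (i j : ι) : b.f j ∈ gradedPiece (b.h i) (-b.A j i) := by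
  rw [mem_gradedPiece, b.lie_h_f, Int.cast_smul_eq_zsmul]

omit [FiniteDimensional ℂ L] in
theorem A_self (i : ι) : b.A i i = 2 := by
  have : IsAddTorsionFree L := .of_isTorsionFree ℂ L
  exact b.A_diag_eq_two i

/-- `α_i^∨(a)` acts on the eigenspaces of `h_i` by the powers of `a`. For a square root `r` of `a`
the scaling `S` by powers of `r` conjugates `nRoot b i 1` to `nRoot b i a`, while `nRoot b i 1`
conjugates `S⁻¹` to `S`. -/
theorem simpleCoroot_apply (i : ι) {a : ℂ} (ha : a ≠ 0) {m : ℤ} {v : L}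
    (hv : v ∈ gradedPiece (b.h i) m) : simpleCoroot b i a v = a ^ m • v := by
  obtain ⟨r, hr⟩ := IsAlgClosed.exists_pow_nat_eq a (n := 2) (by norm_num)
  have hr0 : r ≠ 0 := by rintro rfl; exact ha (by rw [← hr]; simp)
  obtain ⟨S, hSaut, hS⟩ := (isGrading_h b i).exists_scale hr0
  have hSe : S (b.e i) = a • b.e i := by
    rw [hS _ _ (e_mem_gradedPiece_h b i i), A_self, ← hr]; norm_cast
  have hSf : S (b.f i) = a⁻¹ • b.f i := by
    rw [hS _ _ (f_mem_gradedPiece_h b i i), A_self, ← hr, zpow_neg]; norm_cast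
  have h1 : S * nRoot b i 1 * S⁻¹ = nRoot b i a := by
    have e1 : S * xRoot b i 1 * S⁻¹ = xRoot b i a := by
      rw [xRoot, conj_expAd hSaut, one_smul, hSe, xRoot]
    have e2 : S * yRoot b i (-1) * S⁻¹ = yRoot b i (-a⁻¹) := by
      rw [yRoot, conj_expAd hSaut, map_smul, hSf, yRoot, smul_smul, neg_one_mul]
    rw [nRoot, nRoot, ← e1, ← e2, inv_one]
    group
  have h2 : (nRoot b i 1)⁻¹ (b.h i) = -b.h i := by
    have := nRoot_apply_cartan b i one_ne_zero (b.h' i)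
    rw [coe_h', baseSupp_h'_self] at this
    have h3 : nRoot b i 1 (-b.h i) = b.h i := by rw [map_neg, this, two_smul]; abel
    rw [← h3, inv_apply_self', h3]
  have h4 : (nRoot b i 1)⁻¹ v ∈ gradedPiece (b.h i) (-m) := by
    rw [mem_gradedPiece] at hv ⊢
    have h5 : ⁅-b.h i, (nRoot b i 1)⁻¹ v⁆ = (nRoot b i 1)⁻¹ ⁅b.h i, v⁆ := by
      rw [lieAut_apply_lie (inv_mem (nRoot_mem_lieAut b i 1)), h2]
    rw [hv, map_smul, neg_lie] at h5
    rw [neg_eq_iff_eq_neg.mp h5, Int.cast_neg, neg_smul]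
  have hSinv : ∀ k : ℤ, ∀ w ∈ gradedPiece (b.h i) k, S⁻¹ w = r ^ (-k) • w := by
    intro k w hw
    have : S (r ^ (-k) • w) = w := by
      rw [map_smul, hS k w hw, smul_smul, ← zpow_add₀ hr0, neg_add_cancel, zpow_zero, one_smul]
    conv_lhs => rw [← this]
    rw [inv_apply_self']
  rw [simpleCoroot_eq_nRoot, ← h1]
  simp only [LinearEquiv.mul_apply]
  rw [hSinv _ _ h4, map_smul, apply_inv_self', map_smul, hS m v hv, smul_smul, neg_neg, ← hr,
    ← zpow_natCast, ← zpow_mul, ← zpow_add₀ hr0]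
  congr 2; push_cast; ring

theorem simpleCoroot_apply_cartan (i : ι) {a : ℂ} (ha : a ≠ 0) (h : H) :
    simpleCoroot b i a (h : L) = h := by
  have := simpleCoroot_apply b i ha (cartan_mem_gradedPiece b (b.h' i) h)
  rwa [zpow_zero, one_smul] at this

theorem simpleCoroot_apply_e (i j : ι) {a : ℂ} (ha : a ≠ 0) :
    simpleCoroot b i a (b.e j) = a ^ (b.A j i) • b.e j :=
  simpleCoroot_apply b i ha (e_mem_gradedPiece_h b i j)

theorem simpleCoroot_mul (i : ι) {a a' : ℂ} (ha : a ≠ 0) (ha' : a' ≠ 0) :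
    simpleCoroot b i a * simpleCoroot b i a' = simpleCoroot b i (a * a') := by
  refine LinearEquiv.ext ((isGrading_h b i).induction (fun m v hv => ?_) fun x y hx hy => by
    rw [map_add, hx, hy, map_add])
  rw [LinearEquiv.mul_apply, simpleCoroot_apply b i ha' hv, map_smul, simpleCoroot_apply b i ha hv,
    simpleCoroot_apply b i (mul_ne_zero ha ha') hv, smul_smul, mul_zpow, mul_comm]

omit [FiniteDimensional ℂ L] in
theorem simpleCoroot_one (i : ι) : simpleCoroot b i 1 = 1 := by
  rw [simpleCoroot_eq_nRoot, mul_inv_cancel]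

theorem simpleCoroot_inv (i : ι) {a : ℂ} (ha : a ≠ 0) :
    (simpleCoroot b i a)⁻¹ = simpleCoroot b i a⁻¹ := by
  rw [inv_eq_iff_mul_eq_one, simpleCoroot_mul b i ha (inv_ne_zero ha), mul_inv_cancel₀ ha,
    simpleCoroot_one]

/-- The identity `!![1, s; 0, 1] * !![1, 0; a, 1] = !![1, 0; a', 1] * diag (d, d⁻¹) * !![1, s'; 0, 1]`
in `SL₂`, with `d = 1 + s a`. -/
theorem xRoot_mul_yRoot (i : ι) {s a : ℂ} (h : 1 + s * a ≠ 0) :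
    xRoot b i s * yRoot b i a =
      yRoot b i (a / (1 + s * a)) * simpleCoroot b i (1 + s * a) * xRoot b i (s / (1 + s * a)) := by
  rcases eq_or_ne s 0 with rfl | hs
  · simp [simpleCoroot_one]
  rcases eq_or_ne a 0 with rfl | ha
  · simp [simpleCoroot_one]
  set d := 1 + s * a with hd
  -- Both one-parameter subgroups are expressed through the representatives of `s_i`.
  have hx : xRoot b i s = yRoot b i s⁻¹ * nRoot b i s * yRoot b i s⁻¹ := by
    have h1 := nRoot_conj_xRoot b i hs s
    rw [mul_inv_eq_iff_eq_mul] at h1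
    have h2 : nRoot b i s * xRoot b i s =
        yRoot b i (-s⁻¹) * (xRoot b i s * yRoot b i (-s⁻¹) * xRoot b i s) := by
      rw [h1, nRoot]; congr 2; field_simp
    have h3 : nRoot b i s = yRoot b i (-s⁻¹) * xRoot b i s * yRoot b i (-s⁻¹) := by
      rw [← mul_left_inj (xRoot b i s), h2]; group
    rw [h3, ← yRoot_inv]; group
  have hy : yRoot b i (d / s) = xRoot b i (s / d) * (nRoot b i (s / d))⁻¹ * xRoot b i (s / d) := by
    rw [nRoot, mul_inv_rev, mul_inv_rev, yRoot_inv, neg_neg, inv_div]; group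
  have h4 : yRoot b i s⁻¹ * yRoot b i a = yRoot b i (d / s) := by
    rw [← yRoot_add]; congr 1; rw [hd]; field_simp
  have hn : nRoot b i s * (nRoot b i (s / d))⁻¹ = simpleCoroot b i d := by
    have h5 : nRoot b i (s / d) = simpleCoroot b i (s / d) * nRoot b i 1 := by
      rw [simpleCoroot_eq_nRoot]; group
    have h6 : nRoot b i s = simpleCoroot b i s * nRoot b i 1 := by
      rw [simpleCoroot_eq_nRoot]; group
    rw [h5, h6, mul_inv_rev, simpleCoroot_inv b i (div_ne_zero hs h), inv_div]
    rw [show simpleCoroot b i s * nRoot b i 1 * ((nRoot b i 1)⁻¹ * simpleCoroot b i (d / s)) =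
      simpleCoroot b i s * simpleCoroot b i (d / s) by group,
      simpleCoroot_mul b i hs (div_ne_zero h hs), mul_div_cancel₀ _ hs]
  have h7 := nRoot_conj_xRoot b i hs (s / d)
  rw [mul_inv_eq_iff_eq_mul] at h7
  calc xRoot b i s * yRoot b i a
      = yRoot b i s⁻¹ * nRoot b i s * (yRoot b i s⁻¹ * yRoot b i a) := by rw [hx]; group
    _ = yRoot b i s⁻¹ * (nRoot b i s * xRoot b i (s / d)) * (nRoot b i (s / d))⁻¹ *
          xRoot b i (s / d) := by rw [h4, hy]; group
    _ = yRoot b i (s⁻¹ + -(s / d) * (s ^ 2)⁻¹) * (nRoot b i s * (nRoot b i (s / d))⁻¹) *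
          xRoot b i (s / d) := by rw [h7, yRoot_add]; group
    _ = _ := by
      rw [hn]
      congr 3
      field_simp
      rw [hd]; ring

omit [FiniteDimensional ℂ L] in
theorem xRoot_mul_yRoot_of_ne {i j : ι} (h : i ≠ j) (s a : ℂ) :
    xRoot b i s * yRoot b j a = yRoot b j a * xRoot b i s := by
  rw [← mul_inv_eq_iff_eq_mul, yRoot, conj_expAd (xRoot_mem_lieAut b i s), map_smul]
  congr 2
  exact expAd_apply_of_lie (by rw [smul_lie, b.lie_e_f_ne i j h, smul_zero])

end SL2

/-! ### The torus and the Borel subgroup -/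

section Borel

variable {L : Type*} [LieRing L] [LieAlgebra ℂ L] [FiniteDimensional ℂ L]
  {H : LieSubalgebra ℂ L} {ι : Type*} [Fintype ι] (b : LieAlgebra.Basis ι H)

omit [FiniteDimensional ℂ L] in
theorem closure_expAd_le_lieAut (S : Set L) :
    Subgroup.closure {g : L ≃ₗ[ℂ] L | ∃ z ∈ S, g = expAd z} ≤ lieAut L := by
  rw [Subgroup.closure_le]
  rintro _ ⟨z, -, rfl⟩
  exact expAd_mem_lieAut z

omit [FiniteDimensional ℂ L] in
theorem conj_mem_closure_expAd {S : Set L} {g u : L ≃ₗ[ℂ] L} (hg : g ∈ lieAut L)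
    (hS : ∀ z ∈ S, g z ∈ S)
    (hu : u ∈ Subgroup.closure {g : L ≃ₗ[ℂ] L | ∃ z ∈ S, g = expAd z}) :
    g * u * g⁻¹ ∈ Subgroup.closure {g : L ≃ₗ[ℂ] L | ∃ z ∈ S, g = expAd z} := by
  induction hu using Subgroup.closure_induction with
  | mem x hx =>
    obtain ⟨z, hz, rfl⟩ := hx
    exact Subgroup.subset_closure ⟨g z, hS z hz, conj_expAd hg z⟩
  | one => simp
  | mul x y _ _ hx hy => convert mul_mem hx hy using 1; group
  | inv x _ hx => convert inv_mem hx using 1; group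

omit [FiniteDimensional ℂ L] in
theorem unipLower_eq : unipLower b =
    Subgroup.closure {g | ∃ z ∈ (lieSpan ℂ L (Set.range b.f) : Set L), g = expAd z} := by
  simp only [unipLower, SetLike.mem_coe]

omit [FiniteDimensional ℂ L] in
theorem unipLower_le_lieAut : unipLower b ≤ lieAut L := by
  rw [unipLower_eq]; exact closure_expAd_le_lieAut _

omit [FiniteDimensional ℂ L] in
theorem isLower_of_mem_unipLower {u : L ≃ₗ[ℂ] L} (hu : u ∈ unipLower b) :
    IsLower (principal b : L) 1 u := by
  rw [unipLower_eq] at hu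
  exact isLower_of_mem_closure (by norm_num) (fun _ hz => lieSpan_f_le b hz)
    (fun _ hz => neg_mem (S := LieSubalgebra ℂ L) hz) hu

omit [FiniteDimensional ℂ L] in
theorem isLower_of_mem_unipUpper {u : L ≃ₗ[ℂ] L} (hu : u ∈ unipUpper b) :
    IsLower (-(principal b : L)) 1 u := by
  have := isLower_of_mem_unipLower b.symm hu
  rwa [principal_symm] at this

omit [FiniteDimensional ℂ L] in
theorem yRoot_mem_unipLower (i : ι) (a : ℂ) : yRoot b i a ∈ unipLower b :=
  Subgroup.subset_closure
    ⟨_, LieSubalgebra.smul_mem _ a (LieSubalgebra.subset_lieSpan ⟨i, rfl⟩), rfl⟩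

omit [FiniteDimensional ℂ L] in
theorem xRoot_mem_unipUpper (i : ι) (a : ℂ) : xRoot b i a ∈ unipUpper b :=
  yRoot_mem_unipLower b.symm i a

omit [FiniteDimensional ℂ L] in
theorem torus_apply_mem_gradedPiece {t : L ≃ₗ[ℂ] L} (ht : t ∈ torus H) (h : H) {m : ℤ} {v : L}
    (hv : v ∈ gradedPiece (h : L) m) : t v ∈ gradedPiece (h : L) m := by
  rw [mem_gradedPiece] at *
  rw [← map_smul, ← hv, lieAut_apply_lie (torus_le_lieAut H ht), ht.2 _ h.2]

omit [FiniteDimensional ℂ L] in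
theorem torus_apply_mem_filtLE {t : L ≃ₗ[ℂ] L} (ht : t ∈ torus H) (h : H) {m : ℤ} {v : L}
    (hv : v ∈ filtLE (h : L) m) : t v ∈ filtLE (h : L) m := by
  refine filtLE_induction hv (fun k hk x hx => ?_) fun x y hx hy => by
    rw [map_add]; exact add_mem hx hy
  exact gradedPiece_le_filtLE _ hk (torus_apply_mem_gradedPiece ht h hx)

omit [FiniteDimensional ℂ L] in
theorem torus_conj_mem_unipLower {t u : L ≃ₗ[ℂ] L} (ht : t ∈ torus H) (hu : u ∈ unipLower b) :
    t * u * t⁻¹ ∈ unipLower b := by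
  rw [unipLower_eq] at hu ⊢
  exact conj_mem_closure_expAd (torus_le_lieAut H ht) (fun _ hz =>
    (mem_lieSpan_f_iff b).mpr (torus_apply_mem_filtLE ht _ (lieSpan_f_le b hz))) hu

omit [FiniteDimensional ℂ L] in
theorem torus_conj_mem_unipUpper {t u : L ≃ₗ[ℂ] L} (ht : t ∈ torus H) (hu : u ∈ unipUpper b) :
    t * u * t⁻¹ ∈ unipUpper b :=
  torus_conj_mem_unipLower b.symm ht hu

theorem simpleCoroot_mem_torus (i : ι) {a : ℂ} (ha : a ≠ 0) : simpleCoroot b i a ∈ torus H := by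
  refine ⟨?_, fun h hh => simpleCoroot_apply_cartan b i ha ⟨h, hh⟩⟩
  have hx : ∀ c, xRoot b i c ∈ adjointGroup L := fun c => expAd_mem_adjointGroup _
  have hy : ∀ c, yRoot b i c ∈ adjointGroup L := fun c => expAd_mem_adjointGroup _
  exact mul_mem (mul_mem (mul_mem (hx _) (hy _)) (hx _))
    (inv_mem (mul_mem (mul_mem (hx _) (hy _)) (hx _)))

omit [FiniteDimensional ℂ L] in
theorem torusPos_le_torus [FiniteDimensional ℂ L] : torusPos b ≤ (torus H).toSubmonoid := by
  rw [torusPos, Submonoid.closure_le]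
  rintro _ ⟨i, a, ha, rfl⟩
  exact simpleCoroot_mem_torus b i (by exact_mod_cast ha.ne')

omit [FiniteDimensional ℂ L] in
theorem eq_one_of_mem_unipLower_of_mem_torus {u : L ≃ₗ[ℂ] L} (hu : u ∈ unipLower b)
    (ht : u ∈ torus H) : u = 1 := by
  refine LinearEquiv.ext ((isGrading_principal b).induction (fun m v hv => ?_) fun x y hx hy => by
    rw [map_add, hx, hy, map_add])
  have h1 := isLower_of_mem_unipLower b hu m v (gradedPiece_le_filtLE _ le_rfl hv)
  exact sub_eq_zero.mp ((isGrading_principal b).eq_zero (by lia)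
    (sub_mem (torus_apply_mem_gradedPiece ht _ hv) hv) h1)

omit [FiniteDimensional ℂ L] in
theorem borelMinus_apply_mem_filtLE {g : L ≃ₗ[ℂ] L} (hg : g ∈ borelMinus b) {m : ℤ} {v : L}
    (hv : v ∈ filtLE (principal b : L) m) : g v ∈ filtLE (principal b : L) m := by
  obtain ⟨u, hu, t, ht, rfl⟩ := hg
  have h1 := torus_apply_mem_filtLE ht _ hv
  have h2 := isLower_of_mem_unipLower b hu m _ h1
  rw [LinearEquiv.mul_apply, ← sub_add_cancel (u (t v)) (t v)]
  exact add_mem (filtLE_mono _ (by lia) h2) h1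

omit [FiniteDimensional ℂ L] in
theorem eq_one_of_mem_unipUpper_of_mem_borelMinus {u : L ≃ₗ[ℂ] L} (hu : u ∈ unipUpper b)
    (hg : u ∈ borelMinus b) : u = 1 := by
  refine LinearEquiv.ext ((isGrading_principal b).induction (fun m v hv => ?_) fun x y hx hy => by
    rw [map_add, hx, hy, map_add])
  have h0 : v ∈ filtLE (-(principal b : L)) (-m) :=
    gradedPiece_le_filtLE _ le_rfl (by rw [gradedPiece_neg, neg_neg]; exact hv)
  have h0' : v ∈ filtLE (principal b : L) m := gradedPiece_le_filtLE _ le_rfl hv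
  exact sub_eq_zero.mp ((isGrading_principal b).eq_zero_of_mem_filtLE_neg (by lia)
    (sub_mem (borelMinus_apply_mem_filtLE b hg h0') h0') (isLower_of_mem_unipUpper b hu _ v h0))

omit [FiniteDimensional ℂ L] in
theorem mul_mem_borelMinus {g g' : L ≃ₗ[ℂ] L} (hg : g ∈ borelMinus b) (hg' : g' ∈ borelMinus b) :
    g * g' ∈ borelMinus b := by
  obtain ⟨u, hu, t, ht, rfl⟩ := hg
  obtain ⟨u', hu', t', ht', rfl⟩ := hg'
  exact ⟨u * (t * u' * t⁻¹), mul_mem hu (torus_conj_mem_unipLower b ht hu'), t * t',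
    mul_mem ht ht', by group⟩

omit [FiniteDimensional ℂ L] in
theorem unipLower_subset_borelMinus {u : L ≃ₗ[ℂ] L} (hu : u ∈ unipLower b) : u ∈ borelMinus b :=
  ⟨u, hu, 1, one_mem _, (mul_one u).symm⟩

omit [FiniteDimensional ℂ L] in
theorem torus_subset_borelMinus {t : L ≃ₗ[ℂ] L} (ht : t ∈ torus H) : t ∈ borelMinus b :=
  ⟨1, one_mem _, t, ht, (one_mul t).symm⟩

omit [FiniteDimensional ℂ L] in
theorem inv_mem_borelMinus {g : L ≃ₗ[ℂ] L} (hg : g ∈ borelMinus b) : g⁻¹ ∈ borelMinus b := by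
  obtain ⟨u, hu, t, ht, rfl⟩ := hg
  rw [mul_inv_rev]
  exact mul_mem_borelMinus b (torus_subset_borelMinus b (inv_mem ht))
    (unipLower_subset_borelMinus b (inv_mem hu))

omit [FiniteDimensional ℂ L] in
theorem weight_mul {u t : L ≃ₗ[ℂ] L} (hu : u ∈ unipLower b) (ht : t ∈ torus H) :
    weight b (u * t) = t := by
  have h := Classical.epsilon_spec
    (p := fun s => s ∈ torus H ∧ u * t * s⁻¹ ∈ unipLower b) ⟨t, ht, by simpa using hu⟩
  change weight b (u * t) ∈ torus H ∧ u * t * (weight b (u * t))⁻¹ ∈ unipLower b at h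
  set s := weight b (u * t)
  have h1 : t * s⁻¹ ∈ unipLower b := by
    have := mul_mem (inv_mem hu) h.2
    rwa [mul_assoc, inv_mul_cancel_left] at this
  have h2 := eq_one_of_mem_unipLower_of_mem_torus b h1 (mul_mem ht (inv_mem h.1))
  exact (mul_inv_eq_one.mp h2).symm

omit [FiniteDimensional ℂ L] in
theorem phi_mul {u t : L ≃ₗ[ℂ] L} (hu : u ∈ unipLower b) (ht : t ∈ torus H) (i : ι) :
    phi b i (u * t) = lowerChar b i u := by
  rw [phi, weight_mul b hu ht, mul_inv_cancel_right]

omit [FiniteDimensional ℂ L] in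
theorem eps_mul {u t : L ≃ₗ[ℂ] L} (hu : u ∈ unipLower b) (ht : t ∈ torus H) (i : ι) :
    eps b i (u * t) = lowerChar b i u * simpleRoot b i t := by
  rw [eps, weight_mul b hu ht, phi_mul b hu ht]

omit [FiniteDimensional ℂ L] in
theorem e_ne_zero (i : ι) : b.e i ≠ 0 := (b.sl2 i).e_ne_zero

omit [FiniteDimensional ℂ L] in
theorem simpleRoot_eq {i : ι} {t : L ≃ₗ[ℂ] L} {c : ℂ} (h : t (b.e i) = c • b.e i) :
    simpleRoot b i t = c := by
  have h1 := Classical.epsilon_spec (p := fun c : ℂ => t (b.e i) = c • b.e i) ⟨c, h⟩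
  exact smul_left_injective ℂ (e_ne_zero b i) (h1.symm.trans h)

theorem simpleRoot_simpleCoroot (i j : ι) {a : ℂ} (ha : a ≠ 0) :
    simpleRoot b j (simpleCoroot b i a) = a ^ b.A j i :=
  simpleRoot_eq b (simpleCoroot_apply_e b i j ha)

end Borel

section Root

variable {L : Type*} [LieRing L] [LieAlgebra ℂ L] [FiniteDimensional ℂ L] [IsSimple ℂ L]
  {H : LieSubalgebra ℂ L} [H.IsCartanSubalgebra] {ι : Type*} [Fintype ι] (b : LieAlgebra.Basis ι H)

theorem exists_torus_apply_e {t : L ≃ₗ[ℂ] L} (ht : t ∈ torus H) (i : ι) :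
    ∃ c : ℂ, t (b.e i) = c • b.e i := by
  have hmem : ∀ v : L, (∀ h : H, ⁅(h : L), v⁆ = b.baseSupp i h • v) →
      v ∈ rootSpace H (b.baseSupp i) := fun v hv =>
    (LieModule.mem_genWeightSpace _ _ _).mpr fun ⟨z, hz⟩ ↦ ⟨1, by
      have := hv ⟨z, hz⟩
      simpa [sub_eq_zero] using this⟩
  have h1 : b.e i ∈ rootSpace H ((b.baseSupp' i).val : H → ℂ) :=
    hmem _ fun h => lie_cartan_e b h i
  have h2 : t (b.e i) ∈ rootSpace H ((b.baseSupp' i).val : H → ℂ) := hmem (t (b.e i)) fun h => by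
    rw [← map_smul, ← lie_cartan_e, lieAut_apply_lie (torus_le_lieAut H ht), ht.2 _ h.2]
  have h3 := IsKilling.finrank_rootSpace_eq_one (b.baseSupp' i).val
    (LieSubalgebra.isNonZero_coe_root _)
  obtain ⟨c, hc⟩ := (finrank_eq_one_iff_of_nonzero' (⟨_, h1⟩ : rootSpace H (b.baseSupp' i).val)
    (fun h => e_ne_zero b i (congrArg Subtype.val h))).mp h3 ⟨_, h2⟩
  exact ⟨c, (congrArg Subtype.val hc).symm⟩

theorem torus_apply_e {t : L ≃ₗ[ℂ] L} (ht : t ∈ torus H) (i : ι) :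
    t (b.e i) = simpleRoot b i t • b.e i := by
  obtain ⟨c, hc⟩ := exists_torus_apply_e b ht i
  rw [simpleRoot_eq b hc, hc]

theorem simpleRoot_ne_zero {t : L ≃ₗ[ℂ] L} (ht : t ∈ torus H) (i : ι) : simpleRoot b i t ≠ 0 := by
  intro h
  have h1 := torus_apply_e b ht i
  rw [h, zero_smul] at h1
  exact e_ne_zero b i ((LinearEquiv.map_eq_zero_iff t).mp h1)

theorem torus_apply_f {t : L ≃ₗ[ℂ] L} (ht : t ∈ torus H) (i : ι) :
    t (b.f i) = (simpleRoot b i t)⁻¹ • b.f i := by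
  obtain ⟨c, hc⟩ := exists_torus_apply_e b.symm ht i
  rw [b.symm_e] at hc
  have h1 := lieAut_apply_lie (torus_le_lieAut H ht) (b.e i) (b.f i)
  rw [(b.sl2 i).lie_e_f, hc, torus_apply_e b ht, smul_lie, lie_smul, (b.sl2 i).lie_e_f, smul_smul,
    ← coe_h', ht.2 _ (b.h' i).2] at h1
  have h2 : simpleRoot b i t * c = 1 := by
    refine smul_left_injective ℂ (b.sl2 i).h_ne_zero ?_
    simp only [one_smul]
    exact h1.symm
  rw [hc, eq_inv_of_mul_eq_one_right h2]

theorem simpleRoot_mul {t t' : L ≃ₗ[ℂ] L} (ht : t ∈ torus H) (ht' : t' ∈ torus H) (i : ι) :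
    simpleRoot b i (t * t') = simpleRoot b i t * simpleRoot b i t' :=
  simpleRoot_eq b (by
    rw [LinearEquiv.mul_apply, torus_apply_e b ht', map_smul, torus_apply_e b ht, smul_smul,
      mul_comm])

theorem torus_conj_xRoot {t : L ≃ₗ[ℂ] L} (ht : t ∈ torus H) (i : ι) (a : ℂ) :
    t * xRoot b i a * t⁻¹ = xRoot b i (simpleRoot b i t * a) := by
  rw [xRoot, conj_expAd (torus_le_lieAut H ht), map_smul, torus_apply_e b ht, smul_smul, mul_comm,
    xRoot]

theorem torus_conj_yRoot {t : L ≃ₗ[ℂ] L} (ht : t ∈ torus H) (i : ι) (a : ℂ) :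
    t * yRoot b i a * t⁻¹ = yRoot b i ((simpleRoot b i t)⁻¹ * a) := by
  rw [yRoot, conj_expAd (torus_le_lieAut H ht), map_smul, torus_apply_f b ht, smul_smul, mul_comm,
    yRoot]

theorem lowerChar_torus_conj {t : L ≃ₗ[ℂ] L} (ht : t ∈ torus H) (i : ι) (u : L ≃ₗ[ℂ] L) :
    lowerChar b i (t * u * t⁻¹) = (simpleRoot b i t)⁻¹ * lowerChar b i u := by
  have h1 : t⁻¹ (b.h i) = b.h i := (inv_mem ht).2 _ (b.h' i).2
  have h2 : simpleRoot b i t * killingForm ℂ L (b.e i) ((t * u * t⁻¹) (b.h i)) =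
      killingForm ℂ L (b.e i) (u (b.h i)) := by
    have h3 := killingForm_apply_apply (torus_le_lieAut H ht) (b.e i) (u (b.h i))
    rw [torus_apply_e b ht, map_smul, LinearMap.smul_apply, smul_eq_mul] at h3
    simp only [LinearEquiv.mul_apply, h1]
    exact h3
  rw [lowerChar, lowerChar, ← h2, mul_div_assoc, inv_mul_cancel_left₀ (simpleRoot_ne_zero b ht i)]

omit [IsSimple ℂ L] [H.IsCartanSubalgebra] in
theorem killingForm_e_f_ne_zero [IsSimple ℂ L] (i : ι) :
    killingForm ℂ L (b.e i) (b.f i) ≠ 0 := by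
  classical
  intro h
  have := lowerChar_yRoot b i i 1
  rw [lowerChar, h] at this
  simp at this

omit [FiniteDimensional ℂ L] [IsSimple ℂ L] [H.IsCartanSubalgebra] in
theorem killingForm_e_f_of_ne {i j : ι} (hij : i ≠ j) : killingForm ℂ L (b.e i) (b.f j) = 0 := by
  have h1 := LieModule.traceForm_apply_lie_apply ℂ L L (b.h i) (b.e i) (b.f j)
  rw [b.lie_e_f_ne i j hij, (b.sl2 i).lie_h_e_nsmul, map_zero, map_nsmul,
    LinearMap.smul_apply] at h1
  simpa using h1

end Root

/-! ### The kernel of the additive character `χ_i⁻` -/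

section LowerKer

variable {L : Type*} [LieRing L] [LieAlgebra ℂ L] [FiniteDimensional ℂ L] [IsSimple ℂ L]
  {H : LieSubalgebra ℂ L} [H.IsCartanSubalgebra] {ι : Type*} [Fintype ι] (b : LieAlgebra.Basis ι H)

/-- The sum of the root spaces of the negative roots other than `-α_i`: the elements of negative
degree orthogonal to `e_i`. -/
def lowerKerLie (i : ι) : Set L :=
  {z | z ∈ filtLE (principal b : L) (-1) ∧ killingForm ℂ L (b.e i) z = 0}

/-- The subgroup generated by the exponentials of elements of `lowerKerLie b i`, the unipotent
radical of the minimal parabolic subgroup of index `i` containing `B⁻`. -/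
def lowerKer (i : ι) : Subgroup (L ≃ₗ[ℂ] L) :=
  Subgroup.closure {g | ∃ z ∈ lowerKerLie b i, g = expAd z}

omit [IsSimple ℂ L] [H.IsCartanSubalgebra] [FiniteDimensional ℂ L] in
theorem mem_lowerKerLie_of_mem_filtLE (i : ι) {z : L} (hz : z ∈ filtLE (principal b : L) (-2)) :
    z ∈ lowerKerLie b i :=
  ⟨filtLE_mono _ (by lia) hz,
    killingForm_gradedPiece_filtLE (by lia) (e_mem_gradedPiece b i) hz⟩

omit [H.IsCartanSubalgebra] in
/-- `lowerKerLie b i` is stable under `e_i`, as `e_i` annihilates its piece of degree `-1`. -/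
theorem lie_e_mem_lowerKerLie (i : ι) {z : L} (hz : z ∈ lowerKerLie b i) :
    ⁅b.e i, z⁆ ∈ lowerKerLie b i := by
  refine ⟨?_, ?_⟩
  · obtain ⟨S, hS1, hS2, hS3, hS4⟩ := (isGrading_principal b).exists_proj (-1)
    have h1 := hS4 z hz.1
    have h2 := hS3 z
    have h3 : ⁅b.e i, S z⁆ = 0 := by
      have hk : killingForm ℂ L (b.e i) (S z) = 0 := by
        have := killingForm_gradedPiece_filtLE (by lia) (e_mem_gradedPiece b i) h1
        rwa [map_sub, hz.2, zero_sub, neg_eq_zero] at this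
      obtain ⟨c, hc⟩ := (Submodule.mem_span_range_iff_exists_fun ℂ).mp
        (gradedPiece_neg_one_le b h2)
      rw [← hc] at hk ⊢
      have h4 : ∀ j, j ≠ i → ⁅b.e i, c j • b.f j⁆ = 0 := fun j hj => by
        rw [lie_smul, b.lie_e_f_ne i j hj.symm, smul_zero]
      have h5 : c i = 0 := by
        rw [map_sum, Finset.sum_eq_single i (fun j _ hj => by
          rw [map_smul, killingForm_e_f_of_ne b hj.symm, smul_zero]) (by simp), map_smul,
          smul_eq_mul] at hk
        exact (mul_eq_zero.mp hk).resolve_right (killingForm_e_f_ne_zero b i)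
      rw [lie_sum, Finset.sum_eq_single i (fun j _ hj => h4 j hj) (by simp), h5, zero_smul,
        lie_zero]
    have h4 : ⁅b.e i, z⁆ = ⁅b.e i, z - S z⁆ := by rw [lie_sub, h3, sub_zero]
    rw [h4]
    exact lie_mem_filtLE_of_le (gradedPiece_le_filtLE _ le_rfl (e_mem_gradedPiece b i)) h1 (by lia)
  · have := LieModule.traceForm_apply_lie_apply ℂ L L (b.e i) (b.e i) z
    rw [lie_self, map_zero, LinearMap.zero_apply] at this
    exact this.symm

omit [H.IsCartanSubalgebra] in
theorem xRoot_conj_mem_lowerKer (i : ι) (s : ℂ) {n : L ≃ₗ[ℂ] L} (hn : n ∈ lowerKer b i) :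
    xRoot b i s * n * (xRoot b i s)⁻¹ ∈ lowerKer b i := by
  refine conj_mem_closure_expAd (xRoot_mem_lieAut b i s) (fun z hz => ?_) hn
  let N : Submodule ℂ L := filtLE (principal b : L) (-1) ⊓ LinearMap.ker (killingForm ℂ L (b.e i))
  have h1 : ∀ w ∈ N, ⁅s • b.e i, w⁆ ∈ N := fun w hw => by
    rw [smul_lie]; exact Submodule.smul_mem _ _ (lie_e_mem_lowerKerLie b i hw)
  have h2 := expAd_sub_mem N (h1 z hz) h1
  have h3 := add_mem h2 (show z ∈ N from hz)
  rw [sub_add_cancel] at h3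
  exact h3

theorem torus_conj_mem_lowerKer (i : ι) {t : L ≃ₗ[ℂ] L} (ht : t ∈ torus H) {n : L ≃ₗ[ℂ] L}
    (hn : n ∈ lowerKer b i) : t * n * t⁻¹ ∈ lowerKer b i := by
  refine conj_mem_closure_expAd (torus_le_lieAut H ht) (fun z hz => ?_) hn
  refine ⟨torus_apply_mem_filtLE ht _ hz.1, ?_⟩
  have h := killingForm_apply_apply (torus_le_lieAut H ht) (b.e i) z
  rw [torus_apply_e b ht, map_smul, LinearMap.smul_apply, smul_eq_mul, hz.2] at h
  exact (mul_eq_zero.mp h).resolve_left (simpleRoot_ne_zero b ht i)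

omit [IsSimple ℂ L] [H.IsCartanSubalgebra] [FiniteDimensional ℂ L] in
theorem lowerKer_le (i : ι) : lowerKer b i ≤ unipLower b :=
  Subgroup.closure_mono fun _ ⟨z, hz, h⟩ => ⟨z, (mem_lieSpan_f_iff b).mpr hz.1, h⟩

omit [IsSimple ℂ L] [H.IsCartanSubalgebra] [FiniteDimensional ℂ L] in
/-- On `exp (ad z)` the character `χ_i⁻` is the coefficient of `f_i` in `z`. -/
theorem lowerChar_expAd [FiniteDimensional ℂ L] (i : ι) {z : L}
    (hz : z ∈ filtLE (principal b : L) (-1)) :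
    lowerChar b i (expAd z) =
      killingForm ℂ L (b.e i) z / killingForm ℂ L (b.e i) (b.f i) := by
  have hnil := (isGrading_principal b).isNilpotent_ad hz
  have h1 : expAd z (b.h i) - b.h i - ⁅z, b.h i⁆ ∈ filtLE (principal b : L) (-2) := by
    obtain ⟨n, hn⟩ := hnil
    have hn' : ad ℂ L z ^ (n + 2) = 0 := by rw [pow_add, hn, zero_mul]
    have h0 : ∀ j : ℕ, (ad ℂ L z ^ j) (b.h i) ∈ filtLE (principal b : L) (-j) := by
      intro j
      induction j with
      | zero =>
        rw [pow_zero]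
        exact gradedPiece_le_filtLE _ (by simp) (cartan_mem_gradedPiece b _ (b.h' i))
      | succ j ih =>
        rw [pow_succ', Module.End.mul_apply, ad_apply]
        exact lie_mem_filtLE_of_le hz ih (by push_cast; lia)
    rw [expAd_apply hn', Finset.sum_range_succ', Finset.sum_range_succ']
    simp only [zero_add, Nat.factorial_one, Nat.cast_one, inv_one, pow_one, one_smul,
      Nat.factorial_zero, pow_zero, Module.End.one_apply, ad_apply]
    rw [add_sub_cancel_right, add_sub_cancel_right]
    exact Submodule.sum_mem _ fun j _ => Submodule.smul_mem _ _
      (filtLE_mono _ (by push_cast; lia) (h0 _))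
  have h2 := killingForm_gradedPiece_filtLE (by lia) (e_mem_gradedPiece b i) h1
  have h3 : killingForm ℂ L (b.e i) ⁅z, b.h i⁆ = 2 * killingForm ℂ L (b.e i) z := by
    have h4 := LieModule.traceForm_apply_lie_apply ℂ L L (b.h i) (b.e i) z
    rw [(b.sl2 i).lie_h_e_nsmul, map_nsmul, LinearMap.smul_apply] at h4
    have h5 := LieModule.traceForm_apply_lie_apply' ℂ L L (b.h i) (b.e i) z
    rw [(b.sl2 i).lie_h_e_nsmul, map_nsmul, LinearMap.smul_apply] at h5
    rw [← lie_skew, map_neg]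
    change _ = 2 * LieModule.traceForm ℂ L L (b.e i) z
    rw [two_mul, ← two_nsmul, h5]
  rw [map_sub, map_sub, killingForm_e_h, h3, sub_zero, sub_eq_zero] at h2
  rw [lowerChar, h2, mul_div_mul_left _ _ two_ne_zero]

omit [H.IsCartanSubalgebra] in
theorem lowerChar_eq_zero (i : ι) {n : L ≃ₗ[ℂ] L} (hn : n ∈ lowerKer b i) :
    lowerChar b i n = 0 := by
  induction hn using Subgroup.closure_induction'' with
  | mem g hg =>
    obtain ⟨z, hz, rfl⟩ := hg
    rw [lowerChar_expAd b i hz.1, hz.2, zero_div]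
  | inv_mem g hg =>
    obtain ⟨z, hz, rfl⟩ := hg
    rw [expAd_inv, lowerChar_expAd b i (neg_mem hz.1), map_neg, hz.2, neg_zero, zero_div]
  | one =>
    classical
    have := lowerChar_yRoot b i i 0
    simpa using this
  | mul x y hx hy hx' hy' =>
    rw [lowerChar_mul b i (lowerKer_le b i hx) (lowerKer_le b i hy), hx', hy', add_zero]

omit [H.IsCartanSubalgebra] in
/-- `U⁻` is the product of the one-parameter subgroup `y_i` and of `lowerKer b i`. -/
theorem exists_yRoot_mul (i : ι) {u : L ≃ₗ[ℂ] L} (hu : u ∈ unipLower b) :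
    ∃ n ∈ lowerKer b i, u = yRoot b i (lowerChar b i u) * n := by
  classical
  refine ⟨(yRoot b i (lowerChar b i u))⁻¹ * u, ?_, by group⟩
  set u' := (yRoot b i (lowerChar b i u))⁻¹ * u with hu'
  have hmem : u' ∈ unipLower b := mul_mem (inv_mem (yRoot_mem_unipLower b i _)) hu
  have hchar : lowerChar b i u' = 0 := by
    rw [hu', yRoot_inv, lowerChar_mul b i (yRoot_mem_unipLower b i _) hu, lowerChar_yRoot,
      if_pos rfl, neg_add_cancel]
  obtain ⟨z, hz, g, hg, heq⟩ := (IsLower.exists_expAd_mul (isGrading_principal b) (k := 1) le_rfl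
    (unipLower_le_lieAut b hmem) (by exact_mod_cast isLower_of_mem_unipLower b hmem))
  have hg' : g ∈ lowerKer b i := by
    refine Subgroup.closure_mono ?_ hg
    rintro _ ⟨w, hw, rfl⟩
    exact ⟨w, mem_lowerKerLie_of_mem_filtLE b i (filtLE_mono _ (by norm_num) hw), rfl⟩
  have hzf : z ∈ filtLE (principal b : L) (-1) :=
    gradedPiece_le_filtLE _ (by norm_num) hz
  have hexp : expAd z ∈ unipLower b :=
    Subgroup.subset_closure ⟨z, (mem_lieSpan_f_iff b).mpr hzf, rfl⟩
  rw [heq, lowerChar_mul b i hexp (lowerKer_le b i hg'), lowerChar_eq_zero b i hg', add_zero,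
    lowerChar_expAd b i hzf, div_eq_zero_iff] at hchar
  rw [heq]
  exact mul_mem (Subgroup.subset_closure
    ⟨z, ⟨hzf, hchar.resolve_right (killingForm_e_f_ne_zero b i)⟩, rfl⟩) hg'

end LowerKer

/-! ### The maps `e_i^c` on the crystal -/

section Action

variable {L : Type*} [LieRing L] [LieAlgebra ℂ L]
  {H : LieSubalgebra ℂ L} {ι : Type*} [Fintype ι] (b : LieAlgebra.Basis ι H)

/-- The formula defining `e_i^c`, as a total function (with junk values where it is not defined). -/
def eMap (i : ι) (c : ℂ) (x : L ≃ₗ[ℂ] L) : L ≃ₗ[ℂ] L :=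
  xRoot b i ((c - 1) / phi b i x) * x * xRoot b i ((c⁻¹ - 1) / eps b i x)

theorem mem_eAct_iff {IP : Set ι} {ii : List ι} {i : ι} {c : ℂ} {x z : L ≃ₗ[ℂ] L} :
    z ∈ eAct b IP ii i c x ↔
      (x ∈ crystal b IP ii ∧ c ≠ 0 ∧ phi b i x ≠ 0 ∧ eps b i x ≠ 0) ∧ eMap b i c x = z :=
  ⟨fun ⟨h, h'⟩ => ⟨h, h'⟩, fun ⟨h, h'⟩ => ⟨h, h'⟩⟩

variable [FiniteDimensional ℂ L] [IsSimple ℂ L] [H.IsCartanSubalgebra]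

/-- The Gauss decomposition of `e_i^c (u t)`: moving the first factor `x_i(s)` past
`u = y_i(φ) n` changes `φ` to `φ / c`, produces `α_i^∨(c)` as `1 + s φ = c`, and leaves a factor
`x_i(s / c)` which cancels against the last one. -/
theorem exists_eq_mul_simpleCoroot {i : ι} {c : ℂ} (hc : c ≠ 0) {u t : L ≃ₗ[ℂ] L}
    (hu : u ∈ unipLower b) (ht : t ∈ torus H) (hφ : lowerChar b i u ≠ 0) :
    ∃ u' ∈ unipLower b, lowerChar b i u' = lowerChar b i u / c ∧
      xRoot b i ((c - 1) / lowerChar b i u) * (u * t) *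
        xRoot b i ((c⁻¹ - 1) / (lowerChar b i u * simpleRoot b i t)) =
      u' * (simpleCoroot b i c * t) := by
  classical
  obtain ⟨n, hn, hun⟩ := exists_yRoot_mul b i hu
  set φ := lowerChar b i u with hφdef
  have hα := simpleRoot_ne_zero b ht i
  set α := simpleRoot b i t with hαdef
  have hcor := simpleCoroot_mem_torus b i hc
  have h1 : 1 + (c - 1) / φ * φ = c := by field_simp; ring
  have h2 := xRoot_mul_yRoot b i (s := (c - 1) / φ) (a := φ) (by rw [h1]; exact hc)
  rw [h1] at h2
  set s := (c - 1) / φ / c with hs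
  have hn' := xRoot_conj_mem_lowerKer b i s hn
  set n' := xRoot b i s * n * (xRoot b i s)⁻¹ with hn'def
  have hn'' := torus_conj_mem_lowerKer b i hcor hn'
  refine ⟨yRoot b i (φ / c) * (simpleCoroot b i c * n' * (simpleCoroot b i c)⁻¹),
    mul_mem (yRoot_mem_unipLower b i _) (lowerKer_le b i hn''), ?_, ?_⟩
  · rw [lowerChar_mul b i (yRoot_mem_unipLower b i _) (lowerKer_le b i hn''), lowerChar_yRoot,
      if_pos rfl, lowerChar_eq_zero b i hn'', add_zero]
  · have h3 : t⁻¹ * xRoot b i s * t = xRoot b i (α⁻¹ * s) := by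
      have := torus_conj_xRoot b ht i (α⁻¹ * s)
      rw [← hαdef, mul_inv_cancel_left₀ hα] at this
      rw [← this]; group
    have h4 : xRoot b i (α⁻¹ * s) * xRoot b i ((c⁻¹ - 1) / (φ * α)) = 1 := by
      rw [← xRoot_add, ← xRoot_zero b i]
      congr 1
      rw [hs]
      field_simp
      ring
    calc xRoot b i ((c - 1) / φ) * (u * t) * xRoot b i ((c⁻¹ - 1) / (φ * α))
        = (xRoot b i ((c - 1) / φ) * yRoot b i φ) * (n * t) *
            xRoot b i ((c⁻¹ - 1) / (φ * α)) := by rw [hun]; group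
      _ = yRoot b i (φ / c) * simpleCoroot b i c * n' * t *
            ((t⁻¹ * xRoot b i s * t) * xRoot b i ((c⁻¹ - 1) / (φ * α))) := by
          rw [h2, hn'def]; group
      _ = _ := by rw [h3, h4]; group

theorem eMap_spec {i : ι} {c : ℂ} (hc : c ≠ 0) {x : L ≃ₗ[ℂ] L} (hx : x ∈ borelMinus b)
    (hφ : phi b i x ≠ 0) :
    eMap b i c x ∈ borelMinus b ∧ phi b i (eMap b i c x) = phi b i x / c ∧
      weight b (eMap b i c x) = simpleCoroot b i c * weight b x := by
  obtain ⟨u, hu, t, ht, rfl⟩ := hx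
  rw [eMap, eps_mul b hu ht, phi_mul b hu ht, weight_mul b hu ht] at *
  obtain ⟨u', hu', h1, h2⟩ := exists_eq_mul_simpleCoroot b hc hu ht hφ
  have ht' := mul_mem (simpleCoroot_mem_torus b i hc) ht
  rw [h2, phi_mul b hu' ht', weight_mul b hu' ht']
  exact ⟨⟨u', hu', _, ht', rfl⟩, h1, rfl⟩

omit [FiniteDimensional ℂ L] [IsSimple ℂ L] [H.IsCartanSubalgebra] in
theorem weight_mem_torus {x : L ≃ₗ[ℂ] L} (hx : x ∈ borelMinus b) : weight b x ∈ torus H := by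
  obtain ⟨u, hu, t, ht, rfl⟩ := hx
  rwa [weight_mul b hu ht]

theorem simpleRoot_weight_ne_zero {x : L ≃ₗ[ℂ] L} (hx : x ∈ borelMinus b) (i : ι) :
    simpleRoot b i (weight b x) ≠ 0 :=
  simpleRoot_ne_zero b (weight_mem_torus b hx) i

theorem eps_ne_zero {x : L ≃ₗ[ℂ] L} (hx : x ∈ borelMinus b) {i : ι} (hφ : phi b i x ≠ 0) :
    eps b i x ≠ 0 :=
  mul_ne_zero hφ (simpleRoot_weight_ne_zero b hx i)

theorem simpleRoot_weight_eMap {i : ι} {c : ℂ} (hc : c ≠ 0) {x : L ≃ₗ[ℂ] L}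
    (hx : x ∈ borelMinus b) (hφ : phi b i x ≠ 0) :
    simpleRoot b i (weight b (eMap b i c x)) = c ^ 2 * simpleRoot b i (weight b x) := by
  rw [(eMap_spec b hc hx hφ).2.2, simpleRoot_mul b (simpleCoroot_mem_torus b i hc)
    (weight_mem_torus b hx), simpleRoot_simpleCoroot b i i hc, A_self]
  norm_cast

theorem eMap_inv_eMap {i : ι} {c : ℂ} (hc : c ≠ 0) {x : L ≃ₗ[ℂ] L}
    (hx : x ∈ borelMinus b) (hφ : phi b i x ≠ 0) :
    eMap b i c⁻¹ (eMap b i c x) = x := by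
  have h1 := (eMap_spec b hc hx hφ).2.1
  have h2 := simpleRoot_weight_eMap b hc hx hφ
  have hα := simpleRoot_weight_ne_zero b hx i
  rw [eMap, eps, h1, h2, eMap, eps]
  set φ := phi b i x
  set α := simpleRoot b i (weight b x)
  have e1 : xRoot b i ((c⁻¹ - 1) / (φ / c)) * xRoot b i ((c - 1) / φ) = 1 := by
    rw [← xRoot_add, ← xRoot_zero b i]
    congr 1
    field_simp
    ring
  have e2 : xRoot b i ((c⁻¹ - 1) / (φ * α)) *
      xRoot b i ((c⁻¹⁻¹ - 1) / (φ / c * (c ^ 2 * α))) = 1 := by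
    rw [← xRoot_add, ← xRoot_zero b i, inv_inv]
    congr 1
    field_simp
    ring
  calc _ = (xRoot b i ((c⁻¹ - 1) / (φ / c)) * xRoot b i ((c - 1) / φ)) * x *
        (xRoot b i ((c⁻¹ - 1) / (φ * α)) *
          xRoot b i ((c⁻¹⁻¹ - 1) / (φ / c * (c ^ 2 * α)))) := by group
    _ = x := by rw [e1, e2, one_mul, mul_one]

theorem eMap_mem_crystal {IP : Set ι} {ii : List ι} {i : ι} {c : ℂ} (hc : c ≠ 0)
    {x : L ≃ₗ[ℂ] L} (hx : x ∈ crystal b IP ii) (hφ : phi b i x ≠ 0) :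
    eMap b i c x ∈ crystal b IP ii := by
  refine ⟨(eMap_spec b hc hx.1 hφ).1, ?_⟩
  obtain ⟨-, u₁, hu₁, t, ht, u₂, hu₂, hx'⟩ := hx
  refine ⟨xRoot b i ((c - 1) / phi b i x) * u₁, mul_mem (xRoot_mem_unipUpper b i _) hu₁, t, ht,
    u₂ * xRoot b i ((c⁻¹ - 1) / eps b i x), mul_mem hu₂ (xRoot_mem_unipUpper b i _), ?_⟩
  rw [eMap]
  generalize xRoot b i ((c - 1) / phi b i x) = g
  generalize xRoot b i ((c⁻¹ - 1) / eps b i x) = k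
  rw [hx']
  simp only [mul_assoc]

end Action

/-! ### Regularity -/

section Regular

variable {L : Type*} [LieRing L] [LieAlgebra ℂ L]

/-- On `X` the function `F` is regular away from the zeros of `q`. -/
def IsFrac (X : Set (L ≃ₗ[ℂ] L)) (q F : (L ≃ₗ[ℂ] L) → ℂ) : Prop :=
  ∃ r ∈ coordRing L, ∃ n : ℕ, ∀ y ∈ X, q y ≠ 0 → F y = r y / q y ^ n

theorem isFrac_of_mem {X : Set (L ≃ₗ[ℂ] L)} {q F : (L ≃ₗ[ℂ] L) → ℂ} (hF : F ∈ coordRing L) :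
    IsFrac X q F := ⟨F, hF, 0, fun y _ _ => by simp⟩

theorem isFrac_const {X : Set (L ≃ₗ[ℂ] L)} {q : (L ≃ₗ[ℂ] L) → ℂ} (c : ℂ) :
    IsFrac X q fun _ => c :=
  isFrac_of_mem ((coordRing L).algebraMap_mem c)

theorem IsFrac.congr {X : Set (L ≃ₗ[ℂ] L)} {q F F' : (L ≃ₗ[ℂ] L) → ℂ} (h : IsFrac X q F)
    (h' : ∀ y ∈ X, q y ≠ 0 → F' y = F y) : IsFrac X q F' := by
  obtain ⟨r, hr, n, hrn⟩ := h
  exact ⟨r, hr, n, fun y hy hq => by rw [h' y hy hq, hrn y hy hq]⟩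

theorem IsFrac.add {X : Set (L ≃ₗ[ℂ] L)} {q F F' : (L ≃ₗ[ℂ] L) → ℂ} (hq : q ∈ coordRing L)
    (h : IsFrac X q F) (h' : IsFrac X q F') : IsFrac X q fun y => F y + F' y := by
  obtain ⟨r, hr, n, hrn⟩ := h
  obtain ⟨r', hr', n', hrn'⟩ := h'
  refine ⟨r * q ^ n' + r' * q ^ n, add_mem (mul_mem hr (pow_mem hq _)) (mul_mem hr' (pow_mem hq _)),
    n + n', fun y hy hqy => ?_⟩
  simp only [hrn y hy hqy, hrn' y hy hqy, Pi.add_apply, Pi.mul_apply, Pi.pow_apply]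
  field_simp
  ring

theorem IsFrac.mul {X : Set (L ≃ₗ[ℂ] L)} {q F F' : (L ≃ₗ[ℂ] L) → ℂ}
    (h : IsFrac X q F) (h' : IsFrac X q F') : IsFrac X q fun y => F y * F' y := by
  obtain ⟨r, hr, n, hrn⟩ := h
  obtain ⟨r', hr', n', hrn'⟩ := h'
  refine ⟨r * r', mul_mem hr hr', n + n', fun y hy hqy => ?_⟩
  simp only [hrn y hy hqy, hrn' y hy hqy, Pi.mul_apply]
  rw [pow_add, div_mul_div_comm]

theorem IsFrac.pow {X : Set (L ≃ₗ[ℂ] L)} {q F : (L ≃ₗ[ℂ] L) → ℂ}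
    (h : IsFrac X q F) (k : ℕ) : IsFrac X q fun y => F y ^ k := by
  induction k with
  | zero => simpa using isFrac_const 1
  | succ k ih => simpa only [pow_succ] using ih.mul h

theorem IsFrac.sum {X : Set (L ≃ₗ[ℂ] L)} {q : (L ≃ₗ[ℂ] L) → ℂ} (hq : q ∈ coordRing L)
    {κ : Type*} (s : Finset κ) {F : κ → (L ≃ₗ[ℂ] L) → ℂ} (h : ∀ k, IsFrac X q (F k)) :
    IsFrac X q fun y => ∑ k ∈ s, F k y := by
  classical
  induction s using Finset.induction_on with
  | empty => simpa using isFrac_const 0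
  | insert a s ha ih =>
    simp only [Finset.sum_insert ha]
    exact (h a).add hq ih

theorem matrixCoeff_mem_coordRing (ξ : Module.Dual ℂ L) (v : L) :
    (fun g : L ≃ₗ[ℂ] L => ξ (g v)) ∈ coordRing L :=
  Algebra.subset_adjoin ⟨ξ, v, rfl⟩

/-- Regular maps compose: if the second one is regular where `q'` does not vanish, and `q'` pulls back
to `r / q ^ n`, then the composite is regular where `q r` does not vanish. -/
theorem IsRegularAt.comp {X : Set (L ≃ₗ[ℂ] L)} {f g : (L ≃ₗ[ℂ] L) →. (L ≃ₗ[ℂ] L)}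
    {x z : L ≃ₗ[ℂ] L} (hf : IsRegularAt X f x) (hz : z ∈ f x) (hg : IsRegularAt X g z) :
    IsRegularAt X (g.comp f) x := by
  obtain ⟨hx, q, hq, hqx, hdef, hreg⟩ := hf
  obtain ⟨-, q', hq', hqz, hdef', hreg'⟩ := hg
  obtain ⟨r, hr, n, hrn⟩ := hreg q' hq'
  have hzero : ∀ y ∈ X, (q * r) y ≠ 0 → ∀ w ∈ f y, q' w ≠ 0 := fun y hy hqr w hw => by
    have h1 := mul_ne_zero_iff.mp hqr
    rw [hrn y hy h1.1 w hw]
    exact div_ne_zero h1.2 (pow_ne_zero _ h1.1)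
  refine ⟨hx, q * r, mul_mem hq hr, ?_, fun y hy hqr => ?_, fun p hp => ?_⟩
  · have h1 := hrn x hx hqx z hz
    refine mul_ne_zero hqx fun h0 => hqz ?_
    rw [h1, h0, zero_div]
  · obtain ⟨w, hw, hwX⟩ := hdef y hy (left_ne_zero_of_mul hqr)
    obtain ⟨v, hv, hvX⟩ := hdef' w hwX (hzero y hy hqr w hw)
    exact ⟨v, by rw [PFun.comp_apply]; exact Part.mem_bind hw hv, hvX⟩
  · obtain ⟨r', hr', m, hrm⟩ := hreg' p hp
    obtain ⟨r'', hr'', k, hrk⟩ := hreg r' hr'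
    refine ⟨r'' * q ^ (n * m + m) * r ^ k,
      mul_mem (mul_mem hr'' (pow_mem hq _)) (pow_mem hr _), k + m, fun y hy hqr v hv => ?_⟩
    rw [PFun.comp_apply] at hv
    obtain ⟨w, hw, hv⟩ := Part.mem_bind_iff.mp hv
    have h1 := mul_ne_zero_iff.mp hqr
    obtain ⟨w', hw', hwX⟩ := hdef y hy h1.1
    have hww : w = w' := Part.mem_unique hw hw'
    subst hww
    rw [hrm w hwX (hzero y hy hqr w hw) v hv, hrk y hy h1.1 w hw, hrn y hy h1.1 w hw]
    have hqy : q y ≠ 0 := h1.1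
    have hry : r y ≠ 0 := h1.2
    simp only [Pi.mul_apply, Pi.pow_apply]
    rw [div_pow, div_div_div_eq, div_eq_div_iff (by positivity) (by positivity)]
    ring

variable [FiniteDimensional ℂ L]
  {H : LieSubalgebra ℂ L} {ι : Type*} [Fintype ι] (b : LieAlgebra.Basis ι H)

/-- The entries of `x_i(a)` are polynomials in `a`. -/
theorem exists_xRoot_apply (i : ι) : ∃ (n : ℕ) (E : ℕ → Module.End ℂ L),
    ∀ (a : ℂ) (v : L), xRoot b i a v = ∑ k ∈ Finset.range n, a ^ k • E k v := by
  obtain ⟨n, hn⟩ := isNilpotent_ad_e b i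
  refine ⟨n, fun k => (k.factorial : ℂ)⁻¹ • ad ℂ L (b.e i) ^ k, fun a v => ?_⟩
  rw [xRoot, expAd_apply (n := n) (by rw [map_smul, smul_pow, hn, smul_zero])]
  refine Finset.sum_congr rfl fun k _ => ?_
  rw [map_smul, smul_pow, LinearMap.smul_apply, LinearMap.smul_apply, smul_comm]

theorem IsFrac.xRoot_mul_mul_xRoot {X : Set (L ≃ₗ[ℂ] L)} {q s s' p : (L ≃ₗ[ℂ] L) → ℂ}
    (hq : q ∈ coordRing L) (i : ι) (hs : IsFrac X q s) (hs' : IsFrac X q s')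
    (hp : p ∈ coordRing L) :
    IsFrac X q fun y => p (xRoot b i (s y) * y * xRoot b i (s' y)) := by
  obtain ⟨n, E, hE⟩ := exists_xRoot_apply b i
  rw [coordRing] at hp
  induction hp using Algebra.adjoin_induction with
  | mem p hp =>
    obtain ⟨ξ, v, rfl⟩ := hp
    have h1 : ∀ y : L ≃ₗ[ℂ] L, ξ ((xRoot b i (s y) * y * xRoot b i (s' y)) v) =
        ∑ k ∈ Finset.range n, ∑ l ∈ Finset.range n,
          s y ^ k * s' y ^ l * (ξ ∘ₗ E k) (y (E l v)) := by
      intro y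
      rw [LinearEquiv.mul_apply, LinearEquiv.mul_apply, hE, hE, map_sum]
      refine Finset.sum_congr rfl fun k _ => ?_
      rw [map_smul, smul_eq_mul, map_sum, map_sum, map_sum, Finset.mul_sum]
      refine Finset.sum_congr rfl fun l _ => ?_
      rw [map_smul, map_smul, map_smul, smul_eq_mul, LinearMap.comp_apply, mul_assoc]
    simp only [h1]
    exact IsFrac.sum hq _ fun k => IsFrac.sum hq _ fun l =>
      ((hs.pow k).mul (hs'.pow l)).mul (isFrac_of_mem (matrixCoeff_mem_coordRing _ _))
  | algebraMap c => exact isFrac_const c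
  | add p p' _ _ hp hp' => exact hp.add hq hp'
  | mul p p' _ _ hp hp' => exact hp.mul hp'

variable [IsSimple ℂ L] [H.IsCartanSubalgebra]

omit [FiniteDimensional ℂ L] [IsSimple ℂ L] [H.IsCartanSubalgebra] in
/-- On `B⁻` the function `φ_i` is a matrix coefficient, as `T` fixes `h_i`. -/
theorem phi_eq {x : L ≃ₗ[ℂ] L} (hx : x ∈ borelMinus b) (i : ι) :
    phi b i x = killingForm ℂ L (b.e i) (x (b.h i)) / (2 * killingForm ℂ L (b.e i) (b.f i)) := by
  obtain ⟨u, hu, t, ht, rfl⟩ := hx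
  rw [phi_mul b hu ht, lowerChar, LinearEquiv.mul_apply, ← coe_h', ht.2 _ (b.h' i).2]

/-- On `B⁻` the function `α_i ∘ γ` is a matrix coefficient. -/
theorem simpleRoot_weight_eq {x : L ≃ₗ[ℂ] L} (hx : x ∈ borelMinus b) (i : ι) :
    simpleRoot b i (weight b x) =
      killingForm ℂ L (b.f i) (x (b.e i)) / killingForm ℂ L (b.f i) (b.e i) := by
  obtain ⟨u, hu, t, ht, rfl⟩ := hx
  have h1 := isLower_of_mem_unipLower b hu 1 _
    (gradedPiece_le_filtLE _ le_rfl (e_mem_gradedPiece b i))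
  have h2 := killingForm_gradedPiece_filtLE (by lia) (f_mem_gradedPiece b i) h1
  rw [map_sub, sub_eq_zero] at h2
  have h3 : killingForm ℂ L (b.f i) (b.e i) ≠ 0 := killingForm_e_f_ne_zero b.symm i
  rw [weight_mul b hu ht, LinearEquiv.mul_apply, torus_apply_e b ht, map_smul, map_smul, h2,
    smul_eq_mul, mul_div_cancel_right₀ _ h3]

/-- `e_i^c` is regular where `φ_i` does not vanish, also when `c` is a regular function. -/
theorem isRegularAt_eAct {IP : Set ι} {ii : List ι} {i : ι} {x : L ≃ₗ[ℂ] L}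
    (hx : x ∈ crystal b IP ii) (hφ : phi b i x ≠ 0) {c : (L ≃ₗ[ℂ] L) → ℂ}
    (hc : ∀ y ∈ crystal b IP ii, c y ≠ 0)
    (hreg : ∀ q ∈ coordRing L, IsFrac (crystal b IP ii) q
        (fun y => (simpleRoot b i (weight b y))⁻¹) →
      IsFrac (crystal b IP ii) q c ∧ IsFrac (crystal b IP ii) q fun y => (c y)⁻¹) :
    IsRegularAt (crystal b IP ii) (fun y => eAct b IP ii i (c y) y) x := by
  let F : (L ≃ₗ[ℂ] L) → ℂ := fun y =>
    ((2 * killingForm ℂ L (b.e i) (b.f i))⁻¹ • killingForm ℂ L (b.e i)) (y (b.h i))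
  let A : (L ≃ₗ[ℂ] L) → ℂ := fun y =>
    ((killingForm ℂ L (b.f i) (b.e i))⁻¹ • killingForm ℂ L (b.f i)) (y (b.e i))
  have hF : F ∈ coordRing L := matrixCoeff_mem_coordRing _ _
  have hA : A ∈ coordRing L := matrixCoeff_mem_coordRing _ _
  have hFφ : ∀ y ∈ crystal b IP ii, phi b i y = F y := fun y hy => by
    rw [phi_eq b hy.1, div_eq_inv_mul]; rfl
  have hAα : ∀ y ∈ crystal b IP ii, simpleRoot b i (weight b y) = A y := fun y hy => by
    rw [simpleRoot_weight_eq b hy.1, div_eq_inv_mul]; rfl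
  have hA0 : ∀ y ∈ crystal b IP ii, A y ≠ 0 := fun y hy => by
    rw [← hAα y hy]; exact simpleRoot_weight_ne_zero b hy.1 i
  have hq : F * A ∈ coordRing L := mul_mem hF hA
  have hinv : IsFrac (crystal b IP ii) (F * A) fun y => (phi b i y)⁻¹ :=
    ⟨A, hA, 1, fun y hy hqy => by
      have h1 := mul_ne_zero_iff.mp hqy
      change (phi b i y)⁻¹ = _
      rw [hFφ y hy, pow_one, Pi.mul_apply]
      have h2 := h1.1
      have h3 := h1.2
      field_simp⟩
  have hinv' : IsFrac (crystal b IP ii) (F * A) fun y => (simpleRoot b i (weight b y))⁻¹ :=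
    ⟨F, hF, 1, fun y hy hqy => by
      have h1 := mul_ne_zero_iff.mp hqy
      change (simpleRoot b i (weight b y))⁻¹ = _
      rw [hAα y hy, pow_one, Pi.mul_apply]
      have h2 := h1.1
      have h3 := h1.2
      field_simp⟩
  have hφ0 : ∀ y ∈ crystal b IP ii, (F * A) y ≠ 0 → phi b i y ≠ 0 := fun y hy hqy => by
    rw [hFφ y hy]; exact left_ne_zero_of_mul hqy
  obtain ⟨hc1, hc2⟩ := hreg _ hq hinv'
  have hneg : IsFrac (crystal b IP ii) (F * A) fun _ => -1 := isFrac_const (-1)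
  have hs : IsFrac (crystal b IP ii) (F * A) fun y => (c y - 1) / phi b i y :=
    ((hc1.add hq hneg).mul hinv).congr fun y _ _ => by rw [div_eq_mul_inv, sub_eq_add_neg]
  have hs' : IsFrac (crystal b IP ii) (F * A) fun y => ((c y)⁻¹ - 1) / eps b i y :=
    ((hc2.add hq hneg).mul (hinv.mul hinv')).congr fun y _ _ => by
      rw [div_eq_mul_inv, sub_eq_add_neg, eps, mul_inv]
  refine ⟨hx, F * A, hq, mul_ne_zero (hFφ x hx ▸ hφ) (hA0 x hx), fun y hy hqy => ?_,
    fun p hp => ?_⟩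
  · exact ⟨_, (mem_eAct_iff b).mpr ⟨⟨hy, hc y hy, hφ0 y hy hqy, eps_ne_zero b hy.1 (hφ0 y hy hqy)⟩,
      rfl⟩, eMap_mem_crystal b (hc y hy) hy (hφ0 y hy hqy)⟩
  · obtain ⟨r, hr, n, hrn⟩ := IsFrac.xRoot_mul_mul_xRoot b hq i hs hs' hp
    refine ⟨r, hr, n, fun y hy hqy z hz => ?_⟩
    obtain ⟨-, rfl⟩ := (mem_eAct_iff b).mp hz
    exact hrn y hy hqy

end Regular

/-! ### Totally nonnegative elements -/

section Positive

variable {L : Type*} [LieRing L] [LieAlgebra ℂ L]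
  {H : LieSubalgebra ℂ L} {ι : Type*} [Fintype ι] (b : LieAlgebra.Basis ι H)

/-- The totally nonnegative part of `U⁻`, generated by the `y_i(a)` with `a > 0`. -/
def lowerNonneg : Submonoid (L ≃ₗ[ℂ] L) :=
  Submonoid.closure {g | ∃ i : ι, ∃ a : ℝ, 0 < a ∧ g = yRoot b i a}

/-- The totally nonnegative part of `U`, generated by the `x_i(a)` with `a > 0`. -/
def upperNonneg : Submonoid (L ≃ₗ[ℂ] L) :=
  Submonoid.closure {g | ∃ i : ι, ∃ a : ℝ, 0 < a ∧ g = xRoot b i a}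

theorem yRoot_mem_lowerNonneg (i : ι) {a : ℝ} (ha : 0 < a) : yRoot b i a ∈ lowerNonneg b :=
  Submonoid.subset_closure ⟨i, a, ha, rfl⟩

theorem xRoot_mem_upperNonneg (i : ι) {a : ℝ} (ha : 0 < a) : xRoot b i a ∈ upperNonneg b :=
  Submonoid.subset_closure ⟨i, a, ha, rfl⟩

theorem simpleCoroot_mem_torusPos (i : ι) {a : ℝ} (ha : 0 < a) :
    simpleCoroot b i a ∈ torusPos b :=
  Submonoid.subset_closure ⟨i, a, ha, rfl⟩

theorem lowerNonneg_le_unipLower : lowerNonneg b ≤ (unipLower b).toSubmonoid := by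
  rw [lowerNonneg, Submonoid.closure_le]
  rintro _ ⟨i, a, -, rfl⟩
  exact yRoot_mem_unipLower b i a

theorem upperNonneg_le_unipUpper : upperNonneg b ≤ (unipUpper b).toSubmonoid := by
  rw [upperNonneg, Submonoid.closure_le]
  rintro _ ⟨i, a, -, rfl⟩
  exact xRoot_mem_unipUpper b i a

theorem lowerNonneg_le_groupNonneg : lowerNonneg b ≤ groupNonneg b := by
  rw [lowerNonneg, Submonoid.closure_le]
  rintro _ ⟨i, a, ha, rfl⟩
  exact Submonoid.subset_closure ⟨i, a, ha, Or.inr (Or.inr rfl)⟩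

theorem torusPos_le_groupNonneg : torusPos b ≤ groupNonneg b := by
  rw [torusPos, Submonoid.closure_le]
  rintro _ ⟨i, a, ha, rfl⟩
  exact Submonoid.subset_closure ⟨i, a, ha, Or.inl rfl⟩

variable [FiniteDimensional ℂ L] [IsSimple ℂ L] [H.IsCartanSubalgebra]

theorem exists_simpleRoot_eq {t : L ≃ₗ[ℂ] L} (ht : t ∈ torusPos b) (i : ι) :
    ∃ r : ℝ, 0 < r ∧ simpleRoot b i t = r := by
  induction ht using Submonoid.closure_induction with
  | mem g hg =>
    obtain ⟨j, a, ha, rfl⟩ := hg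
    refine ⟨a ^ b.A i j, zpow_pos ha _, ?_⟩
    rw [simpleRoot_simpleCoroot b j i (by exact_mod_cast ha.ne')]
    norm_cast
  | one => exact ⟨1, one_pos, by rw [simpleRoot_eq b (c := 1) (by simp)]; norm_cast⟩
  | mul t t' ht ht' h h' =>
    obtain ⟨r, hr, h⟩ := h
    obtain ⟨r', hr', h'⟩ := h'
    refine ⟨r * r', mul_pos hr hr', ?_⟩
    rw [simpleRoot_mul b (torusPos_le_torus b ht) (torusPos_le_torus b ht'), h, h']
    norm_cast

theorem torusPos_conj_mem_lowerNonneg {t u : L ≃ₗ[ℂ] L} (ht : t ∈ torusPos b)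
    (hu : u ∈ lowerNonneg b) : t * u * t⁻¹ ∈ lowerNonneg b := by
  induction hu using Submonoid.closure_induction with
  | mem g hg =>
    obtain ⟨j, a, ha, rfl⟩ := hg
    obtain ⟨r, hr, h⟩ := exists_simpleRoot_eq b ht j
    rw [torus_conj_yRoot b (torusPos_le_torus b ht), h]
    exact_mod_cast yRoot_mem_lowerNonneg b j (mul_pos (inv_pos.mpr hr) ha)
  | one => simp [one_mem]
  | mul u u' _ _ h h' => convert mul_mem h h' using 1; group

theorem exists_xRoot_mul_torusPos {t : L ≃ₗ[ℂ] L} (ht : t ∈ torusPos b) (i : ι) {a : ℝ}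
    (ha : 0 < a) : ∃ a' : ℝ, 0 < a' ∧ xRoot b i a * t = t * xRoot b i a' := by
  obtain ⟨r, hr, h⟩ := exists_simpleRoot_eq b ht i
  refine ⟨r⁻¹ * a, mul_pos (inv_pos.mpr hr) ha, ?_⟩
  have hr' : (r : ℂ) ≠ 0 := by exact_mod_cast hr.ne'
  have h1 := torus_conj_xRoot b (torusPos_le_torus b ht) i ((r⁻¹ * a : ℝ) : ℂ)
  rw [h] at h1
  push_cast at h1
  rw [mul_inv_cancel_left₀ hr'] at h1
  rw [← h1]
  push_cast
  group

/-- Moving `x_i(s)` past a totally nonnegative element `u` of `U⁻` is possible within the totally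
nonnegative elements also for negative `s`, as long as `1 + s χ_i⁻(u)` remains positive. If
`χ_i⁻(u) = 0`, then `u` is a product of factors `y_j(a)` with `j ≠ i`, as no cancellation can occur
in `χ_i⁻(u)`. -/
theorem exists_xRoot_mul_lowerNonneg (i : ι) {u : L ≃ₗ[ℂ] L} (hu : u ∈ lowerNonneg b) :
    ∃ A : ℝ, 0 ≤ A ∧ lowerChar b i u = A ∧
      (A = 0 → ∀ h : H, (∀ j, j ≠ i → b.baseSupp j h = 0) → u h = h) ∧
      ∀ s : ℝ, 0 < 1 + s * A → ∃ u' ∈ lowerNonneg b, ∃ t' ∈ torusPos b,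
        xRoot b i s * u = u' * t' * xRoot b i (s / (1 + s * A) : ℝ) := by
  classical
  induction hu using Submonoid.closure_induction_left with
  | one =>
    refine ⟨0, le_rfl, ?_, fun _ _ _ => rfl, fun s _ => ⟨1, one_mem _, 1, one_mem _, by simp⟩⟩
    have h1 := lowerChar_mul b i (one_mem (unipLower b)) (one_mem (unipLower b))
    rw [mul_one] at h1
    rw [Complex.ofReal_zero]
    linear_combination -h1
  | mul_left g hg u hu ih =>
    obtain ⟨j, a, ha, rfl⟩ := hg
    obtain ⟨A, hA, hAu, hfix, hmove⟩ := ih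
    have hchar := lowerChar_mul b i (yRoot_mem_unipLower b j a) (lowerNonneg_le_unipLower b hu)
    rw [lowerChar_yRoot, hAu] at hchar
    by_cases hij : i = j
    · subst hij
      rw [if_pos rfl] at hchar
      refine ⟨a + A, by positivity, by rw [hchar]; push_cast; rfl, fun h => by linarith,
        fun s hs => ?_⟩
      -- For negative `s` this follows from `a ≤ a + A`.
      have hsa : 0 < 1 + s * a := by
        rcases le_or_gt 0 s with h | h
        · positivity
        · nlinarith
      have h1 := xRoot_mul_yRoot b i (s := s) (a := a) (by exact_mod_cast hsa.ne')
      have h2 : 1 + s / (1 + s * a) * A = (1 + s * (a + A)) / (1 + s * a) := by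
        field_simp
        ring
      obtain ⟨u', hu', t', ht', h3⟩ := hmove (s / (1 + s * a)) (by rw [h2]; positivity)
      have h4 : s / (1 + s * a) / (1 + s / (1 + s * a) * A) = s / (1 + s * (a + A)) := by
        rw [h2, div_div_div_cancel_right₀ hsa.ne']
      rw [h4] at h3
      have hcor := simpleCoroot_mem_torusPos b i hsa
      refine ⟨yRoot b i (a / (1 + s * a) : ℝ) * (simpleCoroot b i (1 + s * a : ℝ) * u' *
        (simpleCoroot b i (1 + s * a : ℝ))⁻¹), mul_mem (yRoot_mem_lowerNonneg b i (by positivity))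
        (torusPos_conj_mem_lowerNonneg b hcor hu'), _, mul_mem hcor ht', ?_⟩
      rw [← mul_assoc, h1]
      push_cast at h3 ⊢
      rw [mul_assoc _ _ u, h3]
      group
    · rw [if_neg hij, zero_add] at hchar
      refine ⟨A, hA, hchar, fun h0 h hh => ?_, fun s hs => ?_⟩
      · rw [LinearEquiv.mul_apply, hfix h0 h hh, yRoot_apply_cartan, hh j (Ne.symm hij), mul_zero,
          zero_smul, add_zero]
      · obtain ⟨u', hu', t', ht', h3⟩ := hmove s hs
        refine ⟨yRoot b j a * u', mul_mem (yRoot_mem_lowerNonneg b j ha) hu', t', ht', ?_⟩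
        rw [← mul_assoc, xRoot_mul_yRoot_of_ne b hij, mul_assoc, h3]
        group

theorem exists_gauss_of_mem_groupNonneg {g : L ≃ₗ[ℂ] L} (hg : g ∈ groupNonneg b) :
    ∃ u ∈ lowerNonneg b, ∃ t ∈ torusPos b, ∃ n ∈ upperNonneg b, g = u * t * n := by
  induction hg using Submonoid.closure_induction_left with
  | one => exact ⟨1, one_mem _, 1, one_mem _, 1, one_mem _, by simp⟩
  | mul_left k hk g _ ih =>
    obtain ⟨u, hu, t, ht, n, hn, rfl⟩ := ih
    obtain ⟨i, a, ha, rfl | rfl | rfl⟩ := hk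
    · have hcor := simpleCoroot_mem_torusPos b i ha
      exact ⟨_, torusPos_conj_mem_lowerNonneg b hcor hu, _, mul_mem hcor ht, n, hn, by group⟩
    · obtain ⟨A, hA, -, -, hmove⟩ := exists_xRoot_mul_lowerNonneg b i hu
      have hpos : 0 < 1 + a * A := by positivity
      obtain ⟨u', hu', t', ht', h1⟩ := hmove a hpos
      obtain ⟨a', ha', h2⟩ := exists_xRoot_mul_torusPos b ht i (div_pos ha hpos)
      refine ⟨u', hu', _, mul_mem ht' ht, _, mul_mem (xRoot_mem_upperNonneg b i ha') hn, ?_⟩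
      calc xRoot b i a * (u * t * n) = (xRoot b i a * u) * t * n := by group
        _ = u' * t' * (xRoot b i (a / (1 + a * A) : ℝ) * t) * n := by rw [h1]; group
        _ = _ := by rw [h2]; group
    · exact ⟨_, mul_mem (yRoot_mem_lowerNonneg b i ha) hu, t, ht, n, hn, by group⟩

/-- The totally nonnegative elements of `B⁻` have totally nonnegative components in `U⁻` and `T`. -/
theorem exists_eq_mul_of_mem_borelMinus_of_mem_groupNonneg {g : L ≃ₗ[ℂ] L}
    (hg : g ∈ borelMinus b) (hg' : g ∈ groupNonneg b) :
    ∃ u ∈ lowerNonneg b, ∃ t ∈ torusPos b, g = u * t := by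
  obtain ⟨u, hu, t, ht, n, hn, rfl⟩ := exists_gauss_of_mem_groupNonneg b hg'
  -- The factor in `U` lies in `U ∩ B⁻ = 1`.
  have h1 : n ∈ borelMinus b := by
    have h2 := mul_mem_borelMinus b (inv_mem_borelMinus b (g := u * t)
      ⟨u, lowerNonneg_le_unipLower b hu, t, torusPos_le_torus b ht, rfl⟩) hg
    rwa [inv_mul_cancel_left] at h2
  rw [eq_one_of_mem_unipUpper_of_mem_borelMinus b (upperNonneg_le_unipUpper b hn) h1, mul_one]
  exact ⟨u, hu, t, ht, rfl⟩

theorem exists_phi_eq_of_mem_groupNonneg {g : L ≃ₗ[ℂ] L} (hg : g ∈ borelMinus b)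
    (hg' : g ∈ groupNonneg b) (i : ι) :
    ∃ A : ℝ, 0 ≤ A ∧ phi b i g = A ∧
      (A = 0 → ∀ h : H, (∀ j, j ≠ i → b.baseSupp j h = 0) → g h = h) := by
  obtain ⟨u, hu, t, ht, rfl⟩ := exists_eq_mul_of_mem_borelMinus_of_mem_groupNonneg b hg hg'
  obtain ⟨A, hA, h1, h2, -⟩ := exists_xRoot_mul_lowerNonneg b i hu
  refine ⟨A, hA, by rw [phi_mul b (lowerNonneg_le_unipLower b hu) (torusPos_le_torus b ht), h1],
    fun h0 h hh => ?_⟩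
  rw [LinearEquiv.mul_apply, (torusPos_le_torus b ht).2 h h.2, h2 h0 h hh]

/-- For real `c > 0` the map `e_i^c` preserves total nonnegativity: `1 + s φ_i = c` is positive for
`s = (c - 1) / φ_i`. -/
theorem eMap_mem_groupNonneg {g : L ≃ₗ[ℂ] L} (hg : g ∈ borelMinus b) (hg' : g ∈ groupNonneg b)
    {i : ι} (hφ : phi b i g ≠ 0) {c : ℝ} (hc : 0 < c) : eMap b i c g ∈ groupNonneg b := by
  obtain ⟨u, hu, t, ht, rfl⟩ := exists_eq_mul_of_mem_borelMinus_of_mem_groupNonneg b hg hg'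
  have hu' := lowerNonneg_le_unipLower b hu
  have ht' := torusPos_le_torus b ht
  obtain ⟨A, -, h1, -, hmove⟩ := exists_xRoot_mul_lowerNonneg b i hu
  rw [phi_mul b hu' ht', h1] at hφ
  have hA : A ≠ 0 := by exact_mod_cast hφ
  have hs : 1 + (c - 1) / A * A = c := by field_simp; ring
  obtain ⟨u₁, hu₁, t₁, ht₁, h2⟩ := hmove ((c - 1) / A) (by rwa [hs])
  rw [hs] at h2
  have hc' : (c : ℂ) ≠ 0 := by exact_mod_cast hc.ne'
  have hα := simpleRoot_ne_zero b ht' i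
  rw [eMap, eps_mul b hu' ht', phi_mul b hu' ht', h1]
  set α := simpleRoot b i t with hαdef
  push_cast at h2
  have h3 : xRoot b i ((c - 1) / A / c) * t * xRoot b i (((c : ℂ)⁻¹ - 1) / (A * α)) = t := by
    have h4 := torus_conj_xRoot b ht' i (((c : ℂ)⁻¹ - 1) / (A * α))
    have h5 : xRoot b i ((c - 1) / A / c) * (t * xRoot b i (((c : ℂ)⁻¹ - 1) / (A * α)) * t⁻¹) = 1 := by
      rw [h4, ← hαdef, ← xRoot_add, ← xRoot_zero b i]
      congr 1
      field_simp
      ring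
    calc _ = xRoot b i ((c - 1) / A / c) * (t * xRoot b i (((c : ℂ)⁻¹ - 1) / (A * α)) * t⁻¹) * t := by
          group
      _ = t := by rw [h5, one_mul]
  have h6 : xRoot b i ((c - 1) / A) * (u * t) * xRoot b i (((c : ℂ)⁻¹ - 1) / (A * α)) =
      u₁ * t₁ * t := by
    calc _ = (xRoot b i ((c - 1) / A) * u) * t * xRoot b i (((c : ℂ)⁻¹ - 1) / (A * α)) := by group
      _ = u₁ * t₁ * (xRoot b i ((c - 1) / A / c) * t * xRoot b i (((c : ℂ)⁻¹ - 1) / (A * α))) := by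
        rw [h2]; group
      _ = _ := by rw [h3]
  rw [h6]
  exact mul_mem (mul_mem (lowerNonneg_le_groupNonneg b hu₁) (torusPos_le_groupNonneg b ht₁))
    (torusPos_le_groupNonneg b ht)

omit [FiniteDimensional ℂ L] [IsSimple ℂ L] [H.IsCartanSubalgebra] in
theorem torus_mul_mem_borelMinus {t x : L ≃ₗ[ℂ] L} (ht : t ∈ torus H) (hx : x ∈ borelMinus b) :
    t * x ∈ borelMinus b :=
  mul_mem_borelMinus b (torus_subset_borelMinus b ht) hx

theorem phi_torus_mul {t x : L ≃ₗ[ℂ] L} (ht : t ∈ torus H) (hx : x ∈ borelMinus b) (i : ι) :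
    phi b i (t * x) = (simpleRoot b i t)⁻¹ * phi b i x := by
  obtain ⟨u, hu, t₀, ht₀, rfl⟩ := hx
  rw [show t * (u * t₀) = (t * u * t⁻¹) * (t * t₀) by group,
    phi_mul b (torus_conj_mem_unipLower b ht hu) (mul_mem ht ht₀), lowerChar_torus_conj b ht,
    phi_mul b hu ht₀]

omit [FiniteDimensional ℂ L] [IsSimple ℂ L] [H.IsCartanSubalgebra] in
theorem weight_torus_mul {t x : L ≃ₗ[ℂ] L} (ht : t ∈ torus H) (hx : x ∈ borelMinus b) :
    weight b (t * x) = t * weight b x := by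
  obtain ⟨u, hu, t₀, ht₀, rfl⟩ := hx
  rw [show t * (u * t₀) = (t * u * t⁻¹) * (t * t₀) by group,
    weight_mul b (torus_conj_mem_unipLower b ht hu) (mul_mem ht ht₀), weight_mul b hu ht₀]

theorem eMap_torus_mul {t x : L ≃ₗ[ℂ] L} (ht : t ∈ torus H) (hx : x ∈ borelMinus b) (i : ι)
    (c : ℂ) : eMap b i c (t * x) = t * eMap b i c x := by
  have hα := simpleRoot_ne_zero b ht i
  have h1 : xRoot b i ((c - 1) / phi b i (t * x)) * t = t * xRoot b i ((c - 1) / phi b i x) := by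
    have h2 := torus_conj_xRoot b ht i ((c - 1) / phi b i x)
    rw [phi_torus_mul b ht hx, div_mul_eq_div_div, div_inv_eq_mul, mul_comm (c - 1),
      mul_div_assoc, ← h2, inv_mul_cancel_right]
  have h2 : eps b i (t * x) = eps b i x := by
    rw [eps, eps, phi_torus_mul b ht hx, weight_torus_mul b ht hx,
      simpleRoot_mul b ht (weight_mem_torus b hx)]
    field_simp
  rw [eMap, eMap, h2, ← mul_assoc, h1]
  group

end Positive

/-! ### The longest element of the Weyl group -/

section WeylGroup

variable {L : Type*} [LieRing L] [LieAlgebra ℂ L] [FiniteDimensional ℂ L] [IsSimple ℂ L]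
  {H : LieSubalgebra ℂ L} [H.IsCartanSubalgebra] {ι : Type*} [Fintype ι] (b : LieAlgebra.Basis ι H)

theorem root_baseSupp' (i : ι) : (IsKilling.rootSystem H).root (b.baseSupp' i) = b.baseSupp i := rfl

theorem coroot_baseSupp' (i : ι) :
    (IsKilling.rootSystem H).coroot (b.baseSupp' i) = b.h' i :=
  b.coroot_eq_h' i

theorem simpleReflection_smul_eq_reflection (i : ι) (μ : Module.Dual ℂ H) :
    simpleReflection b i • μ = (IsKilling.rootSystem H).reflection (b.baseSupp' i) μ := rfl

theorem simpleReflection_smul (i : ι) (μ : Module.Dual ℂ H) :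
    simpleReflection b i • μ = μ - μ (b.h' i) • b.baseSupp i := by
  rw [simpleReflection_smul_eq_reflection, RootPairing.reflection_apply, root_baseSupp',
    ← coroot_baseSupp']
  rfl

theorem simpleReflection_smul_smul (i : ι) (μ : Module.Dual ℂ H) :
    simpleReflection b i • simpleReflection b i • μ = μ := by
  rw [simpleReflection_smul_eq_reflection, simpleReflection_smul_eq_reflection,
    RootPairing.reflection_same]

theorem weylGroup_ext {w w' : (IsKilling.rootSystem H).weylGroup}
    (h : ∀ μ : Module.Dual ℂ H, w • μ = w' • μ) : w = w' := by
  refine Subtype.ext (RootPairing.Equiv.weightHom_injective _ ?_)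
  ext μ : 1
  exact h μ

theorem simpleReflection_mul_self (i : ι) : simpleReflection b i * simpleReflection b i = 1 :=
  weylGroup_ext fun μ => by rw [mul_smul, simpleReflection_smul_smul, one_smul]

theorem exists_wordProd_eq {J : Set ι} {w : (IsKilling.rootSystem H).weylGroup}
    (hw : w ∈ parabolicSubgroup b J) : ∃ js : List ι, wordProd b js = w := by
  have hinv : ∀ i, (simpleReflection b i)⁻¹ = simpleReflection b i := fun i =>
    inv_eq_of_mul_eq_one_left (simpleReflection_mul_self b i)
  induction hw using Subgroup.closure_induction'' with
  | mem g hg =>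
    obtain ⟨i, -, rfl⟩ := hg
    exact ⟨[i], by simp [wordProd]⟩
  | inv_mem g hg =>
    obtain ⟨i, -, rfl⟩ := hg
    exact ⟨[i], by simp [wordProd, hinv]⟩
  | one => exact ⟨[], by simp [wordProd]⟩
  | mul g g' _ _ hg hg' =>
    obtain ⟨js, rfl⟩ := hg
    obtain ⟨js', rfl⟩ := hg'
    exact ⟨js ++ js', by simp [wordProd]⟩

theorem wordProd_cons (j : ι) (js : List ι) :
    wordProd b (j :: js) = simpleReflection b j * wordProd b js := by
  simp [wordProd]

theorem simpleReflection_smul_root (i : ι) (k : H.root) :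
    simpleReflection b i • (IsKilling.rootSystem H).root k =
      (IsKilling.rootSystem H).root ((IsKilling.rootSystem H).reflectionPerm (b.baseSupp' i) k) := by
  rw [simpleReflection_smul_eq_reflection, RootPairing.root_reflectionPerm]

/-- The conjugate `w s_β w⁻¹` of a reflection is the reflection in the root `w β`. -/
theorem reflection_wordProd_smul (js : List ι) {k m : H.root}
    (hk : (IsKilling.rootSystem H).root k = wordProd b js • (IsKilling.rootSystem H).root m)
    (μ : Module.Dual ℂ H) :
    (IsKilling.rootSystem H).reflection k (wordProd b js • μ) =
      wordProd b js • (IsKilling.rootSystem H).reflection m μ := by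
  induction js generalizing k with
  | nil =>
    have : k = m := (IsKilling.rootSystem H).root.injective (by simpa [wordProd] using hk)
    subst this
    simp [wordProd]
  | cons j js ih =>
    rw [wordProd_cons, mul_smul] at hk
    set k' := (IsKilling.rootSystem H).reflectionPerm (b.baseSupp' j) k with hk'
    have h1 : (IsKilling.rootSystem H).root k' =
        wordProd b js • (IsKilling.rootSystem H).root m := by
      rw [hk', ← simpleReflection_smul_root, hk, simpleReflection_smul_smul]
    have h2 : k = (IsKilling.rootSystem H).reflectionPerm (b.baseSupp' j) k' := by
      rw [hk', RootPairing.reflectionPerm_self]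
    rw [h2, RootPairing.reflection_reflectionPerm, wordProd_cons, mul_smul, mul_smul, ← ih h1]
    simp only [LinearEquiv.mul_apply,
      ← simpleReflection_smul_eq_reflection, simpleReflection_smul_smul]

/-- The exchange property: if `s_{j_1} ⋯ s_{j_m} α_i` is a negative root, then multiplication by `s_i`
on the right amounts to deleting a letter of the word. -/
theorem exists_wordProd_mul_simpleReflection (js : List ι) {i : ι} {k : H.root}
    (hk : (IsKilling.rootSystem H).root k = wordProd b js • b.baseSupp i)
    (hneg : ¬ b.base.IsPos k) :
    ∃ js' : List ι, js'.length + 1 = js.length ∧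
      wordProd b js * simpleReflection b i = wordProd b js' := by
  have hmem : ∀ j, b.baseSupp' j ∈ b.base.support := fun j => (b.baseSupportEquiv j).2
  induction js generalizing k with
  | nil =>
    have : k = b.baseSupp' i :=
      (IsKilling.rootSystem H).root.injective (by simpa [wordProd] using hk)
    subst this
    exact absurd (b.base.isPos_of_mem_support (hmem i)) hneg
  | cons j js ih =>
    rw [wordProd_cons, mul_smul] at hk
    set k' := (IsKilling.rootSystem H).reflectionPerm (b.baseSupp' j) k with hk'
    have h1 : (IsKilling.rootSystem H).root k' = wordProd b js • b.baseSupp i := by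
      rw [hk', ← simpleReflection_smul_root, hk, simpleReflection_smul_smul]
    by_cases hpos : b.base.IsPos k'
    · -- `s_j` permutes the positive roots other than `α_j`.
      have h2 : k' = b.baseSupp' j := by
        by_contra hne
        have h3 := hpos.reflectionPerm (hmem j) hne
        rw [hk', RootPairing.reflectionPerm_self] at h3
        exact hneg h3
      refine ⟨js, rfl, weylGroup_ext fun μ => ?_⟩
      rw [wordProd_cons, mul_smul, mul_smul, simpleReflection_smul_eq_reflection b i,
        ← reflection_wordProd_smul b js (h1.trans (by rw [root_baseSupp'])), h2,
        ← simpleReflection_smul_eq_reflection, simpleReflection_smul_smul]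
    · obtain ⟨js', hlen, h2⟩ := ih h1 hpos
      exact ⟨j :: js', by simp [hlen], by rw [wordProd_cons, mul_assoc, h2, wordProd_cons]⟩

theorem IsLongest.not_isPos {w₀ : (IsKilling.rootSystem H).weylGroup}
    (hw : IsLongest b Set.univ w₀) {i : ι} {k : H.root}
    (hk : (IsKilling.rootSystem H).root k = w₀ • b.baseSupp i) : ¬ b.base.IsPos k := by
  intro hpos
  have hv : w₀ * simpleReflection b i ∈ parabolicSubgroup b Set.univ :=
    mul_mem hw.1 (Subgroup.subset_closure ⟨i, trivial, rfl⟩)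
  obtain ⟨ks, hks⟩ := exists_wordProd_eq b hv
  obtain ⟨js, hlen, hjs⟩ := Nat.sInf_mem
    (s := {n | ∃ js : List ι, js.length = n ∧ wordProd b js = w₀ * simpleReflection b i})
    ⟨_, ks, rfl, hks⟩
  change js.length = weylLength b (w₀ * simpleReflection b i) at hlen
  let := (IsKilling.rootSystem H).indexNeg
  have h1 : simpleReflection b i • b.baseSupp i = -b.baseSupp i := by
    rw [simpleReflection_smul, baseSupp_h'_self, two_smul]
    abel
  have h2 : (IsKilling.rootSystem H).root (-k) = wordProd b js • b.baseSupp i := by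
    rw [hjs, mul_smul, h1, smul_neg, ← hk, RootPairing.indexNeg_neg, RootPairing.root_reflectionPerm,
      RootPairing.reflection_apply_self]
  obtain ⟨js', hlen', h3⟩ := exists_wordProd_mul_simpleReflection b js h2
    (by rw [RootPairing.Base.IsPos.neg_iff_not, not_not]; exact hpos)
  rw [hjs, mul_assoc, simpleReflection_mul_self, mul_one] at h3
  have h4 : weylLength b w₀ ≤ js'.length := Nat.sInf_le ⟨js', rfl, h3.symm⟩
  have h5 := hw.2 _ hv
  lia

theorem neg_root_mem_closure {k : H.root} (hk : ¬ b.base.IsPos k) :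
    -(IsKilling.rootSystem H).root k ∈ AddSubmonoid.closure (Set.range b.baseSupp) := by
  have hsum : ∀ f : H.root → ℕ, ∑ j ∈ b.base.support, f j • (IsKilling.rootSystem H).root j ∈
      AddSubmonoid.closure (Set.range b.baseSupp) := by
    refine fun f => sum_mem fun j hj => nsmul_mem (AddSubmonoid.subset_closure ?_) _
    obtain ⟨i, hi⟩ := b.baseSupportEquiv.surjective ⟨j, hj⟩
    exact ⟨i, by rw [show j = b.baseSupp' i from (congrArg Subtype.val hi).symm, root_baseSupp']⟩
  obtain ⟨f, -, h | h⟩ := b.base.exists_root_eq_sum_nat_or_neg k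
  · refine absurd ?_ hk
    rw [RootPairing.Base.isPos_iff', RootPairing.Base.height_eq_sum (f := fun j => (f j : ℤ))
      (by simpa using h)]
    positivity
  · rw [h, neg_neg]
    exact hsum f

/-- The longest element maps the positive roots to negative roots. -/
theorem IsLongest.neg_smul_mem_closure {w₀ : (IsKilling.rootSystem H).weylGroup}
    (hw : IsLongest b Set.univ w₀) {μ : Module.Dual ℂ H}
    (hμ : μ ∈ AddSubmonoid.closure (Set.range b.baseSupp)) :
    -(w₀ • μ) ∈ AddSubmonoid.closure (Set.range b.baseSupp) := by
  induction hμ using AddSubmonoid.closure_induction with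
  | mem x hx =>
    obtain ⟨i, rfl⟩ := hx
    have h1 := RootPairing.weylGroup_apply_root (IsKilling.rootSystem H) w₀ (b.baseSupp' i)
    rw [root_baseSupp'] at h1
    rw [h1]
    exact neg_root_mem_closure b (hw.not_isPos b h1.symm)
  | zero => simp [zero_mem]
  | add x y _ _ hx hy =>
    rw [smul_add, neg_add]
    exact add_mem hx hy

/-- `W_J` fixes the elements of `H` at which the simple roots in `J` vanish. -/
theorem smul_apply_of_mem_parabolicSubgroup {J : Set ι} {w : (IsKilling.rootSystem H).weylGroup}
    (hw : w ∈ parabolicSubgroup b J) {h : H} (hh : ∀ j ∈ J, b.baseSupp j h = 0)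
    (μ : Module.Dual ℂ H) : (w • μ) h = μ h := by
  induction hw using Subgroup.closure_induction generalizing μ with
  | mem g hg =>
    obtain ⟨j, hj, rfl⟩ := hg
    rw [simpleReflection_smul, LinearMap.sub_apply, LinearMap.smul_apply, hh j hj, smul_zero,
      sub_zero]
  | one => rw [one_smul]
  | mul g g' _ _ hg hg' => rw [mul_smul, hg, hg']
  | inv g _ hg => rw [← hg (g⁻¹ • μ), smul_inv_smul]

/-- The representative of `w` acts on `H` as `w`. -/
theorem exists_inv_wBar_apply (js : List ι) (h : H) :
    ∃ h' : H, (wBar b js)⁻¹ h = h' ∧ ∀ μ : Module.Dual ℂ H, μ h' = (wordProd b js • μ) h := by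
  induction js generalizing h with
  | nil => exact ⟨h, by simp [wBar], fun μ => by simp [wordProd]⟩
  | cons j js ih =>
    let k : H := h - b.baseSupp j h • b.h' j
    have h1 : sBar b j k = h := by
      have h2 : b.baseSupp j k = -b.baseSupp j h := by
        simp only [k, map_sub, map_smul, baseSupp_h'_self, smul_eq_mul]
        ring
      rw [sBar_eq_nRoot, nRoot_apply_cartan b j (by norm_num), h2]
      simp [k, coe_h']
    obtain ⟨h', hh', hμ⟩ := ih k
    refine ⟨h', ?_, fun μ => ?_⟩
    · rw [← hh', ← h1]
      simp only [wBar, List.map_cons, List.prod_cons, mul_inv_rev, LinearEquiv.mul_apply]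
      rw [inv_apply_self']
    · rw [hμ, wordProd_cons, mul_smul, simpleReflection_smul]
      simp only [k, map_sub, map_smul, smul_eq_mul, LinearMap.sub_apply, LinearMap.smul_apply]
      ring

end WeylGroup

/-! ### Positivity of `φ_i` -/

section Support

variable {L : Type*} [LieRing L] [LieAlgebra ℂ L] [FiniteDimensional ℂ L] [IsSimple ℂ L]
  {H : LieSubalgebra ℂ L} [H.IsCartanSubalgebra] {ι : Type*} [Fintype ι] (b : LieAlgebra.Basis ι H)

theorem root_mem_closure_or (β : H.root) :
    (IsKilling.rootSystem H).root β ∈ AddSubmonoid.closure (Set.range b.baseSupp) ∨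
      -(IsKilling.rootSystem H).root β ∈ AddSubmonoid.closure (Set.range b.baseSupp) := by
  have h := b.root_mem_or_mem_neg β
  rwa [show (IsKilling.rootSystem H).root '' Set.range b.baseSupp' = Set.range b.baseSupp by
    rw [← Set.range_comp]; rfl] at h

omit [FiniteDimensional ℂ L] [IsSimple ℂ L] [H.IsCartanSubalgebra] in
theorem exists_nat_apply_eq {h : H} (hh : ∀ i, ∃ n : ℕ, b.baseSupp i h = n)
    {μ : Module.Dual ℂ H} (hμ : μ ∈ AddSubmonoid.closure (Set.range b.baseSupp)) :
    ∃ n : ℕ, μ h = n := by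
  induction hμ using AddSubmonoid.closure_induction with
  | mem x hx =>
    obtain ⟨i, rfl⟩ := hx
    exact hh i
  | zero => exact ⟨0, by simp⟩
  | add x y _ _ hx hy =>
    obtain ⟨m, hm⟩ := hx
    obtain ⟨n, hn⟩ := hy
    exact ⟨m + n, by rw [LinearMap.add_apply, hm, hn, Nat.cast_add]⟩

theorem killingForm_cartan_eq_sum (h h' : H) :
    killingForm ℂ L h h' = ∑ β ∈ H.root, β h * β h' := by
  have h1 := LinearMap.congr_fun₂ (IsKilling.restrict_killingForm_eq_sum (K := ℂ) (L := L) (H := H))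
    h h'
  rw [LinearMap.sum_apply, LinearMap.sum_apply] at h1
  exact h1

theorem lie_lie_eq_zero {h h' : H}
    (hroot : ∀ β ∈ H.root, β h * β h' = 0) (x : L) :
    ⁅(h : L), ⁅(h' : L), x⁆⁆ = 0 := by
  have hx : x ∈ ⨆ χ : LieModule.Weight ℂ H L, LieModule.genWeightSpace L χ := by
    rw [LieModule.iSup_genWeightSpace_eq_top']; trivial
  induction hx using LieSubmodule.iSup_induction' with
  | mem χ x hx =>
    have h1 := IsKilling.lie_eq_smul_of_mem_rootSpace hx
    by_cases hχ : χ.IsNonZero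
    · have h2 := hroot χ (by simpa using hχ)
      change χ h * χ h' = 0 at h2
      change ⁅h, ⁅h', x⁆⁆ = 0
      rw [h1, lie_smul, h1, smul_smul, mul_comm, h2, zero_smul]
    · have h3 : χ h' = 0 := by
        rw [LieModule.Weight.IsNonZero, not_not] at hχ
        rw [hχ, Pi.zero_apply]
      change ⁅h, ⁅h', x⁆⁆ = 0
      rw [h1, h3, zero_smul, lie_zero]
  | zero => simp
  | add x y _ _ hx hy => rw [lie_add, lie_add, hx, hy, add_zero]

omit [FiniteDimensional ℂ L] [IsSimple ℂ L] in
/-- The subalgebra generated by the image of `ad h` is an ideal, for `h` defining a grading. -/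
theorem lie_mem_lieSpan_range_ad {h : L} (hh : IsGrading h) (x : L) {y : L}
    (hy : y ∈ lieSpan ℂ L (Set.range (ad ℂ L h))) :
    ⁅x, y⁆ ∈ lieSpan ℂ L (Set.range (ad ℂ L h)) := by
  refine hh.induction (p := fun x => ⁅x, y⁆ ∈ lieSpan ℂ L (Set.range (ad ℂ L h)))
    (fun m x hx => ?_) (fun x x' hx hx' => by rw [add_lie]; exact add_mem hx hx') x
  rw [mem_gradedPiece] at hx
  by_cases hm : m = 0
  · subst hm
    rw [Int.cast_zero, zero_smul] at hx
    induction hy using lieSpan_induction with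
    | mem y hy =>
      obtain ⟨z, rfl⟩ := hy
      refine subset_lieSpan ⟨⁅x, z⁆, ?_⟩
      rw [ad_apply, ad_apply, leibniz_lie, hx, zero_lie, zero_add]
    | zero => rw [lie_zero]; exact zero_mem _
    | add y z _ _ hy hz => rw [lie_add]; exact add_mem hy hz
    | smul a y _ hy => rw [lie_smul]; exact SMulMemClass.smul_mem _ hy
    | lie y z hy' hz' hy hz =>
      rw [leibniz_lie]
      exact add_mem (LieSubalgebra.lie_mem _ hy hz') (LieSubalgebra.lie_mem _ hy' hz)
  · refine LieSubalgebra.lie_mem _ (subset_lieSpan ⟨(m : ℂ)⁻¹ • x, ?_⟩) hy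
    rw [ad_apply, lie_smul, hx, smul_smul, inv_mul_cancel₀ (by exact_mod_cast hm), one_smul]

omit [FiniteDimensional ℂ L] [H.IsCartanSubalgebra] in
/-- As `L` is simple, the composite of `ad h'` and `ad h` is nonzero for nonzero integral `h`, `h'`:
otherwise `h'` centralizes the ideal generated by the image of `ad h`. -/
theorem exists_lie_lie_ne_zero {h h' : H} (hh : ∀ j, ∃ n : ℕ, b.baseSupp j h = n) {i k : ι}
    (hk : b.baseSupp k h ≠ 0) (hi : b.baseSupp i h' ≠ 0) : ∃ x : L, ⁅(h' : L), ⁅(h : L), x⁆⁆ ≠ 0 := by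
  by_contra! h0
  have hgr : IsGrading (h : L) := isGrading_of_int b fun j => by
    obtain ⟨n, hn⟩ := hh j
    exact ⟨n, by rw [hn]; norm_cast⟩
  let I : LieIdeal ℂ L :=
    { (lieSpan ℂ L (Set.range (ad ℂ L (h : L)))).toSubmodule with
      lie_mem := fun {x y} hy => lie_mem_lieSpan_range_ad hgr x hy }
  have hI : ∀ y ∈ I, ⁅(h' : L), y⁆ = 0 := by
    intro y hy
    change y ∈ lieSpan ℂ L (Set.range (ad ℂ L (h : L))) at hy
    induction hy using lieSpan_induction with
    | mem y hy =>
      obtain ⟨z, rfl⟩ := hy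
      exact h0 z
    | zero => rw [lie_zero]
    | add y z _ _ hy hz => rw [lie_add, hy, hz, add_zero]
    | smul a y _ hy => rw [lie_smul, hy, smul_zero]
    | lie y z _ _ hy hz => rw [leibniz_lie, hy, hz, zero_lie, lie_zero, add_zero]
  rcases LieAlgebra.IsSimple.eq_bot_or_eq_top I with h1 | h1
  · have h2 : ⁅(h : L), b.e k⁆ ∈ I := by
      change _ ∈ lieSpan ℂ L (Set.range (ad ℂ L (h : L)))
      exact subset_lieSpan ⟨b.e k, rfl⟩
    rw [h1, LieSubmodule.mem_bot, lie_cartan_e] at h2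
    exact smul_ne_zero hk (e_ne_zero b k) h2
  · have h2 := hI (b.e i) (by rw [h1]; trivial)
    rw [lie_cartan_e] at h2
    exact smul_ne_zero hi (e_ne_zero b i) h2

omit [FiniteDimensional ℂ L] [H.IsCartanSubalgebra] [IsSimple ℂ L] in
theorem killingForm_cartan_unipUpper {u : L ≃ₗ[ℂ] L} (hu : u ∈ unipUpper b) (h h' : H) :
    killingForm ℂ L h (u h') = killingForm ℂ L h h' := by
  have h1 := isLower_of_mem_unipUpper b hu 0 h'
    (gradedPiece_le_filtLE _ le_rfl (by rw [gradedPiece_neg, neg_zero]; exact cartan_mem_gradedPiece b _ h'))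
  have h2 := killingForm_gradedPiece_filtLE (by lia) (m := 0) (v := (h : L))
    (by rw [gradedPiece_neg, neg_zero]; exact cartan_mem_gradedPiece b _ h) h1
  rwa [map_sub, sub_eq_zero] at h2

omit [FiniteDimensional ℂ L] [H.IsCartanSubalgebra] [IsSimple ℂ L] in
theorem wBar_mem_lieAut (js : List ι) : wBar b js ∈ lieAut L := by
  refine list_prod_mem fun g hg => ?_
  obtain ⟨i, -, rfl⟩ := List.mem_map.mp hg
  rw [sBar_eq_nRoot]
  exact nRoot_mem_lieAut b i _

omit [FiniteDimensional ℂ L] [IsSimple ℂ L] [H.IsCartanSubalgebra] in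
/-- If `u₁ w̄ u₂` fixes `h'`, then the components of `h'` and `w̄ h'` in `H` agree. -/
theorem killingForm_eq_of_fixed {u₁ u₂ : L ≃ₗ[ℂ] L} (hu₁ : u₁ ∈ unipUpper b)
    (hu₂ : u₂ ∈ unipUpper b) {js : List ι} {h h' k : H}
    (hfix : (u₁ * wBar b js * u₂) h' = h') (hk : (wBar b js)⁻¹ h = k) :
    killingForm ℂ L h h' = killingForm ℂ L k h' := by
  have h1 : u₁⁻¹ h' = wBar b js (u₂ h') := by
    have h2 := congrArg (u₁⁻¹ : L ≃ₗ[ℂ] L) hfix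
    rw [LinearEquiv.mul_apply, LinearEquiv.mul_apply, inv_apply_self'] at h2
    exact h2.symm
  have h2 := killingForm_apply_left (inv_mem (wBar_mem_lieAut b js)) h (u₂ h')
  rw [← killingForm_cartan_unipUpper b (inv_mem hu₁), h1, ← killingForm_cartan_unipUpper b hu₂ k,
    ← hk, h2, inv_inv]

/-- `φ_i` does not vanish on the totally nonnegative part of `B⁻ ∩ U w̄_P U`. Otherwise `x` fixes
the fundamental coweight `ω_i`, and hence `κ(ω_k, ω_i) = κ(w_P⁻¹ ω_k, ω_i) = κ(w₀ ω_k, ω_i)` for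
`k ∉ I_P`. Here the left hand side is nonnegative and the right hand side is nonpositive, so both
vanish, which contradicts the simplicity of `L`. -/
theorem phi_ne_zero {IP : Set ι} (hIP : IP ≠ Set.univ) {ii : List ι}
    (hii : IsReducedWordWP b IP ii) {x : L ≃ₗ[ℂ] L} (hx : x ∈ bruhatCell b ii)
    (hx' : x ∈ groupNonneg b) (i : ι) : phi b i x ≠ 0 := by
  classical
  intro h0
  obtain ⟨A, -, hA, hfix⟩ := exists_phi_eq_of_mem_groupNonneg b hx.1 hx' i
  rw [h0] at hA
  obtain ⟨k, hk⟩ := (Set.ne_univ_iff_exists_notMem _).mp hIP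
  obtain ⟨ωi, hωi⟩ := exists_baseSupp_eq b fun j => if j = i then 1 else 0
  obtain ⟨ωk, hωk⟩ := exists_baseSupp_eq b fun j => if j = k then 1 else 0
  have hnat : ∀ {l : ι} {ω : H}, (∀ j, b.baseSupp j ω = if j = l then 1 else 0) →
      ∀ j, ∃ n : ℕ, b.baseSupp j ω = n := fun {l ω} h j => by
    rw [h j]
    split_ifs
    · exact ⟨1, by norm_cast⟩
    · exact ⟨0, by norm_cast⟩
  have hxω := hfix (by exact_mod_cast hA.symm) ωi fun j hj => by rw [hωi, if_neg hj]
  obtain ⟨-, u₁, hu₁, u₂, hu₂, rfl⟩ := hx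
  obtain ⟨ωk', hωk', hμ⟩ := exists_inv_wBar_apply b ii ωk
  have hκ := killingForm_eq_of_fixed b hu₁ hu₂ hxω hωk'
  rw [killingForm_cartan_eq_sum, killingForm_cartan_eq_sum] at hκ
  obtain ⟨w₀, w₀P, hw₀, hw₀P, hred, -⟩ := hii
  have hμ' : ∀ μ : Module.Dual ℂ H, μ ωk' = (w₀ • μ) ωk := fun μ => by
    rw [hμ, hred, mul_smul]
    refine smul_apply_of_mem_parabolicSubgroup b hw₀P.1 (fun j hj => ?_) _
    rw [hωk, if_neg]
    rintro rfl
    exact hk hj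
  have hterm : ∀ β : LieModule.Weight ℂ H L, β ∈ H.root → ∃ m n : ℕ,
      β ωk * β ωi = m ∧ β ωk' * β ωi = -(n : ℂ) := by
    intro β hβ
    have key : ∀ μ ∈ AddSubmonoid.closure (Set.range b.baseSupp),
        ∃ m n : ℕ, μ ωk * μ ωi = m ∧ μ ωk' * μ ωi = -(n : ℂ) := fun μ hmem => by
      obtain ⟨p, hp⟩ := exists_nat_apply_eq b (hnat hωk) hmem
      obtain ⟨q, hq⟩ := exists_nat_apply_eq b (hnat hωi) hmem
      obtain ⟨r, hr⟩ := exists_nat_apply_eq b (hnat hωk) (hw₀.neg_smul_mem_closure b hmem)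
      rw [LinearMap.neg_apply, ← hμ', neg_eq_iff_eq_neg] at hr
      exact ⟨p * q, r * q, by rw [hp, hq, Nat.cast_mul], by rw [hr, hq, Nat.cast_mul, neg_mul]⟩
    rcases root_mem_closure_or b ⟨β, hβ⟩ with h | h
    · exact key _ h
    · have h1 := key _ h
      simp only [LinearMap.neg_apply, neg_mul_neg] at h1
      exact h1
  choose! m n hm hn using hterm
  rw [Finset.sum_congr rfl hm, Finset.sum_congr rfl hn, Finset.sum_neg_distrib,
    eq_neg_iff_add_eq_zero, ← Finset.sum_add_distrib] at hκ
  have hκ' : ∑ β ∈ H.root, (m β + n β) = 0 := by exact_mod_cast hκ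
  -- A sum of natural numbers vanishes, so all of them do.
  obtain ⟨v, hv⟩ := exists_lie_lie_ne_zero b (hnat hωk) (i := i) (k := k) (h' := ωi)
    (by rw [hωk, if_pos rfl]; exact one_ne_zero) (by rw [hωi, if_pos rfl]; exact one_ne_zero)
  refine hv (lie_lie_eq_zero (fun β hβ => ?_) v)
  have h1 := Finset.sum_eq_zero_iff.mp hκ' β hβ
  rw [mul_comm, hm β hβ, Nat.eq_zero_of_add_eq_zero_right h1, Nat.cast_zero]

end Support

/-! ### The action on the totally positive part -/

section Final

variable {L : Type*} [LieRing L] [LieAlgebra ℂ L] [FiniteDimensional ℂ L] [IsSimple ℂ L]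
  {H : LieSubalgebra ℂ L} [H.IsCartanSubalgebra] {ι : Type*} [Fintype ι] (b : LieAlgebra.Basis ι H)

omit [FiniteDimensional ℂ L] [IsSimple ℂ L] [H.IsCartanSubalgebra] in
theorem crystalPos_subset_crystal {IP : Set ι} {ii : List ι} :
    crystalPos b IP ii ⊆ crystal b IP ii := by
  rintro _ ⟨t, ht, -, x, ⟨hx, u₁, hu₁, u₂, hu₂, rfl⟩, -, rfl⟩
  refine ⟨torus_mul_mem_borelMinus b ht.1 hx, t * u₁ * t⁻¹,
    torus_conj_mem_unipUpper b ht.1 hu₁, t, ht, u₂, hu₂, by group⟩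

theorem phi_ne_zero_of_mem_crystalPos {IP : Set ι} (hIP : IP ≠ Set.univ) {ii : List ι}
    (hii : IsReducedWordWP b IP ii) {x : L ≃ₗ[ℂ] L} (hx : x ∈ crystalPos b IP ii) (i : ι) :
    phi b i x ≠ 0 := by
  obtain ⟨t, ht, -, x, hx, hx', rfl⟩ := hx
  rw [phi_torus_mul b ht.1 hx.1]
  exact mul_ne_zero (inv_ne_zero (simpleRoot_ne_zero b ht.1 i)) (phi_ne_zero b hIP hii hx hx' i)

theorem eMap_mem_crystalPos {IP : Set ι} (hIP : IP ≠ Set.univ) {ii : List ι}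
    (hii : IsReducedWordWP b IP ii) {x : L ≃ₗ[ℂ] L} (hx : x ∈ crystalPos b IP ii) (i : ι)
    {c : ℝ} (hc : 0 < c) : eMap b i c x ∈ crystalPos b IP ii := by
  obtain ⟨t, ht, htpos, x, hx, hx', rfl⟩ := hx
  have hφ := phi_ne_zero b hIP hii hx hx' i
  refine ⟨t, ht, htpos, eMap b i c x, ⟨?_, ?_⟩, eMap_mem_groupNonneg b hx.1 hx' hφ hc,
    eMap_torus_mul b ht.1 hx.1 i c⟩
  · exact (eMap_spec b (by exact_mod_cast hc.ne') hx.1 hφ).1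
  · obtain ⟨-, u₁, hu₁, u₂, hu₂, hx⟩ := hx
    refine ⟨_, mul_mem (xRoot_mem_unipUpper b i ((c - 1) / phi b i x)) hu₁, _,
      mul_mem hu₂ (xRoot_mem_unipUpper b i (((c : ℂ)⁻¹ - 1) / eps b i x)), ?_⟩
    rw [eMap]
    generalize xRoot b i ((c - 1) / phi b i x) = g
    generalize xRoot b i (((c : ℂ)⁻¹ - 1) / eps b i x) = k
    rw [hx]
    simp only [mul_assoc]

theorem exists_simpleRoot_weight_eq {IP : Set ι} {ii : List ι} {x : L ≃ₗ[ℂ] L}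
    (hx : x ∈ crystalPos b IP ii) (i : ι) :
    ∃ r : ℝ, 0 < r ∧ simpleRoot b i (weight b x) = r := by
  obtain ⟨t, ht, htpos, x, hx, hx', rfl⟩ := hx
  obtain ⟨u, hu, t₀, ht₀, rfl⟩ :=
    exists_eq_mul_of_mem_borelMinus_of_mem_groupNonneg b hx.1 hx'
  rw [weight_torus_mul b ht.1 hx.1, weight_mul b (lowerNonneg_le_unipLower b hu)
    (torusPos_le_torus b ht₀)]
  exact exists_simpleRoot_eq b (mul_mem htpos ht₀) i

theorem eMap_mem_eAct {IP : Set ι} (hIP : IP ≠ Set.univ) {ii : List ι}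
    (hii : IsReducedWordWP b IP ii) {x : L ≃ₗ[ℂ] L} (hx : x ∈ crystalPos b IP ii) (i : ι)
    {c : ℂ} (hc : c ≠ 0) : eMap b i c x ∈ eAct b IP ii i c x := by
  have hφ := phi_ne_zero_of_mem_crystalPos b hIP hii hx i
  have hx' := crystalPos_subset_crystal b hx
  exact (mem_eAct_iff b).mpr ⟨⟨hx', hc, hφ, eps_ne_zero b hx'.1 hφ⟩, rfl⟩

theorem isRegularAt_eAct_const {IP : Set ι} (hIP : IP ≠ Set.univ) {ii : List ι}
    (hii : IsReducedWordWP b IP ii) {x : L ≃ₗ[ℂ] L} (hx : x ∈ crystalPos b IP ii) (i : ι)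
    {c : ℂ} (hc : c ≠ 0) : IsRegularAt (crystal b IP ii) (eAct b IP ii i c) x :=
  isRegularAt_eAct b (crystalPos_subset_crystal b hx)
    (phi_ne_zero_of_mem_crystalPos b hIP hii hx i) (c := fun _ => c) (fun _ _ => hc)
    fun _ _ _ => ⟨isFrac_const c, isFrac_const c⁻¹⟩

theorem image_eAct {IP : Set ι} (hIP : IP ≠ Set.univ) {ii : List ι}
    (hii : IsReducedWordWP b IP ii) (i : ι) {c : ℝ} (hc : 0 < c) :
    (eAct b IP ii i c).image (crystalPos b IP ii) = crystalPos b IP ii := by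
  have hc' : (c : ℂ) ≠ 0 := by exact_mod_cast hc.ne'
  ext z
  rw [PFun.mem_image]
  constructor
  · rintro ⟨x, hx, hz⟩
    obtain ⟨-, rfl⟩ := (mem_eAct_iff b).mp hz
    exact eMap_mem_crystalPos b hIP hii hx i hc
  · intro hz
    have hy := eMap_mem_crystalPos b hIP hii hz i (inv_pos.mpr hc)
    have h1 := eMap_mem_eAct b hIP hii hy i hc'
    rw [Complex.ofReal_inv] at h1 hy
    have h2 := eMap_inv_eMap b (inv_ne_zero hc') (crystalPos_subset_crystal b hz).1
      (phi_ne_zero_of_mem_crystalPos b hIP hii hz i)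
    rw [inv_inv] at h2
    rw [h2] at h1
    exact ⟨_, hy, h1⟩

theorem isRegularAt_sAct {IP : Set ι} (hIP : IP ≠ Set.univ) {ii : List ι}
    (hii : IsReducedWordWP b IP ii) {x : L ≃ₗ[ℂ] L} (hx : x ∈ crystalPos b IP ii) (i : ι) :
    IsRegularAt (crystal b IP ii) (sAct b IP ii i) x := by
  refine isRegularAt_eAct b (crystalPos_subset_crystal b hx)
    (phi_ne_zero_of_mem_crystalPos b hIP hii hx i)
    (c := fun y => 1 / simpleRoot b i (weight b y))
    (fun y hy => one_div_ne_zero (simpleRoot_weight_ne_zero b hy.1 i)) fun q _ hq => ?_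
  simp only [one_div, inv_inv]
  exact ⟨hq, ((isFrac_of_mem (matrixCoeff_mem_coordRing
    ((killingForm ℂ L (b.f i) (b.e i))⁻¹ • killingForm ℂ L (b.f i)) (b.e i))).congr
    fun y hy _ => by rw [simpleRoot_weight_eq b hy.1, div_eq_inv_mul]; rfl)⟩

/-- `s_i` is an involution of the totally positive part: with `c = 1 / α_i(γ(x))` the weight of
`e_i^c(x)` has `α_i`-value `c ^ 2 α_i(γ(x)) = c`. -/
theorem exists_mem_sAct {IP : Set ι} (hIP : IP ≠ Set.univ) {ii : List ι}
    (hii : IsReducedWordWP b IP ii) {x : L ≃ₗ[ℂ] L} (hx : x ∈ crystalPos b IP ii) (i : ι) :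
    ∃ z ∈ crystalPos b IP ii, z ∈ sAct b IP ii i x ∧ x ∈ sAct b IP ii i z := by
  obtain ⟨r, hr, hrx⟩ := exists_simpleRoot_weight_eq b hx i
  have hr' : (r : ℂ) ≠ 0 := by exact_mod_cast hr.ne'
  have hφ := phi_ne_zero_of_mem_crystalPos b hIP hii hx i
  have hxB := (crystalPos_subset_crystal b hx).1
  have hz := eMap_mem_crystalPos b hIP hii hx i (inv_pos.mpr hr)
  rw [Complex.ofReal_inv] at hz
  refine ⟨_, hz, ?_, ?_⟩
  · rw [sAct, hrx, one_div]
    exact eMap_mem_eAct b hIP hii hx i (inv_ne_zero hr')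
  · have h1 : 1 / simpleRoot b i (weight b (eMap b i (r : ℂ)⁻¹ x)) = r := by
      rw [simpleRoot_weight_eMap b (inv_ne_zero hr') hxB hφ, hrx]
      field_simp
    have h2 := eMap_mem_eAct b hIP hii hz i hr'
    have h3 := eMap_inv_eMap b (inv_ne_zero hr') hxB hφ
    rw [inv_inv] at h3
    rw [h3] at h2
    rwa [sAct, h1]

theorem exists_mem_wordAct {IP : Set ι} (hIP : IP ≠ Set.univ) {ii : List ι}
    (hii : IsReducedWordWP b IP ii) (js : List ι) {x : L ≃ₗ[ℂ] L} (hx : x ∈ crystalPos b IP ii) :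
    IsRegularAt (crystal b IP ii) (wordAct b IP ii js) x ∧
      ∃ z ∈ crystalPos b IP ii, z ∈ wordAct b IP ii js x := by
  induction js with
  | nil =>
    refine ⟨⟨crystalPos_subset_crystal b hx, 1, one_mem _, one_ne_zero,
      fun y hy _ => ⟨y, ⟨hy, rfl⟩, hy⟩, fun p hp => ⟨p, hp, 0, ?_⟩⟩, x, hx,
      crystalPos_subset_crystal b hx, rfl⟩
    rintro y - - _ ⟨-, rfl⟩
    simp [wordAct]
  | cons j js ih =>
    obtain ⟨hreg, z, hz, hzx⟩ := ih
    obtain ⟨z', hz', hz'z, -⟩ := exists_mem_sAct b hIP hii hz j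
    exact ⟨hreg.comp hzx (isRegularAt_sAct b hIP hii hz j), z', hz', by
      rw [wordAct, PFun.comp_apply]; exact Part.mem_bind hzx hz'z⟩

theorem exists_wordAct_eq {IP : Set ι} (hIP : IP ≠ Set.univ) {ii : List ι}
    (hii : IsReducedWordWP b IP ii) (js : List ι) {z : L ≃ₗ[ℂ] L} (hz : z ∈ crystalPos b IP ii) :
    ∃ x ∈ crystalPos b IP ii, z ∈ wordAct b IP ii js x := by
  induction js generalizing z with
  | nil => exact ⟨z, hz, crystalPos_subset_crystal b hz, rfl⟩
  | cons j js ih =>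
    obtain ⟨z', hz', -, h⟩ := exists_mem_sAct b hIP hii hz j
    obtain ⟨x, hx, hx'⟩ := ih hz'
    exact ⟨x, hx, by rw [wordAct, PFun.comp_apply]; exact Part.mem_bind hx' h⟩

theorem image_wordAct {IP : Set ι} (hIP : IP ≠ Set.univ) {ii : List ι}
    (hii : IsReducedWordWP b IP ii) (js : List ι) :
    (wordAct b IP ii js).image (crystalPos b IP ii) = crystalPos b IP ii := by
  ext z
  rw [PFun.mem_image]
  constructor
  · rintro ⟨x, hx, hzx⟩
    obtain ⟨-, z', hz', hz'x⟩ := exists_mem_wordAct b hIP hii js hx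
    rwa [Part.mem_unique hzx hz'x]
  · exact fun hz => exists_wordAct_eq b hIP hii js hz

end Final

end GeometricCrystal

end

theorem mainTheorem8 {L : Type*} [LieRing L] [LieAlgebra ℂ L] [FiniteDimensional ℂ L]
    [LieAlgebra.IsSimple ℂ L] {H : LieSubalgebra ℂ L} [H.IsCartanSubalgebra]
    {ι : Type*} [Fintype ι] (b : LieAlgebra.Basis ι H)
    (IP : Set ι) (hIP : IP ≠ Set.univ)
    (ii : List ι) (hii : GeometricCrystal.IsReducedWordWP b IP ii) :
    (∀ (i : ι) (c : ℝ), 0 < c →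
      (∀ x ∈ GeometricCrystal.crystalPos b IP ii,
        GeometricCrystal.IsRegularAt (GeometricCrystal.crystal b IP ii)
          (GeometricCrystal.eAct b IP ii i c) x) ∧
      (GeometricCrystal.eAct b IP ii i c).image (GeometricCrystal.crystalPos b IP ii) =
        GeometricCrystal.crystalPos b IP ii) ∧
    (∀ (w : (LieAlgebra.IsKilling.rootSystem H).weylGroup) (js : List ι),
      GeometricCrystal.wordProd b js = w →
      (∀ x ∈ GeometricCrystal.crystalPos b IP ii,
        GeometricCrystal.IsRegularAt (GeometricCrystal.crystal b IP ii)
          (GeometricCrystal.wordAct b IP ii js) x) ∧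
      (GeometricCrystal.wordAct b IP ii js).image (GeometricCrystal.crystalPos b IP ii) =
        GeometricCrystal.crystalPos b IP ii) := by
  refine ⟨fun i c hc => ⟨fun x hx => ?_, GeometricCrystal.image_eAct b hIP hii i hc⟩,
    fun w js _ => ⟨fun x hx => (GeometricCrystal.exists_mem_wordAct b hIP hii js hx).1,
      GeometricCrystal.image_wordAct b hIP hii js⟩⟩
  exact GeometricCrystal.isRegularAt_eAct_const b hIP hii hx i (by exact_mod_cast hc.ne')
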